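/- Let $N\ge 1$ be an integer, $\alpha\in(0,N)$ and $p\in(1,\infty)$ with $$\frac{N-2}{N+\alpha}<\frac1p<\frac{N}{N+\alpha}.$$ Let $I_\alpha(x)=\dfrac{\Gamma(\frac{N-\alpha}{2})}{\Gamma(\frac{\alpha}{2})\,\pi^{N/2}\,2^{\alpha}\,|x|^{N-\alpha}}$ be the Riesz potential on $\mathbb R^N$, and for real-valued $v\in W^{1,2}(\mathbb R^N)$ put $$E_{\alpha,p}(v)=\frac12\int_{\mathbb R^N}\bigl(|\nabla v|^2+|v|^2\bigr)-\frac1{2p}\int_{\mathbb R^N}(I_\alpha*|v|^p)\,|v|^p ,$$ where the nonlocal double integral converges for every such $v$, so that $E_{\alpha,p}$ is well defined. Then there exists $u\in W^{1,2}(\mathbb R^N)$, $u\neq0$, such that $$-\Delta u+u=(I_\alpha*|u|^p)\,|u|^{p-2}u\qquad\text{weakly in }\mathbb R^N,$$ that is, $I_\alpha*|u|^p$ is finite almost everywhere, the right-hand side is locally integrable, and $\int_{\mathbb R^N}\nabla u\cdot\nabla\varphi+u\varphi=\int_{\mathbb R^N}(I_\alpha*|u|^p)|u|^{p-2}u\,\varphi$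 for every $\varphi\in C_c^\infty(\mathbb R^N)$. Moreover, $u$ belongs to the set $$\mathcal N=\Bigl\{v\in W^{1,2}(\mathbb R^N)\setminus\{0\}:\int_{\mathbb R^N}|\nabla v|^2+|v|^2=\int_{\mathbb R^N}(I_\alpha*|v|^p)\,|v|^p\Bigr\}$$ and minimizes the energy on it: $$E_{\alpha,p}(u)=\min_{v\in\mathcal N}E_{\alpha,p}(v)=\inf_{v\in\mathcal N}E_{\alpha,p}(v).$$ -/

import Mathlib

open MeasureTheory Set
open scoped ContDiff

noncomputable section

namespace Choquard

/-- The Euclidean space of dimension `N`. -/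
abbrev RN (N : ℕ) : Type := EuclideanSpace ℝ (Fin N)

variable {N : ℕ}

/-- `φ` is a test function: smooth with compact support. -/
def IsTestFunction (φ : RN N → ℝ) : Prop :=
  ContDiff ℝ ∞ φ ∧ HasCompactSupport φ

/-- `g` is the weak (distributional) gradient of `u`, both being locally integrable. -/
def IsWeakGradient (u : RN N → ℝ) (g : RN N → RN N) : Prop :=
  LocallyIntegrable u ∧ LocallyIntegrable g ∧
    ∀ φ : RN N → ℝ, IsTestFunction φ →
      ∫ x, u x • gradient φ x = -∫ x, φ x • g x

/-- Weak gradients are unique almost everywhere. -/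
theorem IsWeakGradient.ae_eq {u : RN N → ℝ} {g h : RN N → RN N}
    (hg : IsWeakGradient u g) (hh : IsWeakGradient u h) : g =ᵐ[volume] h := by
  refine ae_eq_of_integral_contDiff_smul_eq hg.2.1 hh.2.1 fun φ hφ hc => ?_
  have h1 := hg.2.2 φ ⟨hφ, hc⟩
  rw [hh.2.2 φ ⟨hφ, hc⟩] at h1
  exact (neg_injective h1).symm

open scoped Classical in
/-- The weak gradient of `u` (unique up to null sets), and `0` if there is none. -/
def weakGrad (u : RN N → ℝ) : RN N → RN N :=
  if h : ∃ g, IsWeakGradient u g then h.choose else 0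

/-- `u` belongs to the Sobolev space `W^{1,2}` on `ℝ^N`. -/
def MemW12 (u : RN N → ℝ) : Prop :=
  MemLp u 2 volume ∧ ∃ g : RN N → RN N, IsWeakGradient u g ∧ MemLp g 2 volume

theorem IsWeakGradient.weakGrad_ae_eq {u : RN N → ℝ} {g : RN N → RN N}
    (hg : IsWeakGradient u g) : weakGrad u =ᵐ[volume] g := by
  have h : ∃ g, IsWeakGradient u g := ⟨g, hg⟩
  rw [weakGrad, dif_pos h]
  exact h.choose_spec.ae_eq hg

/-- The Riesz potential `I_α` on `ℝ^N` (its value at the single point `0` is irrelevant). -/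
def rieszKernel (α : ℝ) (x : RN N) : ℝ :=
  Real.Gamma ((N - α) / 2) /
    (Real.Gamma (α / 2) * Real.pi ^ ((N : ℝ) / 2) * 2 ^ α * ‖x‖ ^ ((N : ℝ) - α))

/-- The convolution `I_α * |u|^p`. -/
def rieszConv (α p : ℝ) (u : RN N → ℝ) : RN N → ℝ :=
  convolution (rieszKernel α) (fun y => |u y| ^ p) (ContinuousLinearMap.mul ℝ ℝ) volume

/-- `∫ |∇u|² + |u|²`. -/
def sobolevSq (u : RN N → ℝ) : ℝ :=
  ∫ x, (‖weakGrad u x‖ ^ 2 + |u x| ^ 2)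

/-- `∫ (I_α * |u|^p) |u|^p`. -/
def nonlocalTerm (α p : ℝ) (u : RN N → ℝ) : ℝ :=
  ∫ x, rieszConv α p u x * |u x| ^ p

/-- The energy `E_{α,p}`. -/
def energy (α p : ℝ) (u : RN N → ℝ) : ℝ :=
  1 / 2 * sobolevSq u - 1 / (2 * p) * nonlocalTerm α p u

/-- The functions `v ∈ W^{1,2} \ {0}` with `∫ |∇v|² + |v|² = ∫ (I_α * |v|^p) |v|^p`. -/
def nehariSet (N : ℕ) (α p : ℝ) : Set (RN N → ℝ) :=
  {v | MemW12 v ∧ ¬ v =ᵐ[volume] 0 ∧ sobolevSq v = nonlocalTerm α p v}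

/-- The right-hand side `(I_α * |u|^p) |u|^{p-2} u` of the Choquard equation. -/
def choquardRHS (α p : ℝ) (u : RN N → ℝ) (x : RN N) : ℝ :=
  rieszConv α p u x * (|u x| ^ (p - 2) * u x)

/-- `u ∈ W^{1,2}` satisfies `-Δu + u = (I_α * |u|^p) |u|^{p-2} u` weakly in `ℝ^N`. The convolution
is required to be finite almost everywhere and the right-hand side to be locally integrable. -/
def IsWeakSolution (α p : ℝ) (u : RN N → ℝ) : Prop :=
  MemW12 u ∧
  (∀ᵐ x, ConvolutionExistsAt (rieszKernel α) (fun y => |u y| ^ p) x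
    (ContinuousLinearMap.mul ℝ ℝ) volume) ∧
  LocallyIntegrable (choquardRHS α p u) ∧
  ∀ φ : RN N → ℝ, IsTestFunction φ →
    ∫ x, (inner ℝ (weakGrad u x) (gradient φ x) + u x * φ x) = ∫ x, choquardRHS α p u x * φ x

end Choquard

end

/-!
The proof maximizes the nonlocal term against the Sobolev norm. Write `S(v) = ∫ |∇v|² + |v|²`
(`sobolevSq`) and `D(v) = ∫∫ I_α(x - y) |v(x)|^p |v(y)|^p` (`doubleInt`). As `D` is homogeneous of
degree `2p` and `S` of degree `2`, there is an optimal constant `M` in `D(v) ≤ M S(v)^p`. A function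
for which equality holds, scaled so that `D = S`, lies on the Nehari set; it solves the equation,
since `M S^p - D` has a minimum there (`Admissible.isWeakSolution`); and it has the smallest energy,
because the energy on the Nehari set is `(1/2 - 1/(2p)) S` and `S = D ≤ M S^p` bounds `S` from below.
What has to be shown is that `M` is finite and attained (`Admissible.exists_maximizer`).

*Bounds on `D`.* The Riesz kernel is the sum of its parts inside and outside the unit ball, which
belong to `L^s` for `s` slightly smaller and slightly larger than `N / (N - α)`. For a kernel in
`L^s`, a pointwise Young inequality for the integrand (`mul_mul_le_young`) replaces the
Hardy–Littlewood–Sobolev inequality and bounds `D` by norms of `v` in `L^(p r)` with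
`2 / r + 1 / s = 2`; the condition on `p` makes both exponents `p r` larger than `2` and Sobolev
subcritical (`exists_near_exponents`, `exists_far_exponents`).

*Sobolev inequality and vanishing.* By the mean value inequality in `L²`, a Sobolev function differs
from its averages over balls of radius `t` by at most `t ‖∇v‖` in `L²`
(`SobolevPair.lintegral_sub_ballAvg_le`), while the averages themselves are bounded pointwise by any
`L^q` norm. Comparing the two on the dyadic level sets of `|v|` improves an `L^q` bound to an
`L^(q')` bound for all `q' < 2 + 2 q / N`, and iteration gives the embedding for all subcritical
exponents (`hasSobolevBound`). The same comparison shows that a function in the unit ball with small ball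
averages is small in `L^q` (`exists_small_of_ballAvg_small`), so that `D` cannot stay away from zero
on such functions (`Admissible.exists_ballAvg_lower_bound`).

*Attainment.* A maximizing sequence in the unit ball of `W^{1,2}` can therefore be translated so that
one fixed ball average stays away from zero. A subsequence converges weakly and almost everywhere to
some `u ≠ 0`, and `S(v_n - u) - S(v_n) → -S(u)` (`exists_subseq_sobolev`). A one-sided nonlocal
Brezis–Lieb inequality (`eventually_doubleInt_le`) yields `M ≤ M (1 - S(u))^p + D(u)`, and with
`D(u) ≤ M S(u)^p` the strict superadditivity of `σ ↦ σ^p` forces `S(u) = 1`, hence `D(u) = M`.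
-/

open MeasureTheory Set Filter Topology
open scoped ContDiff NNReal ENNReal

noncomputable section

namespace Choquard

variable {N : ℕ}

/-! ### Pointwise inequalities -/

/-- Young's inequality for the integrand of a double integral. The exponents are those of the Young
convolution inequality, and the constant in front of every term containing `a` can be made small. -/
theorem mul_mul_le_young {r s : ℝ} (hr : 1 < r) (hs : 1 < s) (hrs : 2 / r + 1 / s = 2)
    {η : ℝ≥0} (hη : 0 < η) :
    ∃ C : ℝ≥0, ∀ κ a b : ℝ≥0,
      κ * a * b ≤ η * (a ^ r * b ^ r + a ^ r * κ ^ s) + C * (b ^ r * κ ^ s) := by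
  have hr0 : 0 < r := by linarith
  have hs0 : 0 < s := by linarith
  set t : ℝ := 1 - 1 / r with ht
  have ht0 : 0 < t := by
    have : 1 / r < 1 := by rw [div_lt_one hr0]; exact hr
    linarith
  set t' : ℝ := 1 - 1 / s with ht'
  have ht'0 : 0 < t' := by
    have : 1 / s < 1 := by rw [div_lt_one hs0]; exact hs
    linarith
  have hsum : t' + t + t = 1 := by
    have : 2 / r = 2 * (1 / r) := by ring
    rw [ht, ht']; linarith
  have e1 : r * t' + r * t = 1 := by
    have h : t' + t = 1 / r := by linarith
    rw [← mul_add, h, mul_one_div_cancel hr0.ne']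
  have e2 : s * t + s * t = 1 := by
    have h : t + t = 1 / s := by linarith
    rw [← mul_add, h, mul_one_div_cancel hs0.ne']
  refine ⟨(η ^ (t' + t))⁻¹ ^ (1 / t), fun κ a b => ?_⟩
  rcases eq_or_ne κ 0 with rfl | hκ
  · simp
  rcases eq_or_ne a 0 with rfl | ha
  · simp
  rcases eq_or_ne b 0 with rfl | hb
  · simp
  set Z : ℝ≥0 := (η ^ (t' + t))⁻¹ ^ (1 / t) with hZ
  have hZt : Z ^ t = (η ^ (t' + t))⁻¹ := by
    rw [hZ, ← NNReal.rpow_mul, one_div_mul_cancel ht0.ne', NNReal.rpow_one]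
  obtain ⟨T', hT'⟩ : ∃ T' : ℝ≥0, (T' : ℝ) = t' := ⟨⟨t', ht'0.le⟩, rfl⟩
  obtain ⟨T, hT⟩ : ∃ T : ℝ≥0, (T : ℝ) = t := ⟨⟨t, ht0.le⟩, rfl⟩
  have key := NNReal.geom_mean_le_arith_mean3_weighted T' T T
    (η * (a ^ r * b ^ r)) (η * (a ^ r * κ ^ s)) (Z * (b ^ r * κ ^ s))
    (by rw [← NNReal.coe_inj]; push_cast; rw [hT, hT']; exact hsum)
  have hle1 : T' ≤ 1 := by
    rw [← NNReal.coe_le_coe, hT']; push_cast; linarith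
  have hle2 : T ≤ 1 := by
    rw [← NNReal.coe_le_coe, hT]; push_cast; linarith
  rw [hT, hT'] at key
  have hL : (η * (a ^ r * b ^ r)) ^ t' * (η * (a ^ r * κ ^ s)) ^ t * (Z * (b ^ r * κ ^ s)) ^ t
      = κ * a * b := by
    simp only [NNReal.mul_rpow, ← NNReal.rpow_mul]
    have h1 : a ^ (r * t') * a ^ (r * t) = a := by
      rw [← NNReal.rpow_add ha, e1, NNReal.rpow_one]
    have h2 : b ^ (r * t') * b ^ (r * t) = b := by
      rw [← NNReal.rpow_add hb, e1, NNReal.rpow_one]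
    have h3 : κ ^ (s * t) * κ ^ (s * t) = κ := by
      rw [← NNReal.rpow_add hκ, e2, NNReal.rpow_one]
    have h4 : η ^ t' * η ^ t * Z ^ t = 1 := by
      rw [hZt, ← NNReal.rpow_add hη.ne']
      exact mul_inv_cancel₀ (NNReal.rpow_pos hη).ne'
    calc _ = (η ^ t' * η ^ t * Z ^ t) * (κ ^ (s * t) * κ ^ (s * t)) * (a ^ (r * t') * a ^ (r * t))
          * (b ^ (r * t') * b ^ (r * t)) := by ring
      _ = _ := by rw [h1, h2, h3, h4, one_mul]
  calc κ * a * b ≤ _ := hL ▸ key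
    _ ≤ 1 * (η * (a ^ r * b ^ r)) + 1 * (η * (a ^ r * κ ^ s)) + 1 * (Z * (b ^ r * κ ^ s)) := by
        gcongr
    _ = _ := by ring

/-- A sharp form of `(x + y)^p ≲ x^p + y^p`: the constant in front of `x^p` can be taken
arbitrarily close to `1`. -/
theorem add_rpow_le_mul_add_mul {p : ℝ} (hp : 1 < p) {c : ℝ≥0} (hc : 1 < c) :
    ∃ C : ℝ≥0, ∀ x y : ℝ≥0, (x + y) ^ p ≤ c * x ^ p + C * y ^ p := by
  -- convexity with weights `l` and `1 - l`, where `l ^ (1 - p) = c`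
  have hp1 : 0 < p - 1 := by linarith
  set l : ℝ≥0 := c ^ (-(1 / (p - 1))) with hl
  have hc0 : 0 < c := zero_lt_one.trans hc
  have hl0 : 0 < l := NNReal.rpow_pos hc0
  have hl1 : l < 1 := NNReal.rpow_lt_one_of_one_lt_of_neg hc (by
    rw [neg_lt_zero]; positivity)
  have hm0 : 0 < 1 - l := tsub_pos_of_lt hl1
  have hlc : l * (l⁻¹) ^ p = c := by
    have : l * (l⁻¹) ^ p = l ^ (1 - p) := by
      rw [NNReal.inv_rpow, ← NNReal.rpow_neg, sub_eq_add_neg, NNReal.rpow_add hl0.ne',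
        NNReal.rpow_one]
    rw [this, hl, ← NNReal.rpow_mul]
    have : -(1 / (p - 1)) * (1 - p) = 1 := by field_simp; ring
    rw [this, NNReal.rpow_one]
  refine ⟨(1 - l) * ((1 - l)⁻¹) ^ p, fun x y => ?_⟩
  have h := NNReal.rpow_arith_mean_le_arith_mean2_rpow l (1 - l) (l⁻¹ * x) ((1 - l)⁻¹ * y)
    (add_tsub_cancel_of_le hl1.le) hp.le
  rw [mul_inv_cancel_left₀ hl0.ne', mul_inv_cancel_left₀ hm0.ne', NNReal.mul_rpow,
    NNReal.mul_rpow, ← mul_assoc, ← mul_assoc, hlc] at h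
  exact h

/-! ### Double integrals against a convolution kernel -/

/-- The double integral `∫∫ K(x - y) |v(x)|^p |v(y)|^p`, for a nonnegative kernel `K`. -/
def doubleInt (K : RN N → ℝ≥0) (p : ℝ) (v : RN N → ℝ) : ℝ≥0∞ :=
  ∫⁻ z : RN N × RN N, (K (z.1 - z.2) * ‖v z.1‖₊ ^ p * ‖v z.2‖₊ ^ p : ℝ≥0)

theorem lintegral_fst_mul_snd {f g : RN N → ℝ≥0} (hf : AEMeasurable f) (hg : AEMeasurable g) :
    ∫⁻ z : RN N × RN N, (f z.1 * g z.2 : ℝ≥0) = (∫⁻ x, f x) * ∫⁻ x, g x := by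
  simp only [ENNReal.coe_mul, Measure.volume_eq_prod]
  exact lintegral_prod_mul hf.coe_nnreal_ennreal hg.coe_nnreal_ennreal

theorem lintegral_fst_mul_sub {f g : RN N → ℝ≥0} (hf : AEMeasurable f) (hg : Measurable g) :
    ∫⁻ z : RN N × RN N, (f z.1 * g (z.1 - z.2) : ℝ≥0) = (∫⁻ x, f x) * ∫⁻ x, g x := by
  have hg' : Measurable fun z : RN N × RN N => g (z.1 - z.2) :=
    hg.comp (measurable_fst.sub measurable_snd)
  rw [Measure.volume_eq_prod, lintegral_prod _ (by
    exact ((hf.comp_fst.mul hg'.aemeasurable).coe_nnreal_ennreal))]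
  have : ∀ x : RN N, ∫⁻ y : RN N, ((f x * g (x - y) : ℝ≥0) : ℝ≥0∞) = f x * ∫⁻ y, g y := by
    intro x
    simp only [ENNReal.coe_mul]
    rw [lintegral_const_mul _ (by fun_prop),
      lintegral_sub_left_eq_self (fun y => (g y : ℝ≥0∞)) x]
  simp only [this]
  rw [lintegral_mul_const'' _ hf.coe_nnreal_ennreal]

theorem lintegral_snd_mul_sub {f g : RN N → ℝ≥0} (hf : AEMeasurable f) (hg : Measurable g) :
    ∫⁻ z : RN N × RN N, (f z.2 * g (z.1 - z.2) : ℝ≥0) = (∫⁻ x, f x) * ∫⁻ x, g x := by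
  have hg' : Measurable fun z : RN N × RN N => g (z.1 - z.2) :=
    hg.comp (measurable_fst.sub measurable_snd)
  rw [Measure.volume_eq_prod, lintegral_prod_symm _ (by
    exact ((hf.comp_snd.mul hg'.aemeasurable).coe_nnreal_ennreal))]
  have : ∀ y : RN N, ∫⁻ x : RN N, ((f y * g (x - y) : ℝ≥0) : ℝ≥0∞) = f y * ∫⁻ y, g y := by
    intro y
    simp only [ENNReal.coe_mul]
    rw [lintegral_const_mul _ (by fun_prop),
      lintegral_sub_right_eq_self (fun y => (g y : ℝ≥0∞)) y]
  simp only [this]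
  rw [lintegral_mul_const'' _ hf.coe_nnreal_ennreal]

theorem aemeasurable_nnnorm_rpow_fst {p : ℝ} {v : RN N → ℝ} (hv : AEStronglyMeasurable v) :
    AEMeasurable fun z : RN N × RN N => ‖v z.1‖₊ ^ p := by
  have : AEMeasurable fun x : RN N => ‖v x‖₊ ^ p := hv.nnnorm.aemeasurable.pow_const p
  exact this.comp_fst

theorem aemeasurable_nnnorm_rpow_snd {p : ℝ} {v : RN N → ℝ} (hv : AEStronglyMeasurable v) :
    AEMeasurable fun z : RN N × RN N => ‖v z.2‖₊ ^ p := by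
  have : AEMeasurable fun x : RN N => ‖v x‖₊ ^ p := hv.nnnorm.aemeasurable.pow_const p
  exact this.comp_snd

theorem measurable_kernel_sub {K : RN N → ℝ≥0} (hK : Measurable K) :
    Measurable fun z : RN N × RN N => K (z.1 - z.2) :=
  hK.comp (measurable_fst.sub measurable_snd)

theorem aemeasurable_doubleInt_integrand {K : RN N → ℝ≥0} (hK : Measurable K) {p : ℝ}
    {v : RN N → ℝ} (hv : AEStronglyMeasurable v) :
    AEMeasurable fun z : RN N × RN N => K (z.1 - z.2) * ‖v z.1‖₊ ^ p * ‖v z.2‖₊ ^ p :=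
  ((measurable_kernel_sub hK).aemeasurable.mul (aemeasurable_nnnorm_rpow_fst hv)).mul
    (aemeasurable_nnnorm_rpow_snd hv)

theorem coe_nnnorm_rpow {q : ℝ} (hq : 0 ≤ q) (a : ℝ) : ((‖a‖₊ ^ q : ℝ≥0) : ℝ≥0∞) = ‖a‖ₑ ^ q := by
  rw [ENNReal.coe_rpow_of_nonneg _ hq]; rfl

theorem lintegral_fst_mul_snd_rpow {r q : ℝ} (hq : 0 ≤ q * r) {v w : RN N → ℝ}
    (hv : AEStronglyMeasurable v) (hw : AEStronglyMeasurable w) :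
    ∫⁻ z : RN N × RN N, ((‖v z.1‖₊ ^ q) ^ r * (‖w z.2‖₊ ^ q) ^ r : ℝ≥0) =
      (∫⁻ x, ‖v x‖ₑ ^ (q * r)) * ∫⁻ x, ‖w x‖ₑ ^ (q * r) := by
  simp only [← NNReal.rpow_mul, ← coe_nnnorm_rpow hq]
  exact lintegral_fst_mul_snd (f := fun x => ‖v x‖₊ ^ (q * r)) (g := fun x => ‖w x‖₊ ^ (q * r))
    (hv.nnnorm.aemeasurable.pow_const _) (hw.nnnorm.aemeasurable.pow_const _)

theorem lintegral_fst_rpow_mul_sub {r q s : ℝ} (hq : 0 ≤ q * r) {v : RN N → ℝ}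
    (hv : AEStronglyMeasurable v) {K : RN N → ℝ≥0} (hK : Measurable K) :
    ∫⁻ z : RN N × RN N, ((‖v z.1‖₊ ^ q) ^ r * K (z.1 - z.2) ^ s : ℝ≥0) =
      (∫⁻ x, ‖v x‖ₑ ^ (q * r)) * ∫⁻ x, (K x ^ s : ℝ≥0) := by
  simp only [← NNReal.rpow_mul, ← coe_nnnorm_rpow hq]
  exact lintegral_fst_mul_sub (f := fun x => ‖v x‖₊ ^ (q * r)) (g := fun x => K x ^ s)
    (hv.nnnorm.aemeasurable.pow_const _) (hK.pow_const s)

theorem lintegral_snd_rpow_mul_sub {r q s : ℝ} (hq : 0 ≤ q * r) {v : RN N → ℝ}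
    (hv : AEStronglyMeasurable v) {K : RN N → ℝ≥0} (hK : Measurable K) :
    ∫⁻ z : RN N × RN N, ((‖v z.2‖₊ ^ q) ^ r * K (z.1 - z.2) ^ s : ℝ≥0) =
      (∫⁻ x, ‖v x‖ₑ ^ (q * r)) * ∫⁻ x, (K x ^ s : ℝ≥0) := by
  simp only [← NNReal.rpow_mul, ← coe_nnnorm_rpow hq]
  exact lintegral_snd_mul_sub (f := fun x => ‖v x‖₊ ^ (q * r)) (g := fun x => K x ^ s)
    (hv.nnnorm.aemeasurable.pow_const _) (hK.pow_const s)

/-- A bound on `doubleInt` by a Lebesgue norm of `v`; the exponents are those of the Young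
convolution inequality. -/
theorem exists_doubleInt_le {r s p : ℝ} (hr : 1 < r) (hs : 1 < s) (hrs : 2 / r + 1 / s = 2)
    (hp : 0 < p) :
    ∃ C : ℝ≥0, ∀ (K : RN N → ℝ≥0) (v : RN N → ℝ), Measurable K → AEStronglyMeasurable v →
      doubleInt K p v ≤ (∫⁻ x, ‖v x‖ₑ ^ (p * r)) *
        ((∫⁻ x, ‖v x‖ₑ ^ (p * r)) + C * ∫⁻ x, (K x ^ s : ℝ≥0)) := by
  obtain ⟨C, hC⟩ := mul_mul_le_young hr hs hrs (zero_lt_one (α := ℝ≥0))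
  have hq : 0 ≤ p * r := by positivity
  refine ⟨1 + C, fun K v hK hv => ?_⟩
  have hKs : AEMeasurable fun z : RN N × RN N => K (z.1 - z.2) ^ s :=
    ((measurable_kernel_sub hK).pow_const s).aemeasurable
  have m1 := (aemeasurable_nnnorm_rpow_fst (p := p) hv).pow_const r
  have m2 := (aemeasurable_nnnorm_rpow_snd (p := p) hv).pow_const r
  calc doubleInt K p v
      ≤ ∫⁻ z : RN N × RN N, (((‖v z.1‖₊ ^ p) ^ r * (‖v z.2‖₊ ^ p) ^ r : ℝ≥0) : ℝ≥0∞)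
          + ((‖v z.1‖₊ ^ p) ^ r * K (z.1 - z.2) ^ s : ℝ≥0)
          + C * ((‖v z.2‖₊ ^ p) ^ r * K (z.1 - z.2) ^ s : ℝ≥0) := by
        refine lintegral_mono fun z => ?_
        have h := hC (K (z.1 - z.2)) (‖v z.1‖₊ ^ p) (‖v z.2‖₊ ^ p)
        rw [one_mul] at h
        simp only [← ENNReal.coe_mul, ← ENNReal.coe_add, ENNReal.coe_le_coe]
        exact h
    _ = _ := by
        rw [lintegral_add_right', lintegral_add_right', lintegral_const_mul'',
          lintegral_fst_mul_snd_rpow hq hv hv, lintegral_fst_rpow_mul_sub hq hv hK,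
          lintegral_snd_rpow_mul_sub hq hv hK]
        · push_cast; ring
        · exact (m2.mul hKs).coe_nnreal_ennreal
        · exact (m1.mul hKs).coe_nnreal_ennreal
        · exact (m2.mul hKs).coe_nnreal_ennreal.const_mul _

set_option maxHeartbeats 400000 in
/-- A one-sided nonlocal Brezis–Lieb inequality. After the sharp splitting of `|w n| ^ p`, the mixed
terms are absorbed into a multiple of `η` and a fixed integrable function on the product space, and
dominated convergence applies to the remaining positive part. -/
theorem eventually_doubleInt_le {r s p : ℝ} (hr : 1 < r) (hs : 1 < s)
    (hrs : 2 / r + 1 / s = 2) (hp : 1 < p) {K : RN N → ℝ≥0} (hK : Measurable K)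
    (hKs : ∫⁻ x, (K x ^ s : ℝ≥0) ≠ ⊤) {w : ℕ → RN N → ℝ} {u : RN N → ℝ}
    (hw : ∀ n, AEStronglyMeasurable (w n)) (hu : AEStronglyMeasurable u)
    (hlim : ∀ᵐ x, Tendsto (fun n => w n x) atTop (𝓝 (u x))) {B : ℝ≥0}
    (hB : ∀ n, ∫⁻ x, ‖w n x - u x‖ₑ ^ (p * r) ≤ B) (huq : ∫⁻ x, ‖u x‖ₑ ^ (p * r) ≠ ⊤)
    {c : ℝ≥0} (hc : 1 < c) {η : ℝ≥0} (hη : 0 < η) :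
    ∀ᶠ n in atTop, doubleInt K p (w n) ≤
      c ^ 2 * doubleInt K p (fun x => w n x - u x) + doubleInt K p u + η := by
  have hp0 : 0 < p := by linarith
  have hr0 : 0 < r := by linarith
  have hs0 : 0 < s := by linarith
  have hq : 0 ≤ p * r := by positivity
  have hg : ∀ n, AEStronglyMeasurable (fun x => w n x - u x) := fun n => (hw n).sub hu
  obtain ⟨C, hC⟩ := add_rpow_le_mul_add_mul hp hc
  set KS : ℝ≥0∞ := ∫⁻ x, (K x ^ s : ℝ≥0) with hKS
  set U : ℝ≥0∞ := ∫⁻ x, ‖u x‖ₑ ^ (p * r) with hU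
  -- the total mass of the part with the small factor is at most `T * η'`
  set T : ℝ≥0 := c * C * (2 * (B * U.toNNReal + B * KS.toNNReal)) with hT
  obtain ⟨η', hη'0, hη'⟩ : ∃ η' : ℝ≥0, 0 < η' ∧ η' * T ≤ η / 2 := by
    refine ⟨η / 2 / (T + 1), by positivity, ?_⟩
    rw [div_mul_eq_mul_div, div_le_iff₀ (by positivity)]
    gcongr
    exact le_self_add
  obtain ⟨C', hC'⟩ := mul_mul_le_young hr hs hrs hη'0
  -- pointwise ingredients
  set κ : RN N × RN N → ℝ≥0 := fun z => K (z.1 - z.2) with hκ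
  set G : RN N → ℝ≥0 := fun x => ‖u x‖₊ ^ p with hG
  set f : ℕ → RN N → ℝ≥0 := fun n x => ‖w n x‖₊ ^ p with hf
  set g : ℕ → RN N → ℝ≥0 := fun n x => ‖w n x - u x‖₊ ^ p with hgdef
  set A : ℕ → RN N × RN N → ℝ≥0 := fun n z =>
    c * C * (η' * (((g n z.1) ^ r * (G z.2) ^ r + (g n z.1) ^ r * (κ z) ^ s) +
      ((G z.1) ^ r * (g n z.2) ^ r + (g n z.2) ^ r * (κ z) ^ s))) with hA
  set F : RN N × RN N → ℝ≥0 := fun z =>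
    c * C * (C' * ((G z.2) ^ r * (κ z) ^ s + (G z.1) ^ r * (κ z) ^ s)) +
      C ^ 2 * (κ z * G z.1 * G z.2) with hF
  set W : ℕ → RN N × RN N → ℝ≥0 := fun n z =>
    κ z * f n z.1 * f n z.2 - (c ^ 2 * (κ z * g n z.1 * g n z.2) + A n z) with hW
  have hfle : ∀ n x, f n x ≤ c * g n x + C * G x := fun n x => by
    refine le_trans ?_ (hC _ _)
    refine NNReal.rpow_le_rpow ?_ hp0.le
    calc ‖w n x‖₊ = ‖(w n x - u x) + u x‖₊ := by rw [sub_add_cancel]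
      _ ≤ _ := nnnorm_add_le _ _
  have hWF : ∀ n z, W n z ≤ F z := fun n z => by
    rw [hW, tsub_le_iff_left]
    have y1 := hC' (κ z) (g n z.1) (G z.2)
    have y2 := hC' (κ z) (g n z.2) (G z.1)
    calc κ z * f n z.1 * f n z.2
        ≤ κ z * (c * g n z.1 + C * G z.1) * (c * g n z.2 + C * G z.2) := by
          gcongr <;> exact hfle _ _
      _ = c ^ 2 * (κ z * g n z.1 * g n z.2) + c * C * (κ z * g n z.1 * G z.2 +
            κ z * g n z.2 * G z.1) + C ^ 2 * (κ z * G z.1 * G z.2) := by ring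
      _ ≤ c ^ 2 * (κ z * g n z.1 * g n z.2) + c * C *
            ((η' * (g n z.1 ^ r * G z.2 ^ r + g n z.1 ^ r * κ z ^ s) + C' * (G z.2 ^ r * κ z ^ s)) +
            (η' * (g n z.2 ^ r * G z.1 ^ r + g n z.2 ^ r * κ z ^ s) + C' * (G z.1 ^ r * κ z ^ s)))
            + C ^ 2 * (κ z * G z.1 * G z.2) := by gcongr
      _ = _ := by simp only [hA, hF]; ring
  -- measurability
  have mκ : AEMeasurable κ := (measurable_kernel_sub hK).aemeasurable
  have mG1 : AEMeasurable fun z : RN N × RN N => G z.1 := aemeasurable_nnnorm_rpow_fst hu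
  have mG2 : AEMeasurable fun z : RN N × RN N => G z.2 := aemeasurable_nnnorm_rpow_snd hu
  have mg1 : ∀ n, AEMeasurable fun z : RN N × RN N => g n z.1 :=
    fun n => aemeasurable_nnnorm_rpow_fst (hg n)
  have mg2 : ∀ n, AEMeasurable fun z : RN N × RN N => g n z.2 :=
    fun n => aemeasurable_nnnorm_rpow_snd (hg n)
  have mff : ∀ n, AEMeasurable fun z : RN N × RN N => κ z * f n z.1 * f n z.2 :=
    fun n => by
      have := aemeasurable_doubleInt_integrand (p := p) hK (hw n)
      exact this
  have mgg : ∀ n, AEMeasurable fun z : RN N × RN N => κ z * g n z.1 * g n z.2 :=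
    fun n => by
      have := aemeasurable_doubleInt_integrand (p := p) hK (hg n)
      exact this
  have mGG : AEMeasurable fun z : RN N × RN N => κ z * G z.1 * G z.2 := by
    have := aemeasurable_doubleInt_integrand (p := p) hK hu
    exact this
  have mA : ∀ n, AEMeasurable (A n) := fun n =>
    (((((mg1 n).pow_const r).mul (mG2.pow_const r)).add
      (((mg1 n).pow_const r).mul (mκ.pow_const s))).add
      (((mG1.pow_const r).mul ((mg2 n).pow_const r)).add
      (((mg2 n).pow_const r).mul (mκ.pow_const s)))).const_mul _ |>.const_mul _
  have mW : ∀ n, AEMeasurable (W n) := fun n =>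
    (mff n).sub (((mgg n).const_mul _).add (mA n))
  -- the integral of `A n` is small
  have hAint : ∀ n, ∫⁻ z, (A n z : ℝ≥0∞) ≤ (η / 2 : ℝ≥0) := fun n => by
    have e : ∀ z, (A n z : ℝ≥0∞) = (c * C * η' : ℝ≥0) *
        ((((g n z.1) ^ r * (G z.2) ^ r : ℝ≥0) + ((g n z.1) ^ r * (κ z) ^ s : ℝ≥0)) +
        (((G z.1) ^ r * (g n z.2) ^ r : ℝ≥0) + ((g n z.2) ^ r * (κ z) ^ s : ℝ≥0))) := by
      intro z
      simp only [hA]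
      norm_cast
      ring
    simp only [e]
    have i1 := lintegral_fst_mul_snd_rpow (q := p) hq (hg n) hu
    have i2 := lintegral_fst_mul_snd_rpow (q := p) hq hu (hg n)
    have i3 := lintegral_fst_rpow_mul_sub (q := p) (s := s) hq (hg n) hK
    have i4 := lintegral_snd_rpow_mul_sub (q := p) (s := s) hq (hg n) hK
    rw [lintegral_const_mul'' _ (by
      exact ((((mg1 n).pow_const r).mul (mG2.pow_const r)).coe_nnreal_ennreal.add
        (((mg1 n).pow_const r).mul (mκ.pow_const s)).coe_nnreal_ennreal).add
        ((((mG1.pow_const r).mul ((mg2 n).pow_const r)).coe_nnreal_ennreal).add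
        (((mg2 n).pow_const r).mul (mκ.pow_const s)).coe_nnreal_ennreal)),
      lintegral_add_left' (by
      exact (((mg1 n).pow_const r).mul (mG2.pow_const r)).coe_nnreal_ennreal.add
        (((mg1 n).pow_const r).mul (mκ.pow_const s)).coe_nnreal_ennreal),
      lintegral_add_left' (by
      exact (((mg1 n).pow_const r).mul (mG2.pow_const r)).coe_nnreal_ennreal),
      lintegral_add_left' (by
      exact ((mG1.pow_const r).mul ((mg2 n).pow_const r)).coe_nnreal_ennreal),
      i1, i2, i3, i4, ← hU, ← hKS]
    calc _ ≤ ((c * C * η' : ℝ≥0) : ℝ≥0∞) * ((B * U + B * KS) + (U * B + B * KS)) := by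
          gcongr <;> exact hB n
      _ = ((η' * T : ℝ≥0) : ℝ≥0∞) := by
          rw [hT]; push_cast
          rw [ENNReal.coe_toNNReal huq, ENNReal.coe_toNNReal hKs]; ring
      _ ≤ _ := by exact_mod_cast hη'
  -- the dominating function is integrable
  obtain ⟨C₁, hC₁⟩ := exists_doubleInt_le (N := N) hr hs hrs hp0
  have hDu : doubleInt K p u ≠ ⊤ :=
    ne_top_of_le_ne_top (by finiteness) (hC₁ K u hK hu)
  have hFint : ∫⁻ z, (F z : ℝ≥0∞) ≠ ⊤ := by
    have e : ∀ z, (F z : ℝ≥0∞) = (c * C * C' : ℝ≥0) *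
        (((G z.2) ^ r * (κ z) ^ s : ℝ≥0) + ((G z.1) ^ r * (κ z) ^ s : ℝ≥0)) +
        (C ^ 2 : ℝ≥0) * (κ z * G z.1 * G z.2 : ℝ≥0) := by
      intro z
      simp only [hF]
      norm_cast
      ring
    simp only [e]
    have i3 := lintegral_fst_rpow_mul_sub (q := p) (s := s) hq hu hK
    have i4 := lintegral_snd_rpow_mul_sub (q := p) (s := s) hq hu hK
    rw [lintegral_add_right' _ (mGG.coe_nnreal_ennreal.const_mul _),
      lintegral_const_mul'' _ mGG.coe_nnreal_ennreal,
      lintegral_const_mul'' _ (by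
        exact ((mG2.pow_const r).mul (mκ.pow_const s)).coe_nnreal_ennreal.add
          ((mG1.pow_const r).mul (mκ.pow_const s)).coe_nnreal_ennreal),
      lintegral_add_left' (by exact ((mG2.pow_const r).mul (mκ.pow_const s)).coe_nnreal_ennreal),
      i3, i4, ← hU, ← hKS]
    change _ + _ * doubleInt K p u ≠ ⊤
    finiteness
  -- pointwise limit
  have hgz : ∀ x, Tendsto (fun n => w n x) atTop (𝓝 (u x)) →
      Tendsto (fun n => g n x) atTop (𝓝 0) ∧ Tendsto (fun n => f n x) atTop (𝓝 (G x)) := by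
    intro x hx
    constructor
    · have h1 : Tendsto (fun n => ‖w n x - u x‖₊) atTop (𝓝 0) := by
        have := (hx.sub_const (u x)).nnnorm
        simpa using this
      have := ((NNReal.continuous_rpow_const hp0.le).tendsto 0).comp h1
      rwa [NNReal.zero_rpow hp0.ne'] at this
    · exact ((NNReal.continuous_rpow_const hp0.le).tendsto _).comp hx.nnnorm
  have hWlim : ∀ᵐ z : RN N × RN N, Tendsto (fun n => (W n z : ℝ≥0∞)) atTop
      (𝓝 (κ z * G z.1 * G z.2 : ℝ≥0)) := by
    have h1 : ∀ᵐ z : RN N × RN N, Tendsto (fun n => w n z.1) atTop (𝓝 (u z.1)) := by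
      rw [Measure.volume_eq_prod]
      exact Measure.quasiMeasurePreserving_fst.ae hlim
    have h2 : ∀ᵐ z : RN N × RN N, Tendsto (fun n => w n z.2) atTop (𝓝 (u z.2)) := by
      rw [Measure.volume_eq_prod]
      exact Measure.quasiMeasurePreserving_snd.ae hlim
    filter_upwards [h1, h2] with z hz1 hz2
    rw [ENNReal.tendsto_coe]
    obtain ⟨a1, b1⟩ := hgz _ hz1
    obtain ⟨a2, b2⟩ := hgz _ hz2
    have hrpow : ∀ {x : RN N}, Tendsto (fun n => g n x) atTop (𝓝 0) →
        Tendsto (fun n => (g n x) ^ r) atTop (𝓝 0) := fun {x} hx => by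
      have := ((NNReal.continuous_rpow_const hr0.le).tendsto 0).comp hx
      rwa [NNReal.zero_rpow hr0.ne'] at this
    have a1r := hrpow a1
    have a2r := hrpow a2
    have hAz : Tendsto (fun n => A n z) atTop (𝓝 0) := by
      have := ((((a1r.mul_const ((G z.2) ^ r)).add (a1r.mul_const ((κ z) ^ s))).add
        ((a2r.const_mul ((G z.1) ^ r)).add (a2r.mul_const ((κ z) ^ s)))).const_mul η').const_mul
        (c * C)
      simpa using this
    have hsub := ((b1.const_mul (κ z)).mul b2).sub
      ((((a1.const_mul (κ z)).mul a2).const_mul (c ^ 2)).add hAz)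
    simpa using hsub
  have hDCT := tendsto_lintegral_of_dominated_convergence' (fun z => (F z : ℝ≥0∞))
    (fun n => (mW n).coe_nnreal_ennreal)
    (fun n => Eventually.of_forall fun z => ENNReal.coe_le_coe.2 (hWF n z)) hFint hWlim
  have hev : ∀ᶠ n in atTop, ∫⁻ z, (W n z : ℝ≥0∞) ≤ doubleInt K p u + (η / 2 : ℝ≥0) := by
    refine (hDCT.eventually_lt_const ?_).mono fun n h => h.le
    exact ENNReal.lt_add_right hDu (by simpa using hη.ne')
  filter_upwards [hev] with n hn
  calc doubleInt K p (w n)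
      ≤ ∫⁻ z, (((c ^ 2 : ℝ≥0) : ℝ≥0∞) * (κ z * g n z.1 * g n z.2 : ℝ≥0) + A n z) + W n z := by
        refine lintegral_mono fun z => ?_
        simp only [← ENNReal.coe_mul, ← ENNReal.coe_add, ENNReal.coe_le_coe]
        exact tsub_le_iff_left.1 le_rfl
    _ = c ^ 2 * doubleInt K p (fun x => w n x - u x) + (∫⁻ z, (A n z : ℝ≥0∞)) +
          ∫⁻ z, (W n z : ℝ≥0∞) := by
        rw [lintegral_add_right' _ (mW n).coe_nnreal_ennreal,
          lintegral_add_right' _ (mA n).coe_nnreal_ennreal,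
          lintegral_const_mul'' _ (mgg n).coe_nnreal_ennreal]
        push_cast
        rfl
    _ ≤ c ^ 2 * doubleInt K p (fun x => w n x - u x) + (η / 2 : ℝ≥0) +
          (doubleInt K p u + (η / 2 : ℝ≥0)) := by
        gcongr
        exact hAint n
    _ = c ^ 2 * doubleInt K p (fun x => w n x - u x) + doubleInt K p u +
          ((η / 2 + η / 2 : ℝ≥0) : ℝ≥0∞) := by
        push_cast; ring
    _ = _ := by rw [add_halves]

/-! ### The Riesz kernel -/

/-- The Riesz kernel as a nonnegative function. -/
def rieszNN (N : ℕ) (α : ℝ) (x : RN N) : ℝ≥0 := (rieszKernel α x).toNNReal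

/-- The part of the Riesz kernel in the unit ball. -/
def nearKernel (N : ℕ) (α : ℝ) : RN N → ℝ≥0 := indicator (Metric.ball 0 1) (rieszNN N α)

/-- The part of the Riesz kernel outside the unit ball. -/
def farKernel (N : ℕ) (α : ℝ) : RN N → ℝ≥0 := indicator (Metric.ball 0 1)ᶜ (rieszNN N α)

theorem nearKernel_add_farKernel (α : ℝ) (x : RN N) :
    nearKernel N α x + farKernel N α x = rieszNN N α x :=
  congrFun (indicator_self_add_compl _ _) x

/-- The constant in front of `‖x‖ ^ (α - N)` in the Riesz kernel. -/
def rieszConst (N : ℕ) (α : ℝ) : ℝ :=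
  Real.Gamma ((N - α) / 2) / (Real.Gamma (α / 2) * Real.pi ^ ((N : ℝ) / 2) * 2 ^ α)

theorem rieszConst_pos {α : ℝ} (hα : α ∈ Ioo (0 : ℝ) N) : 0 < rieszConst N α := by
  have h1 : 0 < Real.Gamma ((N - α) / 2) := Real.Gamma_pos_of_pos (by linarith [hα.2])
  have h2 : 0 < Real.Gamma (α / 2) := Real.Gamma_pos_of_pos (by linarith [hα.1])
  have h3 := Real.pi_pos
  unfold rieszConst
  positivity

theorem rieszKernel_eq {α : ℝ} (x : RN N) :
    rieszKernel α x = rieszConst N α * ‖x‖ ^ (-((N : ℝ) - α)) := by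
  rw [rieszKernel, rieszConst, Real.rpow_neg (norm_nonneg _), ← div_eq_mul_inv, div_div]

theorem rieszKernel_nonneg {α : ℝ} (hα : α ∈ Ioo (0 : ℝ) N) (x : RN N) : 0 ≤ rieszKernel α x := by
  rw [rieszKernel_eq]
  have := rieszConst_pos hα
  positivity

theorem coe_rieszNN {α : ℝ} (hα : α ∈ Ioo (0 : ℝ) N) (x : RN N) :
    (rieszNN N α x : ℝ) = rieszKernel α x :=
  Real.coe_toNNReal _ (rieszKernel_nonneg hα x)

theorem rieszNN_pos {α : ℝ} (hα : α ∈ Ioo (0 : ℝ) N) {x : RN N} (hx : x ≠ 0) :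
    0 < rieszNN N α x := by
  rw [← NNReal.coe_pos, coe_rieszNN hα, rieszKernel_eq]
  have := rieszConst_pos hα
  have := norm_pos_iff.2 hx
  positivity

theorem measurable_rieszKernel (α : ℝ) : Measurable (rieszKernel (N := N) α) := by
  unfold rieszKernel
  fun_prop

theorem measurable_rieszNN (α : ℝ) : Measurable (rieszNN N α) :=
  (measurable_rieszKernel α).real_toNNReal

theorem measurable_nearKernel (α : ℝ) : Measurable (nearKernel N α) :=
  (measurable_rieszNN α).indicator measurableSet_ball

theorem measurable_farKernel (α : ℝ) : Measurable (farKernel N α) :=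
  (measurable_rieszNN α).indicator measurableSet_ball.compl

theorem rieszKernel_neg {α : ℝ} (x : RN N) : rieszKernel α (-x) = rieszKernel α x := by
  simp [rieszKernel]

theorem coe_rieszNN_rpow {α s : ℝ} (hα : α ∈ Ioo (0 : ℝ) N) (x : RN N) :
    ((rieszNN N α x ^ s : ℝ≥0) : ℝ) = rieszConst N α ^ s * ‖x‖ ^ (-(s * ((N : ℝ) - α))) := by
  rw [NNReal.coe_rpow, coe_rieszNN hα, rieszKernel_eq,
    Real.mul_rpow (rieszConst_pos hα).le (by positivity), ← Real.rpow_mul (norm_nonneg _)]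
  congr 2; ring

/-- Integrability of a radial function, by polar coordinates. -/
theorem lintegral_ne_top_of_radial [Nontrivial (RN N)] {k : RN N → ℝ≥0} {f : ℝ → ℝ}
    (hkf : ∀ x, (k x : ℝ) = f ‖x‖)
    (hf : IntegrableOn (fun y : ℝ => y ^ (N - 1) * f y) (Ioi 0)) : ∫⁻ x, (k x : ℝ≥0∞) ≠ ⊤ := by
  have h : Integrable (fun x : RN N => f ‖x‖) := by
    rw [integrable_fun_norm_addHaar]
    simpa using hf
  have h2 := h.2.ne
  refine ne_of_eq_of_ne (lintegral_congr fun x => ?_) h2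
  change _ = ‖f ‖x‖‖ₑ
  rw [← hkf x, enorm_eq_nnnorm]
  simp

theorem lintegral_nearKernel_rpow_ne_top {α s : ℝ} (hN : 1 ≤ N) (hα : α ∈ Ioo (0 : ℝ) N)
    (hs : 0 < s) (hsN : s * (N - α) < N) : ∫⁻ x, (nearKernel N α x ^ s : ℝ≥0) ≠ ⊤ := by
  have : Nontrivial (RN N) := by
    have : Nonempty (Fin N) := ⟨⟨0, hN⟩⟩
    infer_instance
  refine lintegral_ne_top_of_radial (f := fun y => (Iio (1 : ℝ)).indicator
    (fun y => rieszConst N α ^ s * y ^ (-(s * ((N : ℝ) - α)))) y) (fun x => ?_) ?_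
  · by_cases hx : x ∈ Metric.ball (0 : RN N) 1
    · have hx' : ‖x‖ ∈ Iio (1 : ℝ) := by simpa using hx
      simp only [nearKernel, indicator_of_mem hx, indicator_of_mem hx']
      exact coe_rieszNN_rpow hα x
    · have hx' : ‖x‖ ∉ Iio (1 : ℝ) := by simpa using hx
      simp only [nearKernel, indicator_of_notMem hx, indicator_of_notMem hx']
      simp [NNReal.zero_rpow hs.ne']
  · have h1 : IntegrableOn (fun y : ℝ => y ^ ((N : ℝ) - 1 - s * (N - α))) (Ioo 0 1) :=
      (intervalIntegral.integrableOn_Ioo_rpow_iff one_pos).2 (by linarith)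
    have h2 := h1.const_mul (rieszConst N α ^ s)
    have h3 : IntegrableOn ((Ioo (0 : ℝ) 1).indicator
        fun y => rieszConst N α ^ s * y ^ ((N : ℝ) - 1 - s * (N - α))) (Ioi 0) :=
      ((integrable_indicator_iff measurableSet_Ioo).2 h2).integrableOn
    refine h3.congr_fun (fun y (hy : 0 < y) => ?_) measurableSet_Ioi
    by_cases hy1 : y < 1
    · have m1 : y ∈ Ioo (0 : ℝ) 1 := ⟨hy, hy1⟩
      have m2 : y ∈ Iio (1 : ℝ) := hy1
      simp only [indicator_of_mem m1, indicator_of_mem m2]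
      rw [sub_eq_add_neg ((N : ℝ) - 1), Real.rpow_add hy, ← Real.rpow_natCast, Nat.cast_sub hN]
      push_cast; ring
    · have m1 : y ∉ Ioo (0 : ℝ) 1 := fun h => hy1 h.2
      have m2 : y ∉ Iio (1 : ℝ) := hy1
      simp only [indicator_of_notMem m1, indicator_of_notMem m2, mul_zero]

theorem lintegral_farKernel_rpow_ne_top {α s : ℝ} (hN : 1 ≤ N) (hα : α ∈ Ioo (0 : ℝ) N)
    (hs : 0 < s) (hsN : N < s * (N - α)) : ∫⁻ x, (farKernel N α x ^ s : ℝ≥0) ≠ ⊤ := by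
  have : Nontrivial (RN N) := by
    have : Nonempty (Fin N) := ⟨⟨0, hN⟩⟩
    infer_instance
  refine lintegral_ne_top_of_radial (f := fun y => (Ici (1 : ℝ)).indicator
    (fun y => rieszConst N α ^ s * y ^ (-(s * ((N : ℝ) - α)))) y) (fun x => ?_) ?_
  · by_cases hx : x ∈ (Metric.ball (0 : RN N) 1)ᶜ
    · have hx' : ‖x‖ ∈ Ici (1 : ℝ) := by simpa using hx
      simp only [farKernel, indicator_of_mem hx, indicator_of_mem hx']
      exact coe_rieszNN_rpow hα x
    · have hx' : ‖x‖ ∉ Ici (1 : ℝ) := by simpa using hx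
      simp only [farKernel, indicator_of_notMem hx, indicator_of_notMem hx']
      simp [NNReal.zero_rpow hs.ne']
  · have h1 : IntegrableOn (fun y : ℝ => y ^ ((N : ℝ) - 1 - s * (N - α))) (Ici 1) :=
      (integrableOn_Ici_iff_integrableOn_Ioi).2 (integrableOn_Ioi_rpow_of_lt (by linarith) one_pos)
    have h2 := h1.const_mul (rieszConst N α ^ s)
    have h3 : IntegrableOn ((Ici (1 : ℝ)).indicator
        fun y => rieszConst N α ^ s * y ^ ((N : ℝ) - 1 - s * (N - α))) (Ioi 0) :=
      ((integrable_indicator_iff measurableSet_Ici).2 h2).integrableOn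
    refine h3.congr_fun (fun y (hy : 0 < y) => ?_) measurableSet_Ioi
    by_cases hy1 : y ∈ Ici (1 : ℝ)
    · simp only [indicator_of_mem hy1]
      rw [sub_eq_add_neg ((N : ℝ) - 1), Real.rpow_add hy, ← Real.rpow_natCast, Nat.cast_sub hN]
      push_cast; ring
    · simp only [indicator_of_notMem hy1, mul_zero]

theorem doubleInt_add {K₁ K₂ : RN N → ℝ≥0} (hK₁ : Measurable K₁) {p : ℝ}
    {v : RN N → ℝ} (hv : AEStronglyMeasurable v) :
    doubleInt (fun x => K₁ x + K₂ x) p v = doubleInt K₁ p v + doubleInt K₂ p v := by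
  unfold doubleInt
  rw [← lintegral_add_left' (aemeasurable_doubleInt_integrand hK₁ hv).coe_nnreal_ennreal]
  refine lintegral_congr fun z => ?_
  push_cast
  ring

theorem doubleInt_riesz_eq {α p : ℝ} {v : RN N → ℝ} (hv : AEStronglyMeasurable v) :
    doubleInt (rieszNN N α) p v =
      doubleInt (nearKernel N α) p v + doubleInt (farKernel N α) p v := by
  rw [← doubleInt_add (measurable_nearKernel α) hv]
  congr 1
  ext x
  rw [nearKernel_add_farKernel]

/-- Exponents for the Young inequality with a kernel in `L^s`, the exponent `p * r` lying in the
subcritical Sobolev range. -/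
structure YoungExponents (N : ℕ) (p r s : ℝ) : Prop where
  one_lt_r : 1 < r
  one_lt_s : 1 < s
  sum_eq : 2 / r + 1 / s = 2
  two_lt : 2 < p * r
  subcritical : ((N : ℝ) - 2) * (p * r) < 2 * N

/-- Young exponents in terms of `ρ = 1 / r`. -/
theorem YoungExponents.of_inv {p ρ : ℝ} (h1 : 1 / 2 < ρ) (h2 : ρ < 1)
    (h3 : 2 * ρ < p) (h4 : ((N : ℝ) - 2) * p < 2 * N * ρ) :
    YoungExponents N p (1 / ρ) (1 / (2 - 2 * ρ)) := by
  have hρ : 0 < ρ := by linarith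
  have hρ' : 0 < 2 - 2 * ρ := by linarith
  refine ⟨?_, ?_, ?_, ?_, ?_⟩
  · rw [lt_div_iff₀ hρ]; linarith
  · rw [lt_div_iff₀ hρ']; linarith
  · rw [div_div_eq_mul_div, one_div_one_div]; ring
  · rw [mul_one_div, lt_div_iff₀ hρ]; linarith
  · rw [mul_one_div, mul_div_assoc', div_lt_iff₀ hρ]; linarith

/-- The part of the Riesz kernel in the unit ball lies in `L^s` for `s < N / (N - α)`, that is, for
`1 / r < (N + α) / (2 N)`. -/
theorem exists_near_exponents {α p : ℝ} (hN : 1 ≤ N) (hα : α ∈ Ioo (0 : ℝ) N)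
    (hlow : ((N : ℝ) - 2) / (N + α) < 1 / p) (hupp : 1 / p < (N : ℝ) / (N + α)) (hp : 1 < p) :
    ∃ r s, YoungExponents N p r s ∧ ∫⁻ x, (nearKernel N α x ^ s : ℝ≥0) ≠ ⊤ := by
  have hN0 : (0 : ℝ) < N := by exact_mod_cast hN
  have hα0 := hα.1
  have hαN := hα.2
  rw [div_lt_div_iff₀ (by linarith) (by linarith)] at hlow hupp
  obtain ⟨ρ, h1, h2⟩ : ∃ ρ, max (1 / 2) (((N : ℝ) - 2) * p / (2 * N)) < ρ ∧
      ρ < (N + α) / (2 * N) := by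
    apply exists_between
    rw [max_lt_iff]
    constructor
    · rw [lt_div_iff₀ (by positivity)]; linarith
    · gcongr; linarith
  rw [max_lt_iff, div_lt_iff₀ (by positivity : (0 : ℝ) < 2 * N)] at h1
  rw [lt_div_iff₀ (by positivity)] at h2
  have hρ1 : ρ < 1 := by nlinarith
  refine ⟨_, _, YoungExponents.of_inv h1.1 hρ1 (by nlinarith) (by linarith), ?_⟩
  have hpos : 0 < 2 - 2 * ρ := by linarith
  refine lintegral_nearKernel_rpow_ne_top hN hα (by positivity) ?_
  rw [one_div_mul_eq_div, div_lt_iff₀ hpos]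
  linarith

/-- The part of the Riesz kernel outside the unit ball lies in `L^s` for `s > N / (N - α)`, that is,
for `1 / r > (N + α) / (2 N)`. -/
theorem exists_far_exponents {α p : ℝ} (hN : 1 ≤ N) (hα : α ∈ Ioo (0 : ℝ) N)
    (hlow : ((N : ℝ) - 2) / (N + α) < 1 / p) (hupp : 1 / p < (N : ℝ) / (N + α)) (hp : 1 < p) :
    ∃ r s, YoungExponents N p r s ∧ ∫⁻ x, (farKernel N α x ^ s : ℝ≥0) ≠ ⊤ := by
  have hN0 : (0 : ℝ) < N := by exact_mod_cast hN
  have hα0 := hα.1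
  have hαN := hα.2
  rw [div_lt_div_iff₀ (by linarith) (by linarith)] at hlow hupp
  obtain ⟨ρ, h1, h2⟩ : ∃ ρ, (N + α) / (2 * N) < ρ ∧ ρ < min 1 (p / 2) := by
    apply exists_between
    rw [lt_min_iff]
    constructor
    · rw [div_lt_iff₀ (by positivity)]; linarith
    · rw [div_lt_iff₀ (by positivity)]; linarith
  rw [lt_min_iff] at h2
  rw [div_lt_iff₀ (by positivity)] at h1
  have hρ1 : 1 / 2 < ρ := by nlinarith
  refine ⟨_, _, YoungExponents.of_inv hρ1 h2.1 (by linarith) (by linarith), ?_⟩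
  have hpos : 0 < 2 - 2 * ρ := by linarith
  refine lintegral_farKernel_rpow_ne_top hN hα (by have := h2.1; positivity) ?_
  rw [one_div_mul_eq_div, lt_div_iff₀ hpos]
  linarith

/-! ### Sobolev functions and their weak gradients -/

theorem IsTestFunction.continuous {φ : RN N → ℝ} (hφ : IsTestFunction φ) : Continuous φ :=
  hφ.1.continuous

theorem IsTestFunction.differentiable {φ : RN N → ℝ} (hφ : IsTestFunction φ) :
    Differentiable ℝ φ :=
  hφ.1.differentiable (by simp)

theorem IsTestFunction.continuous_gradient {φ : RN N → ℝ} (hφ : IsTestFunction φ) :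
    Continuous (gradient φ) :=
  (InnerProductSpace.toDual ℝ (RN N)).symm.continuous.comp (hφ.1.continuous_fderiv (by simp))

theorem IsTestFunction.hasCompactSupport_gradient {φ : RN N → ℝ} (hφ : IsTestFunction φ) :
    HasCompactSupport (gradient φ) :=
  (hφ.2.fderiv ℝ).comp_left (g := (InnerProductSpace.toDual ℝ (RN N)).symm) (map_zero _)

theorem IsTestFunction.memLp {φ : RN N → ℝ} (hφ : IsTestFunction φ) (q : ℝ≥0∞) : MemLp φ q :=
  hφ.continuous.memLp_of_hasCompactSupport hφ.2

theorem IsTestFunction.memLp_gradient {φ : RN N → ℝ} (hφ : IsTestFunction φ) (q : ℝ≥0∞) :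
    MemLp (gradient φ) q :=
  hφ.continuous_gradient.memLp_of_hasCompactSupport hφ.hasCompactSupport_gradient

theorem IsTestFunction.comp_sub {φ : RN N → ℝ} (hφ : IsTestFunction φ) (h : RN N) :
    IsTestFunction fun x => φ (x - h) :=
  ⟨hφ.1.comp (contDiff_id.sub contDiff_const),
    hφ.2.comp_homeomorph (Homeomorph.subRight h)⟩

theorem IsTestFunction.comp_neg {φ : RN N → ℝ} (hφ : IsTestFunction φ) :
    IsTestFunction fun x => φ (-x) :=
  ⟨hφ.1.comp contDiff_neg, hφ.2.comp_homeomorph (Homeomorph.neg _)⟩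

theorem gradient_comp_sub (φ : RN N → ℝ) (h x : RN N) :
    gradient (fun y => φ (y - h)) x = gradient φ (x - h) := by
  unfold gradient
  rw [fderiv_comp_sub]

theorem memLp_locallyIntegrable {E : Type*} [NormedAddCommGroup E] {f : RN N → E}
    (hf : MemLp f 2) : LocallyIntegrable f :=
  hf.locallyIntegrable (by norm_num)

/-- `g` is the weak gradient of `v`, and both are square integrable. -/
structure SobolevPair (v : RN N → ℝ) (g : RN N → RN N) : Prop where
  memLp : MemLp v 2
  memLp_grad : MemLp g 2
  integral_eq : ∀ φ : RN N → ℝ, IsTestFunction φ →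
    ∫ x, v x • gradient φ x = -∫ x, φ x • g x

theorem SobolevPair.isWeakGradient {v : RN N → ℝ} {g : RN N → RN N} (h : SobolevPair v g) :
    IsWeakGradient v g :=
  ⟨memLp_locallyIntegrable h.memLp, memLp_locallyIntegrable h.memLp_grad, h.integral_eq⟩

theorem SobolevPair.memW12 {v : RN N → ℝ} {g : RN N → RN N} (h : SobolevPair v g) : MemW12 v :=
  ⟨h.memLp, g, h.isWeakGradient, h.memLp_grad⟩

theorem MemW12.exists_pair {v : RN N → ℝ} (h : MemW12 v) : ∃ g, SobolevPair v g := by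
  obtain ⟨h1, g, h2, h3⟩ := h
  exact ⟨g, h1, h3, h2.2.2⟩

theorem MemW12.sobolevPair {v : RN N → ℝ} (h : MemW12 v) : SobolevPair v (weakGrad v) := by
  obtain ⟨g, hg⟩ := h.exists_pair
  have e := hg.isWeakGradient.weakGrad_ae_eq
  refine ⟨hg.memLp, hg.memLp_grad.ae_eq e.symm, fun φ hφ => ?_⟩
  rw [hg.integral_eq φ hφ]
  congr 1
  refine integral_congr_ae ?_
  filter_upwards [e] with x hx
  rw [hx]

theorem integrable_smul_gradient {v : RN N → ℝ} (hv : LocallyIntegrable v) {φ : RN N → ℝ}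
    (hφ : IsTestFunction φ) : Integrable fun x => v x • gradient φ x :=
  hv.integrable_smul_right_of_hasCompactSupport hφ.continuous_gradient
    hφ.hasCompactSupport_gradient

theorem integrable_test_smul {g : RN N → RN N} (hg : LocallyIntegrable g) {φ : RN N → ℝ}
    (hφ : IsTestFunction φ) : Integrable fun x => φ x • g x :=
  hg.integrable_smul_left_of_hasCompactSupport hφ.continuous hφ.2

/-- The weak gradient relation, tested in a fixed direction. -/
theorem SobolevPair.integral_inner_eq {v : RN N → ℝ} {g : RN N → RN N} (h : SobolevPair v g)
    {φ : RN N → ℝ} (hφ : IsTestFunction φ) (e : RN N) :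
    ∫ x, v x * fderiv ℝ φ x e = -∫ x, φ x * inner ℝ e (g x) := by
  have h1 := congrArg (inner ℝ e) (h.integral_eq φ hφ)
  rw [inner_neg_right, ← integral_inner (integrable_smul_gradient
      (memLp_locallyIntegrable h.memLp) hφ),
    ← integral_inner (integrable_test_smul (memLp_locallyIntegrable h.memLp_grad) hφ)] at h1
  simpa [inner_smul_right, inner_gradient_right] using h1

theorem SobolevPair.of_integral_inner {v : RN N → ℝ} {g : RN N → RN N} (hv : MemLp v 2)
    (hg : MemLp g 2) (h : ∀ φ : RN N → ℝ, IsTestFunction φ → ∀ e : RN N,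
      ∫ x, v x * fderiv ℝ φ x e = -∫ x, φ x * inner ℝ e (g x)) : SobolevPair v g := by
  refine ⟨hv, hg, fun φ hφ => ext_inner_left ℝ fun e => ?_⟩
  rw [inner_neg_right, ← integral_inner (integrable_smul_gradient
      (memLp_locallyIntegrable hv) hφ),
    ← integral_inner (integrable_test_smul (memLp_locallyIntegrable hg) hφ)]
  simpa [inner_smul_right, inner_gradient_right] using h φ hφ e

theorem SobolevPair.const_smul {v : RN N → ℝ} {g : RN N → RN N} (h : SobolevPair v g) (t : ℝ) :
    SobolevPair (fun x => t * v x) (fun x => t • g x) := by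
  refine ⟨h.memLp.const_mul t, h.memLp_grad.const_smul t, fun φ hφ => ?_⟩
  have := congrArg (fun y => t • y) (h.integral_eq φ hφ)
  simp only [smul_neg, ← integral_smul] at this
  simp only [mul_smul, this, smul_comm _ t]

theorem SobolevPair.add {v w : RN N → ℝ} {g k : RN N → RN N} (h : SobolevPair v g)
    (h' : SobolevPair w k) : SobolevPair (fun x => v x + w x) (fun x => g x + k x) := by
  refine ⟨h.memLp.add h'.memLp, h.memLp_grad.add h'.memLp_grad, fun φ hφ => ?_⟩
  simp only [add_smul, smul_add]
  rw [integral_add (integrable_smul_gradient (memLp_locallyIntegrable h.memLp) hφ)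
      (integrable_smul_gradient (memLp_locallyIntegrable h'.memLp) hφ),
    integral_add (integrable_test_smul (memLp_locallyIntegrable h.memLp_grad) hφ)
      (integrable_test_smul (memLp_locallyIntegrable h'.memLp_grad) hφ),
    h.integral_eq φ hφ, h'.integral_eq φ hφ, neg_add]

theorem SobolevPair.sub {v w : RN N → ℝ} {g k : RN N → RN N} (h : SobolevPair v g)
    (h' : SobolevPair w k) : SobolevPair (fun x => v x - w x) (fun x => g x - k x) := by
  have := h.add (h'.const_smul (-1))
  simpa [sub_eq_add_neg] using this

theorem SobolevPair.comp_add {v : RN N → ℝ} {g : RN N → RN N} (h : SobolevPair v g) (a : RN N) :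
    SobolevPair (fun x => v (x + a)) (fun x => g (x + a)) := by
  have mp := measurePreserving_add_right (volume : Measure (RN N)) a
  refine ⟨h.memLp.comp_measurePreserving mp, h.memLp_grad.comp_measurePreserving mp,
    fun φ hφ => ?_⟩
  have := h.integral_eq _ (hφ.comp_sub a)
  simp only [gradient_comp_sub] at this
  rw [← integral_add_right_eq_self _ a, ← integral_add_right_eq_self (fun x => φ (x - a) • g x) a]
    at this
  simpa using this

theorem IsTestFunction.sobolevPair {φ : RN N → ℝ} (hφ : IsTestFunction φ) :
    SobolevPair φ (gradient φ) := by
  refine SobolevPair.of_integral_inner (hφ.memLp 2) (hφ.memLp_gradient 2) fun ψ hψ e => ?_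
  have c : ∀ {χ : RN N → ℝ}, IsTestFunction χ → Continuous fun x => fderiv ℝ χ x e :=
    fun {χ} hχ => (hχ.1.continuous_fderiv (by simp)).clm_apply continuous_const
  rw [integral_mul_fderiv_eq_neg_fderiv_mul_of_integrable]
  · congr 1
    refine integral_congr_ae (Eventually.of_forall fun x => ?_)
    simp [inner_gradient_right, mul_comm]
  · exact ((c hφ).mul hψ.continuous).integrable_of_hasCompactSupport hψ.2.mul_left
  · exact (hφ.continuous.mul (c hψ)).integrable_of_hasCompactSupport hφ.2.mul_right
  · exact (hφ.continuous.mul hψ.continuous).integrable_of_hasCompactSupport hφ.2.mul_right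
  · exact fun x _ => hφ.differentiable x
  · exact fun x _ => hψ.differentiable x

theorem integral_norm_sq_eq_norm_toLp {E : Type*} [NormedAddCommGroup E] [InnerProductSpace ℝ E]
    {f : RN N → E} (hf : MemLp f 2) : ∫ x, ‖f x‖ ^ 2 = ‖hf.toLp f‖ ^ 2 := by
  rw [← real_inner_self_eq_norm_sq, L2.inner_def]
  refine integral_congr_ae ?_
  filter_upwards [hf.coeFn_toLp] with x hx
  rw [hx, real_inner_self_eq_norm_sq]

theorem integral_inner_eq_inner_toLp {E : Type*} [NormedAddCommGroup E] [InnerProductSpace ℝ E]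
    {f g : RN N → E} (hf : MemLp f 2) (hg : MemLp g 2) :
    ∫ x, inner ℝ (f x) (g x) = inner ℝ (hf.toLp f) (hg.toLp g) := by
  rw [L2.inner_def]
  refine integral_congr_ae ?_
  filter_upwards [hf.coeFn_toLp, hg.coeFn_toLp] with x hx hx'
  rw [hx, hx']

theorem SobolevPair.sobolevSq_eq {v : RN N → ℝ} {g : RN N → RN N} (h : SobolevPair v g) :
    sobolevSq v = ∫ x, (‖g x‖ ^ 2 + |v x| ^ 2) := by
  refine integral_congr_ae ?_
  filter_upwards [h.isWeakGradient.weakGrad_ae_eq] with x hx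
  rw [hx]

theorem SobolevPair.sobolevSq_eq_norm {v : RN N → ℝ} {g : RN N → RN N} (h : SobolevPair v g) :
    sobolevSq v = ‖h.memLp_grad.toLp g‖ ^ 2 + ‖h.memLp.toLp v‖ ^ 2 := by
  rw [h.sobolevSq_eq, ← integral_norm_sq_eq_norm_toLp, ← integral_norm_sq_eq_norm_toLp,
    ← integral_add]
  · rfl
  · exact h.memLp_grad.integrable_norm_pow (by norm_num)
  · exact h.memLp.integrable_norm_pow (by norm_num)

theorem sobolevSq_nonneg (v : RN N → ℝ) : 0 ≤ sobolevSq v :=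
  integral_nonneg fun x => by positivity

theorem SobolevPair.sobolevSq_const_mul {v : RN N → ℝ} {g : RN N → RN N} (h : SobolevPair v g)
    (t : ℝ) : sobolevSq (fun x => t * v x) = t ^ 2 * sobolevSq v := by
  rw [(h.const_smul t).sobolevSq_eq, h.sobolevSq_eq, ← integral_const_mul]
  refine integral_congr_ae (Eventually.of_forall fun x => ?_)
  simp only [norm_smul, abs_mul, Real.norm_eq_abs, mul_pow, sq_abs]
  ring

theorem SobolevPair.sobolevSq_comp_add {v : RN N → ℝ} {g : RN N → RN N} (h : SobolevPair v g)
    (a : RN N) : sobolevSq (fun x => v (x + a)) = sobolevSq v := by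
  rw [(h.comp_add a).sobolevSq_eq, h.sobolevSq_eq,
    integral_add_right_eq_self (fun x => ‖g x‖ ^ 2 + |v x| ^ 2) a]

theorem SobolevPair.sobolevSq_pos {v : RN N → ℝ} {g : RN N → RN N} (h : SobolevPair v g)
    (hv : ¬ v =ᵐ[volume] 0) : 0 < sobolevSq v := by
  rw [h.sobolevSq_eq_norm]
  have : 0 < ‖h.memLp.toLp v‖ := by
    rw [norm_pos_iff]
    intro h0
    refine hv (h.memLp.coeFn_toLp.symm.trans ?_)
    rw [h0]
    exact Lp.coeFn_zero _ _ _
  positivity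

theorem lintegral_enorm_sq_eq {E : Type*} [NormedAddCommGroup E] [InnerProductSpace ℝ E]
    {f : RN N → E} (hf : MemLp f 2) :
    ∫⁻ x, ‖f x‖ₑ ^ 2 = ENNReal.ofReal (‖hf.toLp f‖ ^ 2) := by
  rw [← integral_norm_sq_eq_norm_toLp, ofReal_integral_eq_lintegral_ofReal]
  · refine lintegral_congr fun x => ?_
    rw [ENNReal.ofReal_pow (norm_nonneg _), ofReal_norm]
  · exact hf.integrable_norm_pow (by norm_num)
  · exact Eventually.of_forall fun x => by positivity

/-! ### Translations of Sobolev functions -/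

theorem abs_integral_mul_le {f g : RN N → ℝ} (hf : MemLp f 2) (hg : MemLp g 2) :
    |∫ x, f x * g x| ≤ (eLpNorm f 2).toReal * (eLpNorm g 2).toReal := by
  have h := abs_real_inner_le_norm (hf.toLp f) (hg.toLp g)
  rw [← integral_inner_eq_inner_toLp, Lp.norm_toLp, Lp.norm_toLp] at h
  simpa [mul_comm] using h

/-- Square integrable functions are controlled by their action on test functions. -/
theorem eLpNorm_le_of_forall_test {w : RN N → ℝ} (hw : MemLp w 2) {C : ℝ} (hC : 0 ≤ C)
    (h : ∀ φ : RN N → ℝ, IsTestFunction φ → |∫ x, w x * φ x| ≤ C * (eLpNorm φ 2).toReal) :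
    (eLpNorm w 2).toReal ≤ C := by
  have hcl : IsClosed {f : Lp ℝ 2 (volume : Measure (RN N)) |
      |inner ℝ (hw.toLp w) f| ≤ C * ‖f‖} :=
    isClosed_le (by fun_prop) (by fun_prop)
  have hd := Lp.dense_hasCompactSupport_contDiff (E := RN N) (F := ℝ)
    (μ := (volume : Measure (RN N))) (p := 2) (by norm_num)
  have hmem : hw.toLp w ∈ {f : Lp ℝ 2 (volume : Measure (RN N)) |
      |inner ℝ (hw.toLp w) f| ≤ C * ‖f‖} := by
    refine hcl.closure_subset_iff.2 ?_ (hd (hw.toLp w))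
    rintro f ⟨φ, hfφ, h1, h2⟩
    have hφ : IsTestFunction φ := ⟨h2, h1⟩
    have : f = (hφ.memLp 2).toLp φ := by
      ext1
      exact hfφ.trans (hφ.memLp 2).coeFn_toLp.symm
    rw [this, mem_ofPred_eq, ← integral_inner_eq_inner_toLp, Lp.norm_toLp]
    simpa [mul_comm] using h φ hφ
  rw [mem_ofPred_eq, real_inner_self_eq_norm_sq, abs_of_nonneg (by positivity), sq,
    Lp.norm_toLp] at hmem
  rcases (ENNReal.toReal_nonneg (a := eLpNorm w 2)).eq_or_lt with h0 | h0
  · rwa [← h0]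
  · exact le_of_mul_le_mul_right hmem h0

/-- The mean value inequality for Sobolev functions. It is obtained by duality from the
differentiability of `a ↦ ∫ v (x + a) φ x` for test functions `φ`. -/
theorem SobolevPair.eLpNorm_translate_sub_le {v : RN N → ℝ} {g : RN N → RN N}
    (h : SobolevPair v g) (a : RN N) :
    (eLpNorm (fun x => v (x + a) - v x) 2).toReal ≤ ‖a‖ * (eLpNorm g 2).toReal := by
  refine eLpNorm_le_of_forall_test ((h.comp_add a).memLp.sub h.memLp) (by positivity)
    fun φ hφ => ?_
  set ψ : RN N → ℝ := fun x => φ (-x) with hψdef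
  have hψ : IsTestFunction ψ := hφ.comp_neg
  set L := ContinuousLinearMap.mul ℝ ℝ
  set F : RN N → ℝ := convolution v ψ L volume with hF
  have hvl := memLp_locallyIntegrable h.memLp
  have hFb : ∀ b, F b = ∫ x, v (x + b) * φ x := by
    intro b
    rw [hF, convolution, ← integral_add_right_eq_self _ b]
    simp [L, hψdef]
  have hd : ∀ b, HasFDerivAt F ((convolution v (fderiv ℝ ψ) (L.precompR (RN N)) volume) b) b :=
    fun b => hψ.2.hasFDerivAt_convolution_right L hvl (hψ.1.of_le (by simp)) b
  have hbound : ∀ b, ‖(convolution v (fderiv ℝ ψ) (L.precompR (RN N)) volume) b‖ ≤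
      (eLpNorm φ 2).toReal * (eLpNorm g 2).toReal := by
    intro b
    refine ContinuousLinearMap.opNorm_le_bound _ (by positivity) fun e => ?_
    rw [convolution_precompR_apply L hvl (hψ.2.fderiv ℝ) (hψ.1.continuous_fderiv (by simp))]
    have e1 : convolution v (fun x => fderiv ℝ ψ x e) L volume b =
        ∫ x, φ (x - b) * inner ℝ e (g x) := by
      rw [← neg_neg (∫ x, φ (x - b) * inner ℝ e (g x)),
        ← h.integral_inner_eq (hφ.comp_sub b) e, convolution, ← integral_neg]
      refine integral_congr_ae (Eventually.of_forall fun x => ?_)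
      have : fderiv ℝ ψ (b - x) = -fderiv ℝ (fun y => φ (y - b)) x := by
        have hn : HasFDerivAt ψ ((fderiv ℝ φ (-(b - x))).comp
            (-ContinuousLinearMap.id ℝ (RN N))) (b - x) :=
          (hφ.differentiable (-(b - x))).hasFDerivAt.comp (b - x) (hasFDerivAt_id (b - x)).neg
        rw [hn.fderiv, fderiv_comp_sub, neg_sub]
        ext e'
        simp
      simp [L, this]
    rw [e1]
    have hmeas : AEStronglyMeasurable (fun x => inner ℝ e (g x)) :=
      (aestronglyMeasurable_const).inner h.memLp_grad.1
    have hge : MemLp (fun x => inner ℝ e (g x)) 2 :=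
      h.memLp_grad.of_le_mul (c := ‖e‖) hmeas
        (Eventually.of_forall fun x => norm_inner_le_norm e (g x))
    refine (abs_integral_mul_le ((hφ.comp_sub b).memLp 2) hge).trans ?_
    have e2 : eLpNorm (fun x => φ (x - b)) 2 = eLpNorm φ 2 :=
      eLpNorm_comp_measurePreserving (hφ.memLp 2).1
        (measurePreserving_sub_right (volume : Measure (RN N)) b)
    have e3 : (eLpNorm (fun x => inner ℝ e (g x)) 2).toReal ≤ ‖e‖ * (eLpNorm g 2).toReal := by
      have := eLpNorm_le_mul_eLpNorm_of_ae_le_mul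
        (Eventually.of_forall fun x => norm_inner_le_norm (𝕜 := ℝ) e (g x)) 2
        (μ := (volume : Measure (RN N)))
      have h3 := ENNReal.toReal_mono (by finiteness [h.memLp_grad.2.ne]) this
      rwa [ENNReal.toReal_mul, ENNReal.toReal_ofReal (norm_nonneg _)] at h3
    rw [e2]
    calc _ ≤ (eLpNorm φ 2).toReal * (‖e‖ * (eLpNorm g 2).toReal) := by gcongr
      _ = _ := by ring
  have key := convex_univ.norm_image_sub_le_of_norm_hasFDerivWithin_le
    (fun b _ => (hd b).hasFDerivWithinAt) (fun b _ => hbound b) (mem_univ 0) (mem_univ a)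
  rw [sub_zero, hFb, hFb, Real.norm_eq_abs] at key
  have i1 : ∀ b, Integrable fun x => v (x + b) * φ x := fun b =>
    (memLp_locallyIntegrable (h.comp_add b).memLp).integrable_smul_right_of_hasCompactSupport
      hφ.continuous hφ.2
  rw [← integral_sub (i1 a) (i1 0)] at key
  calc |∫ x, (v (x + a) - v x) * φ x| = _ := by
        congr 2; ext x; simp [sub_mul]
    _ ≤ _ := key
    _ = _ := by ring

/-! ### Ball averages -/

/-- The uniform probability measure on the ball of radius `t` around the origin. -/
def ballProb (N : ℕ) (t : ℝ) : Measure (RN N) :=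
  ProbabilityTheory.cond volume (Metric.ball 0 t)

/-- The average of `v` over the ball of radius `t` around `x`. -/
def ballAvg (t : ℝ) (v : RN N → ℝ) (x : RN N) : ℝ := ∫ z, v (x + z) ∂(ballProb N t)

theorem isProbabilityMeasure_ballProb {t : ℝ} (ht : 0 < t) :
    IsProbabilityMeasure (ballProb N t) :=
  ProbabilityTheory.cond_isProbabilityMeasure_of_finite (Metric.measure_ball_pos _ _ ht).ne'
    measure_ball_lt_top.ne

instance (t : ℝ) : IsFiniteMeasure (ballProb N t) := by
  rcases le_or_gt t 0 with ht | ht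
  · rw [ballProb, Metric.ball_eq_empty.2 ht, ProbabilityTheory.cond_empty]
    infer_instance
  · have := isProbabilityMeasure_ballProb (N := N) ht
    infer_instance

theorem ballProb_eq (t : ℝ) : ballProb N t =
    (volume (Metric.ball (0 : RN N) t))⁻¹ • volume.restrict (Metric.ball (0 : RN N) t) := rfl

theorem ballProb_absolutelyContinuous (t : ℝ) : ballProb N t ≪ volume :=
  ProbabilityTheory.cond_absolutelyContinuous

theorem ae_ballProb_norm_lt (t : ℝ) : ∀ᵐ z ∂(ballProb N t), ‖z‖ < t := by
  rw [ballProb_eq]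
  refine Measure.smul_absolutelyContinuous.ae_le ?_
  filter_upwards [ae_restrict_mem measurableSet_ball] with z hz
  simpa using hz

/-- Jensen's inequality for the power `q`. -/
theorem enorm_integral_rpow_le {Ω : Type*} [MeasurableSpace Ω] {μ : Measure Ω}
    [IsProbabilityMeasure μ] {f : Ω → ℝ} (hf : AEStronglyMeasurable f μ) {q : ℝ} (hq : 1 ≤ q) :
    ‖∫ z, f z ∂μ‖ₑ ^ q ≤ ∫⁻ z, ‖f z‖ₑ ^ q ∂μ := by
  have hq0 : 0 < q := by linarith
  have h1 : ‖∫ z, f z ∂μ‖ₑ ≤ eLpNorm f 1 μ := by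
    rw [eLpNorm_one_eq_lintegral_enorm]
    exact enorm_integral_le_lintegral_enorm f
  have h2 : eLpNorm f 1 μ ≤ eLpNorm f (ENNReal.ofReal q) μ :=
    eLpNorm_le_eLpNorm_of_exponent_le (by simpa using hq) hf
  have h3 := eLpNorm_eq_lintegral_rpow_enorm_toReal (μ := μ) (f := f)
    (p := ENNReal.ofReal q) (by simpa using hq0) ENNReal.ofReal_ne_top
  rw [ENNReal.toReal_ofReal hq0.le] at h3
  calc ‖∫ z, f z ∂μ‖ₑ ^ q ≤ ((∫⁻ z, ‖f z‖ₑ ^ q ∂μ) ^ (1 / q)) ^ q := by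
        gcongr
        exact (h1.trans h2).trans h3.le
    _ = _ := by rw [← ENNReal.rpow_mul, one_div_mul_cancel hq0.ne', ENNReal.rpow_one]

theorem aestronglyMeasurable_comp_add {v : RN N → ℝ} (hv : AEStronglyMeasurable v) (t : ℝ) :
    AEStronglyMeasurable (fun z : RN N × RN N => v (z.1 + z.2)) (volume.prod (ballProb N t)) := by
  have h : AEStronglyMeasurable (fun z : RN N × RN N => v (z.1 + z.2))
      (volume.prod (volume : Measure (RN N))) :=
    hv.comp_snd.comp_measurePreserving
      (measurePreserving_prod_add (volume : Measure (RN N)) (volume : Measure (RN N)))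
  exact h.mono_ac (Measure.AbsolutelyContinuous.rfl.prod (ballProb_absolutelyContinuous t))

theorem aestronglyMeasurable_ballAvg {v : RN N → ℝ} (hv : AEStronglyMeasurable v) (t : ℝ) :
    AEStronglyMeasurable (ballAvg t v) :=
  (aestronglyMeasurable_comp_add hv t).integral_prod_right'

theorem integrable_ballProb {v : RN N → ℝ} (hv : LocallyIntegrable v) {t : ℝ} (ht : 0 < t)
    (x : RN N) : Integrable (fun z => v (x + z)) (ballProb N t) := by
  have h1 : LocallyIntegrable (fun z => v (x + z)) := by
    have mp := measurePreserving_add_left (volume : Measure (RN N)) x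
    intro y
    obtain ⟨U, hU, hUi⟩ := hv (x + y)
    refine ⟨(fun z => x + z) ⁻¹' U, (continuous_const_add x).continuousAt hU, ?_⟩
    exact (mp.integrableOn_comp_preimage (Homeomorph.addLeft x).measurableEmbedding).2 hUi
  have h2 : IntegrableOn (fun z => v (x + z)) (Metric.ball 0 t) :=
    (h1.integrableOn_isCompact (isCompact_closedBall (0 : RN N) t)).mono_set
      Metric.ball_subset_closedBall
  rw [ballProb_eq]
  exact Integrable.smul_measure h2 (by simpa using (Metric.measure_ball_pos _ _ ht).ne')

theorem SobolevPair.lintegral_sub_translate_le {v : RN N → ℝ} {g : RN N → RN N}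
    (h : SobolevPair v g) (z : RN N) :
    ∫⁻ x, ‖v x - v (x + z)‖ₑ ^ 2 ≤ ENNReal.ofReal ((‖z‖ * (eLpNorm g 2).toReal) ^ 2) := by
  have hml : MemLp (fun x => v (x + z) - v x) 2 := (h.comp_add z).memLp.sub h.memLp
  have e : ∫⁻ x, ‖v x - v (x + z)‖ₑ ^ 2 = ∫⁻ x, ‖v (x + z) - v x‖ₑ ^ 2 :=
    lintegral_congr fun x => by rw [enorm_sub_rev]
  rw [e, lintegral_enorm_sq_eq hml, Lp.norm_toLp]
  exact ENNReal.ofReal_le_ofReal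
    (pow_le_pow_left₀ ENNReal.toReal_nonneg (h.eLpNorm_translate_sub_le z) 2)

/-- A Poincaré inequality on the whole space: a Sobolev function is close in `L^2` to its averages
over small balls. -/
theorem SobolevPair.lintegral_sub_ballAvg_le {v : RN N → ℝ} {g : RN N → RN N}
    (h : SobolevPair v g) (hS : sobolevSq v ≤ 1) {t : ℝ} (ht : 0 < t) :
    ∫⁻ x, ‖v x - ballAvg t v x‖ₑ ^ 2 ≤ ENNReal.ofReal (t ^ 2) := by
  have := isProbabilityMeasure_ballProb (N := N) ht
  have hvl := memLp_locallyIntegrable h.memLp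
  have hg1 : (eLpNorm g 2).toReal ≤ 1 := by
    rw [h.sobolevSq_eq_norm, Lp.norm_toLp] at hS
    nlinarith [sq_nonneg ‖h.memLp.toLp v‖, ENNReal.toReal_nonneg (a := eLpNorm g 2)]
  have hm₁ : AEStronglyMeasurable (fun z : RN N × RN N => v z.1)
      (volume.prod (ballProb N t)) := h.memLp.1.comp_fst
  have hm₂ := aestronglyMeasurable_comp_add h.memLp.1 t
  have hm : AEMeasurable (fun z : RN N × RN N => ‖v z.1 - v (z.1 + z.2)‖ₑ ^ 2)
      (volume.prod (ballProb N t)) := (hm₁.sub hm₂).enorm.pow_const 2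
  calc ∫⁻ x, ‖v x - ballAvg t v x‖ₑ ^ 2
      ≤ ∫⁻ x, ∫⁻ z, ‖v x - v (x + z)‖ₑ ^ 2 ∂(ballProb N t) := by
        refine lintegral_mono fun x => ?_
        have e : v x - ballAvg t v x = ∫ z, (v x - v (x + z)) ∂(ballProb N t) := by
          rw [integral_sub (integrable_const _) (integrable_ballProb hvl ht x)]
          simp [ballAvg]
        have hmz : AEStronglyMeasurable (fun z => v x - v (x + z)) (ballProb N t) :=
          aestronglyMeasurable_const.sub (integrable_ballProb hvl ht x).1
        have := enorm_integral_rpow_le hmz one_le_two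
        rw [← e] at this
        simpa only [ENNReal.rpow_two] using this
    _ = ∫⁻ z, (∫⁻ x, ‖v x - v (x + z)‖ₑ ^ 2) ∂(ballProb N t) :=
        lintegral_lintegral_swap (f := fun x z => ‖v x - v (x + z)‖ₑ ^ 2) hm
    _ ≤ ∫⁻ z, ENNReal.ofReal (t ^ 2) ∂(ballProb N t) := by
        refine lintegral_mono_ae ?_
        filter_upwards [ae_ballProb_norm_lt t] with z hz
        refine (h.lintegral_sub_translate_le z).trans (ENNReal.ofReal_le_ofReal ?_)
        have h1 : ‖z‖ * (eLpNorm g 2).toReal ≤ t * 1 := by gcongr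
        rw [mul_one] at h1
        exact pow_le_pow_left₀ (by positivity) h1 2
    _ = ENNReal.ofReal (t ^ 2) := by simp

theorem enorm_ballAvg_rpow_le {v : RN N → ℝ} (hv : LocallyIntegrable v) {q : ℝ} (hq : 1 ≤ q)
    {t : ℝ} (ht : 0 < t) (x : RN N) :
    ‖ballAvg t v x‖ₑ ^ q ≤ (volume (Metric.ball (0 : RN N) t))⁻¹ * ∫⁻ y, ‖v y‖ₑ ^ q := by
  have := isProbabilityMeasure_ballProb (N := N) ht
  calc ‖ballAvg t v x‖ₑ ^ q ≤ ∫⁻ z, ‖v (x + z)‖ₑ ^ q ∂(ballProb N t) :=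
        enorm_integral_rpow_le (integrable_ballProb hv ht x).1 hq
    _ = (volume (Metric.ball (0 : RN N) t))⁻¹ *
          ∫⁻ z in Metric.ball (0 : RN N) t, ‖v (x + z)‖ₑ ^ q := by
        rw [ballProb_eq, lintegral_smul_measure, smul_eq_mul]
    _ ≤ (volume (Metric.ball (0 : RN N) t))⁻¹ * ∫⁻ z, ‖v (x + z)‖ₑ ^ q := by
        gcongr
        exact Measure.restrict_le_self
    _ = _ := by rw [lintegral_add_left_eq_self (fun y => ‖v y‖ₑ ^ q) x]

/-! ### The subcritical Sobolev inequality -/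

theorem enorm_rpow_eq_ofReal {q : ℝ} (hq : 0 ≤ q) (a : ℝ) :
    ‖a‖ₑ ^ q = ENNReal.ofReal (|a| ^ q) := by
  rw [Real.enorm_eq_ofReal_abs, ENNReal.ofReal_rpow_of_nonneg (abs_nonneg _) hq]

theorem enorm_sq_eq_ofReal (a : ℝ) : ‖a‖ₑ ^ 2 = ENNReal.ofReal (|a| ^ 2) := by
  rw [Real.enorm_eq_ofReal_abs, ENNReal.ofReal_pow (abs_nonneg _)]

/-- `W^{1,2}` embeds into `L^q`: there is a common bound for the functions in the unit ball. -/
def HasSobolevBound (N : ℕ) (q : ℝ) : Prop :=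
  ∃ A : ℝ≥0, ∀ (v : RN N → ℝ) (g : RN N → RN N), SobolevPair v g → sobolevSq v ≤ 1 →
    ∫⁻ x, ‖v x‖ₑ ^ q ≤ A

theorem SobolevPair.lintegral_sq_le {v : RN N → ℝ} {g : RN N → RN N} (h : SobolevPair v g)
    (hS : sobolevSq v ≤ 1) : ∫⁻ x, ‖v x‖ₑ ^ 2 ≤ 1 := by
  rw [lintegral_enorm_sq_eq h.memLp, ENNReal.ofReal_le_one]
  rw [h.sobolevSq_eq_norm] at hS
  nlinarith [sq_nonneg ‖h.memLp_grad.toLp g‖]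

theorem hasSobolevBound_two : HasSobolevBound N 2 :=
  ⟨1, fun v g h hS => by exact_mod_cast h.lintegral_sq_le hS⟩

/-- Radii `t k` for which the averages over balls of radius `t k` of a function with `L^q₀`-norm
bounded by `A` are at most `2 ^ (k - 1)`. -/
theorem exists_radius (hN : 1 ≤ N) {q₀ : ℝ} (hq₀ : 1 ≤ q₀) (A : ℝ≥0) :
    ∃ c : ℝ, 0 < c ∧ ∀ (v : RN N → ℝ), LocallyIntegrable v → ∫⁻ x, ‖v x‖ₑ ^ q₀ ≤ A →
      ∀ (k : ℕ) (x : RN N), |ballAvg (c * 2 ^ (-(k * (q₀ / N)))) v x| ≤ 2 ^ k / 2 := by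
  have hN0 : (0 : ℝ) < N := by exact_mod_cast hN
  have hq0 : 0 < q₀ := by linarith
  set V : ℝ := (volume (Metric.ball (0 : RN N) 1)).toReal with hV
  have hV0 : 0 < V := ENNReal.toReal_pos (Metric.measure_ball_pos _ _ one_pos).ne'
    measure_ball_lt_top.ne
  set c : ℝ := ((A + 1) * 2 ^ q₀ / V) ^ (1 / (N : ℝ)) with hc
  have hc0 : 0 < c := by positivity
  have hcN : c ^ N = (A + 1) * 2 ^ q₀ / V := by
    rw [hc, ← Real.rpow_natCast, ← Real.rpow_mul (by positivity), one_div_mul_cancel hN0.ne',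
      Real.rpow_one]
  refine ⟨c, hc0, fun v hv hA k x => ?_⟩
  set t : ℝ := c * 2 ^ (-(k * (q₀ / N))) with ht
  have ht0 : 0 < t := by positivity
  have htN : t ^ N * V = (A + 1) / (2 ^ k / 2) ^ q₀ := by
    have e1 : ((2 : ℝ) ^ (-(k * (q₀ / N)))) ^ N = ((2 ^ k) ^ q₀)⁻¹ := by
      rw [← Real.rpow_natCast, ← Real.rpow_mul (by norm_num), ← Real.rpow_natCast,
        ← Real.rpow_mul (by norm_num), ← Real.rpow_neg (by norm_num)]
      congr 1
      field_simp
    rw [ht, mul_pow, hcN, e1, Real.div_rpow (by positivity) (by norm_num)]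
    field_simp
  have hvol : volume (Metric.ball (0 : RN N) t) = ENNReal.ofReal (t ^ N * V) := by
    rw [Measure.addHaar_ball_of_pos _ _ ht0, ENNReal.ofReal_mul (by positivity), hV,
      ENNReal.ofReal_toReal measure_ball_lt_top.ne]
    simp
  have h1 := enorm_ballAvg_rpow_le hv hq₀ ht0 x
  rw [enorm_rpow_eq_ofReal hq0.le, hvol, htN, ← ENNReal.ofReal_inv_of_pos (by positivity)] at h1
  have h2 : ENNReal.ofReal (|ballAvg t v x| ^ q₀) ≤ ENNReal.ofReal ((2 ^ k / 2) ^ q₀) := by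
    refine h1.trans ?_
    calc _ ≤ ENNReal.ofReal ((A + 1) / (2 ^ k / 2) ^ q₀)⁻¹ * ENNReal.ofReal (A + 1) := by
          gcongr
          refine hA.trans ?_
          rw [ENNReal.ofReal_add (by positivity) (by norm_num), ENNReal.ofReal_coe_nnreal]
          exact le_self_add
      _ = _ := by
          rw [← ENNReal.ofReal_mul (by positivity)]
          congr 1
          field_simp
  rw [ENNReal.ofReal_le_ofReal_iff (by positivity)] at h2
  exact (Real.rpow_le_rpow_iff (abs_nonneg _) (by positivity) hq0).1 h2

/-- One step of the bootstrap. On the set where `|v|` is comparable to `2 ^ k`, the function `v` is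
much larger than its average over balls of the radius given by `exists_radius`, and the `L^2`-norm
of the difference is controlled by that radius. -/
theorem HasSobolevBound.step (hN : 1 ≤ N) {q₀ q : ℝ} (hq₀ : 1 ≤ q₀) (h₀ : HasSobolevBound N q₀)
    (hq : 2 ≤ q) (hqq : q < 2 + 2 * q₀ / N) : HasSobolevBound N q := by
  obtain ⟨A, hA⟩ := h₀
  obtain ⟨c, hc0, hc⟩ := exists_radius (N := N) hN hq₀ A
  have hN0 : (0 : ℝ) < N := by exact_mod_cast hN
  set t : ℕ → ℝ := fun k => c * 2 ^ (-(k * (q₀ / N))) with ht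
  have ht0 : ∀ k, 0 < t k := fun k => by positivity
  set a : ℕ → ℝ := fun k => 2 ^ (q + 2) * 2 ^ (k * (q - 2)) with ha
  have ha0 : ∀ k, 0 ≤ a k := fun k => by positivity
  set ρ : ℝ := 2 ^ (q - 2 - 2 * q₀ / N) with hρ
  have hρ1 : ρ < 1 := Real.rpow_lt_one_of_one_lt_of_neg (by norm_num) (by linarith)
  have hat : ∀ k, a k * t k ^ 2 = 2 ^ (q + 2) * c ^ 2 * ρ ^ k := by
    intro k
    have e1 : ((2 : ℝ) ^ (-(k * (q₀ / N)))) ^ 2 = 2 ^ (-(k * (q₀ / N)) * 2) := by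
      rw [Real.rpow_mul (by norm_num)]; norm_num
    have e2 : ρ ^ k = 2 ^ ((q - 2 - 2 * q₀ / N) * k) := by
      rw [Real.rpow_mul (by norm_num), Real.rpow_natCast]
    rw [ha, ht, e2]
    simp only
    rw [mul_pow, e1]
    have e3 : (2 : ℝ) ^ ((q - 2 - 2 * q₀ / N) * k) =
        2 ^ (k * (q - 2)) * 2 ^ (-(k * (q₀ / N)) * 2) := by
      rw [← Real.rpow_add (by norm_num)]
      congr 1
      ring
    rw [e3]
    ring
  have hsum : Summable fun k => a k * t k ^ 2 := by
    simp only [hat]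
    exact (summable_geometric_of_lt_one (by positivity) hρ1).mul_left _
  refine ⟨1 + (∑' k, a k * t k ^ 2).toNNReal, fun v g h hS => ?_⟩
  have hvl := memLp_locallyIntegrable h.memLp
  have hpt : ∀ x, ‖v x‖ₑ ^ q ≤
      ‖v x‖ₑ ^ 2 + ∑' k, ENNReal.ofReal (a k) * ‖v x - ballAvg (t k) v x‖ₑ ^ 2 := by
    intro x
    rw [enorm_rpow_eq_ofReal (by linarith)]
    rcases le_or_gt |v x| 1 with hx | hx
    · refine le_trans ?_ le_self_add
      rw [enorm_sq_eq_ofReal]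
      refine ENNReal.ofReal_le_ofReal ?_
      rw [← Real.rpow_natCast]
      exact Real.rpow_le_rpow_of_exponent_ge' (abs_nonneg _) hx (by norm_num)
        (by exact_mod_cast hq)
    · obtain ⟨k, hk1, hk2⟩ := exists_nat_pow_near hx.le (one_lt_two (α := ℝ))
      refine le_trans ?_ le_add_self
      refine le_trans ?_ (ENNReal.le_tsum k)
      rw [enorm_sq_eq_ofReal, ← ENNReal.ofReal_mul (ha0 k)]
      refine ENNReal.ofReal_le_ofReal ?_
      have hb := hc v hvl (hA v g h hS) k x
      have hd : 2 ^ k / 2 ≤ |v x - ballAvg (t k) v x| := by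
        have := abs_sub_abs_le_abs_sub (v x) (ballAvg (t k) v x)
        linarith
      have e : a k * (2 ^ k / 2) ^ 2 = ((2 : ℝ) ^ (k + 1)) ^ q := by
        have e1 : ((2 : ℝ) ^ (k + 1)) ^ q = 2 ^ ((k + 1) * q) := by
          rw [← Real.rpow_natCast, ← Real.rpow_mul (by norm_num)]; push_cast; rfl
        have e2 : ((2 : ℝ) ^ k) ^ 2 = 2 ^ ((k : ℝ) * 2) := by
          rw [Real.rpow_mul (by norm_num), Real.rpow_natCast]; norm_num
        have e3 : (4 : ℝ)⁻¹ = 2 ^ (-2 : ℝ) := by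
          rw [Real.rpow_neg (by norm_num)]; norm_num
        have e4 : (2 ^ k / 2 : ℝ) ^ 2 = (2 ^ k) ^ 2 * 4⁻¹ := by ring
        rw [ha, e1, e4, e2, e3]
        simp only
        rw [← Real.rpow_add (by norm_num), ← Real.rpow_add (by norm_num),
          ← Real.rpow_add (by norm_num)]
        congr 1
        ring
      calc |v x| ^ q ≤ ((2 : ℝ) ^ (k + 1)) ^ q := by
            exact Real.rpow_le_rpow (abs_nonneg _) hk2.le (by linarith)
        _ = a k * (2 ^ k / 2) ^ 2 := e.symm
        _ ≤ a k * |v x - ballAvg (t k) v x| ^ 2 := by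
            have := ha0 k
            gcongr
  have hmeas : ∀ k, AEMeasurable fun x => ‖v x - ballAvg (t k) v x‖ₑ ^ 2 := fun k =>
    (h.memLp.1.sub (aestronglyMeasurable_ballAvg h.memLp.1 (t k))).enorm.pow_const 2
  calc ∫⁻ x, ‖v x‖ₑ ^ q
      ≤ ∫⁻ x, (‖v x‖ₑ ^ 2 + ∑' k, ENNReal.ofReal (a k) * ‖v x - ballAvg (t k) v x‖ₑ ^ 2) :=
        lintegral_mono hpt
    _ = (∫⁻ x, ‖v x‖ₑ ^ 2) +
          ∑' k, ENNReal.ofReal (a k) * ∫⁻ x, ‖v x - ballAvg (t k) v x‖ₑ ^ 2 := by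
        rw [lintegral_add_left' (h.memLp.1.enorm.pow_const 2),
          lintegral_tsum fun k => (hmeas k).const_mul _]
        congr 2
        ext k
        rw [lintegral_const_mul'' _ (hmeas k)]
    _ ≤ 1 + ∑' k, ENNReal.ofReal (a k * t k ^ 2) := by
        gcongr with k
        · exact h.lintegral_sq_le hS
        · rw [ENNReal.ofReal_mul (ha0 k)]
          gcongr
          exact h.lintegral_sub_ballAvg_le hS (ht0 k)
    _ = _ := by
        rw [← ENNReal.ofReal_tsum_of_nonneg (fun k => by have := ha0 k; positivity) hsum]
        push_cast
        rfl

/-- The Sobolev embedding for all subcritical exponents, obtained by iterating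
`HasSobolevBound.step`: the fixed point of `q ↦ 2 + 2 q / N` is the critical exponent. -/
theorem hasSobolevBound (hN : 1 ≤ N) {q : ℝ} (hq : 2 ≤ q) (hqN : ((N : ℝ) - 2) * q < 2 * N) :
    HasSobolevBound N q := by
  have hN0 : (0 : ℝ) < N := by exact_mod_cast hN
  -- a lower bound for `2 + 2 q' / N - q'`, which is affine in `q'`, on `[2, q]`
  set m : ℝ := min (4 / N) (2 + 2 * q / N - q) with hm
  have hm0 : 0 < m := by
    refine lt_min (by positivity) ?_
    have : 2 + 2 * q / N - q = (2 * N - (N - 2) * q) / N := by field_simp; ring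
    rw [this]
    exact div_pos (by linarith) hN0
  have hstep : ∀ q', 2 ≤ q' → q' ≤ q → m ≤ 2 + 2 * q' / N - q' := by
    intro q' h2 hq'
    have a1 : m ≤ 4 / N := min_le_left _ _
    have a2 : m ≤ 2 + 2 * q / N - q := min_le_right _ _
    rcases eq_or_lt_of_le hq with rfl | hlt
    · have : q' = 2 := le_antisymm hq' h2
      rw [this]; linarith
    · have e : 2 + 2 * q' / N - q' =
          ((q - q') * (4 / N) + (q' - 2) * (2 + 2 * q / N - q)) / (q - 2) := by
        have : q - 2 ≠ 0 := by linarith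
        field_simp
        ring
      rw [e, le_div_iff₀ (by linarith)]
      nlinarith
  have main : ∀ k : ℕ, ∀ q', 2 ≤ q' → q' ≤ q → q' ≤ 2 + k * (m / 2) → HasSobolevBound N q' := by
    intro k
    induction k with
    | zero =>
      intro q' h1 _ h3
      have : q' = 2 := le_antisymm (by simpa using h3) h1
      rw [this]
      exact hasSobolevBound_two
    | succ k ih =>
      intro q' h1 h2 h3
      rcases le_or_gt q' (2 + m / 2) with h4 | h4
      · refine HasSobolevBound.step hN one_le_two hasSobolevBound_two h1 ?_
        have := hstep 2 le_rfl hq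
        linarith
      · have h5 : HasSobolevBound N (q' - m / 2) :=
          ih (q' - m / 2) (by linarith) (by linarith) (by push_cast at h3; linarith)
        refine HasSobolevBound.step hN (by linarith) h5 h1 ?_
        have := hstep (q' - m / 2) (by linarith) (by linarith)
        linarith
  obtain ⟨k, hk⟩ := exists_nat_ge ((q - 2) / (m / 2))
  refine main k q hq le_rfl ?_
  rw [div_le_iff₀ (by positivity)] at hk
  linarith

/-! ### Vanishing -/

/-- A function in the unit ball of `W^{1,2}` whose averages over small balls are all small is small
in `L^q`, for subcritical `q`. Where `|v|` is neither small nor large it is far from its average. -/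
theorem exists_small_of_ballAvg_small (hN : 1 ≤ N) {q : ℝ} (hq : 2 < q)
    (hqN : ((N : ℝ) - 2) * q < 2 * N) {ε : ℝ} (hε : 0 < ε) :
    ∃ t₀ δ : ℝ, 0 < t₀ ∧ 0 < δ ∧ ∀ t, 0 < t → t ≤ t₀ →
      ∀ (v : RN N → ℝ) (g : RN N → RN N), SobolevPair v g → sobolevSq v ≤ 1 →
        (∀ x, |ballAvg t v x| ≤ δ) → ∫⁻ x, ‖v x‖ₑ ^ q ≤ ENNReal.ofReal ε := by
  have hN0 : (0 : ℝ) < N := by exact_mod_cast hN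
  obtain ⟨q', hqq', hq'N⟩ : ∃ q', q < q' ∧ ((N : ℝ) - 2) * q' < 2 * N := by
    refine ⟨q + (2 * N - (N - 2) * q) / (2 * N), ?_, ?_⟩
    · have : 0 < (2 * N - (N - 2) * q) / (2 * N) := div_pos (by linarith) (by linarith)
      linarith
    · have h1 : ((N : ℝ) - 2) * ((2 * N - (N - 2) * q) / (2 * N)) =
          (2 * N - (N - 2) * q) * ((N - 2) / (2 * N)) := by ring
      have h2 : ((N : ℝ) - 2) / (2 * N) < 1 := by
        rw [div_lt_one (by positivity)]; linarith
      rw [mul_add, h1]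
      nlinarith
  obtain ⟨A, hA⟩ := hasSobolevBound hN (by linarith) hq'N
  -- the three terms of the splitting at heights `l` and `L` are at most `ε / 3` each
  set l : ℝ := (ε / 3) ^ (1 / (q - 2)) with hl
  have hl0 : 0 < l := by positivity
  have hlq : l ^ (q - 2) = ε / 3 := by
    rw [hl, ← Real.rpow_mul (by positivity), one_div_mul_cancel (by linarith), Real.rpow_one]
  set L : ℝ := (ε / (3 * (A + 1))) ^ (1 / (q - q')) with hL
  have hL0 : 0 < L := by positivity
  have hLq : L ^ (q - q') = ε / (3 * (A + 1)) := by
    rw [hL, ← Real.rpow_mul (by positivity), one_div_mul_cancel (by linarith), Real.rpow_one]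
  set b : ℝ := L ^ q * (4 / l ^ 2) with hb
  have hb0 : 0 < b := by positivity
  refine ⟨√(ε / (3 * b)), l / 2, by positivity, by positivity, fun t ht htt v g h hS hv => ?_⟩
  have ht2 : b * t ^ 2 ≤ ε / 3 := by
    have : t ^ 2 ≤ ε / (3 * b) := by
      rw [← Real.sq_sqrt (by positivity : 0 ≤ ε / (3 * b))]
      gcongr
    calc b * t ^ 2 ≤ b * (ε / (3 * b)) := by gcongr
      _ = ε / 3 := by field_simp
  have hpt : ∀ x, |v x| ^ q ≤ l ^ (q - 2) * |v x| ^ 2 + L ^ (q - q') * |v x| ^ q' +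
      b * |v x - ballAvg t v x| ^ 2 := by
    intro x
    have n1 : 0 ≤ l ^ (q - 2) * |v x| ^ 2 := by positivity
    have n2 : 0 ≤ L ^ (q - q') * |v x| ^ q' := by positivity
    have n3 : 0 ≤ b * |v x - ballAvg t v x| ^ 2 := by positivity
    rcases (abs_nonneg (v x)).eq_or_lt with h0 | h0
    · have : |v x| ^ q = 0 := by rw [← h0, Real.zero_rpow (by linarith)]
      linarith
    rcases le_or_gt |v x| l with h1 | h1
    · have : |v x| ^ q ≤ l ^ (q - 2) * |v x| ^ 2 := by
        calc |v x| ^ q = |v x| ^ (q - 2) * |v x| ^ 2 := by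
              rw [← Real.rpow_natCast, ← Real.rpow_add h0]; norm_num
          _ ≤ _ := by gcongr
      linarith
    rcases le_or_gt L |v x| with h2 | h2
    · have : |v x| ^ q ≤ L ^ (q - q') * |v x| ^ q' := by
        calc |v x| ^ q = |v x| ^ (q - q') * |v x| ^ q' := by
              rw [← Real.rpow_add h0]; congr 1; ring
          _ ≤ _ := by
              gcongr ?_ * _
              exact Real.rpow_le_rpow_of_nonpos hL0 h2 (by linarith)
      linarith
    · have hd : l / 2 ≤ |v x - ballAvg t v x| := by
        have := abs_sub_abs_le_abs_sub (v x) (ballAvg t v x)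
        linarith [hv x]
      have : |v x| ^ q ≤ b * |v x - ballAvg t v x| ^ 2 := by
        calc |v x| ^ q ≤ L ^ q := by gcongr
          _ = b * (l / 2) ^ 2 := by rw [hb]; field_simp; ring
          _ ≤ _ := by gcongr
      linarith
  have hpt' : ∀ x, ‖v x‖ₑ ^ q ≤ ENNReal.ofReal (l ^ (q - 2)) * ‖v x‖ₑ ^ 2 +
      ENNReal.ofReal (L ^ (q - q')) * ‖v x‖ₑ ^ q' +
      ENNReal.ofReal b * ‖v x - ballAvg t v x‖ₑ ^ 2 := by
    intro x
    rw [enorm_rpow_eq_ofReal (by linarith), enorm_rpow_eq_ofReal (by linarith),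
      enorm_sq_eq_ofReal, enorm_sq_eq_ofReal, ← ENNReal.ofReal_mul (by positivity),
      ← ENNReal.ofReal_mul (by positivity), ← ENNReal.ofReal_mul (by positivity),
      ← ENNReal.ofReal_add (by positivity) (by positivity),
      ← ENNReal.ofReal_add (by positivity) (by positivity)]
    exact ENNReal.ofReal_le_ofReal (hpt x)
  have m1 : AEMeasurable fun x => ‖v x‖ₑ ^ 2 := h.memLp.1.enorm.pow_const 2
  have m2 : AEMeasurable fun x => ‖v x‖ₑ ^ q' := h.memLp.1.enorm.pow_const q'
  have m3 : AEMeasurable fun x => ‖v x - ballAvg t v x‖ₑ ^ 2 :=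
    (h.memLp.1.sub (aestronglyMeasurable_ballAvg h.memLp.1 t)).enorm.pow_const 2
  calc ∫⁻ x, ‖v x‖ₑ ^ q ≤ _ := lintegral_mono hpt'
    _ = ENNReal.ofReal (l ^ (q - 2)) * (∫⁻ x, ‖v x‖ₑ ^ 2) +
          ENNReal.ofReal (L ^ (q - q')) * (∫⁻ x, ‖v x‖ₑ ^ q') +
          ENNReal.ofReal b * (∫⁻ x, ‖v x - ballAvg t v x‖ₑ ^ 2) := by
        rw [lintegral_add_right' _ (m3.const_mul _),
          lintegral_add_right' _ (m2.const_mul _), lintegral_const_mul'' _ m1,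
          lintegral_const_mul'' _ m2, lintegral_const_mul'' _ m3]
    _ ≤ ENNReal.ofReal (ε / 3) * 1 + ENNReal.ofReal (ε / (3 * (A + 1))) * ENNReal.ofReal (A + 1) +
          ENNReal.ofReal b * ENNReal.ofReal (t ^ 2) := by
        rw [hlq, hLq]
        gcongr
        · exact h.lintegral_sq_le hS
        · refine (hA v g h hS).trans ?_
          rw [ENNReal.ofReal_add (by positivity) (by norm_num), ENNReal.ofReal_coe_nnreal]
          exact le_self_add
        · exact h.lintegral_sub_ballAvg_le hS ht
    _ ≤ ENNReal.ofReal (ε / 3) + ENNReal.ofReal (ε / 3) + ENNReal.ofReal (ε / 3) := by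
        rw [mul_one, ← ENNReal.ofReal_mul (by positivity), ← ENNReal.ofReal_mul (by positivity)]
        gcongr
        exact le_of_eq (by field_simp)
    _ = ENNReal.ofReal ε := by
        rw [← ENNReal.ofReal_add (by positivity) (by positivity),
          ← ENNReal.ofReal_add (by positivity) (by positivity)]
        congr 1; ring

/-! ### Weak compactness -/

/-- Bounded sequences in a separable Hilbert space have weakly convergent subsequences. -/
theorem exists_subseq_weak_tendsto {H : Type*} [NormedAddCommGroup H] [InnerProductSpace ℝ H]
    [CompleteSpace H] [TopologicalSpace.SeparableSpace H] {x : ℕ → H} {R : ℝ}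
    (hx : ∀ n, ‖x n‖ ≤ R) :
    ∃ (a : H) (φ : ℕ → ℕ), StrictMono φ ∧
      ∀ y, Tendsto (fun n => inner ℝ (x (φ n)) y) atTop (𝓝 (inner ℝ a y)) := by
  have h := WeakDual.isSeqCompact_closedBall ℝ H 0 R
  obtain ⟨f, -, φ, hφ, hlim⟩ := h (x := fun n =>
    StrongDual.toWeakDual (InnerProductSpace.toDual ℝ H (x n))) (fun n => by simpa using hx n)
  refine ⟨(InnerProductSpace.toDual ℝ H).symm (WeakDual.toStrongDual f), φ, hφ, fun y => ?_⟩
  have h1 := ((WeakDual.eval_continuous y).tendsto f).comp hlim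
  rw [InnerProductSpace.toDual_symm_apply]
  exact h1

theorem norm_sub_sq_sub_tendsto {H : Type*} [NormedAddCommGroup H] [InnerProductSpace ℝ H]
    {x : ℕ → H} {a : H} (h : Tendsto (fun n => inner ℝ (x n) a) atTop (𝓝 (inner ℝ a a))) :
    Tendsto (fun n => ‖x n - a‖ ^ 2 - ‖x n‖ ^ 2) atTop (𝓝 (-‖a‖ ^ 2)) := by
  have e : ∀ n, ‖x n - a‖ ^ 2 - ‖x n‖ ^ 2 = ‖a‖ ^ 2 - 2 * inner ℝ (x n) a := fun n => by
    rw [norm_sub_sq_real]; ring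
  simp only [e]
  have := (h.const_mul 2).const_sub (‖a‖ ^ 2)
  rw [real_inner_self_eq_norm_sq] at this
  convert this using 2
  ring

theorem ballAvg_eq_mul_integral (t : ℝ) (v : RN N → ℝ) (x : RN N) :
    ballAvg t v x = (volume (Metric.ball (0 : RN N) t))⁻¹.toReal *
      ∫ y in Metric.ball x t, v y := by
  rw [ballAvg, ballProb_eq, integral_smul_measure, smul_eq_mul]
  congr 1
  have mp := measurePreserving_add_left (volume : Measure (RN N)) x
  have := mp.setIntegral_preimage_emb (Homeomorph.addLeft x).measurableEmbedding v
    (Metric.ball x t)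
  rw [← this]
  congr 2
  ext z
  simp

theorem ballAvg_eq_inner (t : ℝ) {v : RN N → ℝ} (hv : MemLp v 2) (x : RN N) :
    ballAvg t v x = (volume (Metric.ball (0 : RN N) t))⁻¹.toReal *
      inner ℝ (hv.toLp v) (indicatorConstLp 2 (measurableSet_ball (x := x) (ε := t))
        measure_ball_lt_top.ne (1 : ℝ)) := by
  rw [ballAvg_eq_mul_integral, real_inner_comm, L2.inner_indicatorConstLp_one]
  congr 1
  refine setIntegral_congr_ae measurableSet_ball ?_
  filter_upwards [hv.coeFn_toLp] with y hy _
  exact hy.symm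

/-- A finite measure that is bounded by the Lebesgue measure and has the same null sets. -/
def finiteWeight (N : ℕ) : Measure (RN N) :=
  volume.withDensity fun x => ENNReal.ofReal ((1 + ‖x‖) ^ (-((N : ℝ) + 1)))

instance : IsFiniteMeasure (finiteWeight N) := by
  refine isFiniteMeasure_withDensity ?_
  have := finite_integral_one_add_norm (E := RN N) (μ := volume) (r := (N : ℝ) + 1) (by simp)
  exact this.ne

theorem finiteWeight_le : finiteWeight N ≤ volume := by
  calc finiteWeight N ≤ (volume : Measure (RN N)).withDensity 1 := by
        refine withDensity_mono (Eventually.of_forall fun x => ?_)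
        rw [Pi.one_apply, ENNReal.ofReal_le_one]
        exact Real.rpow_le_one_of_one_le_of_nonpos (by linarith [norm_nonneg x])
          (by have : (0 : ℝ) ≤ N := by positivity
              linarith)
    _ = volume := withDensity_one

theorem absolutelyContinuous_finiteWeight : (volume : Measure (RN N)) ≪ finiteWeight N := by
  refine withDensity_absolutelyContinuous' (by fun_prop) (Eventually.of_forall fun x => ?_)
  have : 0 < 1 + ‖x‖ := by positivity
  simp only [ne_eq, ENNReal.ofReal_eq_zero, not_le]
  positivity

theorem enorm_add_add_sq_le (a b c : ℝ) :
    ‖a + b + c‖ₑ ^ 2 ≤ 3 * (‖a‖ₑ ^ 2 + ‖b‖ₑ ^ 2 + ‖c‖ₑ ^ 2) := by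
  have e : (3 : ℝ≥0∞) = ENNReal.ofReal 3 := by norm_num
  rw [enorm_sq_eq_ofReal, enorm_sq_eq_ofReal, enorm_sq_eq_ofReal, enorm_sq_eq_ofReal, e,
    ← ENNReal.ofReal_add (by positivity) (by positivity),
    ← ENNReal.ofReal_add (by positivity) (by positivity), ← ENNReal.ofReal_mul (by norm_num)]
  refine ENNReal.ofReal_le_ofReal ?_
  simp only [sq_abs]
  nlinarith [sq_nonneg (a - b), sq_nonneg (b - c), sq_nonneg (a - c)]

/-- Local strong convergence: if the averages over small balls converge, then so do the functions,
since they are uniformly close to their averages in `L^2`. -/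
theorem tendsto_lintegral_finiteWeight {w : ℕ → RN N → ℝ} {g : ℕ → RN N → RN N} {u : RN N → ℝ}
    {k : RN N → RN N} (hw : ∀ n, SobolevPair (w n) (g n)) (hwS : ∀ n, sobolevSq (w n) ≤ 1)
    (hu : SobolevPair u k) (huS : sobolevSq u ≤ 1)
    (havg : ∀ t x, Tendsto (fun n => ballAvg t (w n) x) atTop (𝓝 (ballAvg t u x))) :
    Tendsto (fun n => ∫⁻ x, ‖w n x - u x‖ₑ ^ 2 ∂(finiteWeight N)) atTop (𝓝 0) := by
  rw [ENNReal.tendsto_nhds_zero]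
  intro ε hε
  obtain ⟨δ, hδ0, hδ⟩ : ∃ δ : ℝ≥0, 0 < δ ∧ 3 * (δ + δ + δ : ℝ≥0∞) ≤ ε := by
    obtain ⟨δ, h1, h2⟩ := ENNReal.lt_iff_exists_nnreal_btwn.1 (ENNReal.div_pos hε.ne'
      (by norm_num : (9 : ℝ≥0∞) ≠ ⊤))
    refine ⟨δ, by exact_mod_cast h1, ?_⟩
    have h3 := (ENNReal.le_div_iff_mul_le (by norm_num) (by norm_num)).1 h2.le
    calc 3 * (δ + δ + δ : ℝ≥0∞) = δ * 9 := by ring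
      _ ≤ ε := h3
  set t : ℝ := √δ with ht
  have ht0 : 0 < t := by positivity
  have ht2 : ENNReal.ofReal (t ^ 2) = δ := by
    rw [ht, Real.sq_sqrt (by positivity), ENNReal.ofReal_coe_nnreal]
  have := isProbabilityMeasure_ballProb (N := N) ht0
  set V : ℝ≥0∞ := (volume (Metric.ball (0 : RN N) t))⁻¹ with hV
  have hVfin : V ≠ ⊤ := ENNReal.inv_ne_top.2 (Metric.measure_ball_pos _ _ ht0).ne'
  have hbd : ∀ {v : RN N → ℝ} {g : RN N → RN N}, SobolevPair v g → sobolevSq v ≤ 1 → ∀ x,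
      ‖ballAvg t v x‖ₑ ^ 2 ≤ V := by
    intro v g h hS x
    have := enorm_ballAvg_rpow_le (memLp_locallyIntegrable h.memLp) one_le_two ht0 x
    simp only [ENNReal.rpow_two] at this
    calc _ ≤ _ := this
      _ ≤ V * 1 := by gcongr; exact h.lintegral_sq_le hS
      _ = V := mul_one V
  have hmid : Tendsto (fun n => ∫⁻ x, ‖ballAvg t (w n) x - ballAvg t u x‖ₑ ^ 2 ∂(finiteWeight N))
      atTop (𝓝 0) := by
    have h0 : ∫⁻ _, (0 : ℝ≥0∞) ∂(finiteWeight N) = 0 := lintegral_zero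
    rw [← h0]
    refine tendsto_lintegral_of_dominated_convergence' (fun _ => 3 * (V + V + 0)) ?_ ?_ ?_ ?_
    · intro n
      have : AEStronglyMeasurable (fun x => ballAvg t (w n) x - ballAvg t u x) :=
        (aestronglyMeasurable_ballAvg (hw n).memLp.1 t).sub
          (aestronglyMeasurable_ballAvg hu.memLp.1 t)
      exact (this.mono_measure finiteWeight_le).enorm.pow_const 2
    · intro n
      refine Eventually.of_forall fun x => ?_
      calc ‖ballAvg t (w n) x - ballAvg t u x‖ₑ ^ 2
          = ‖ballAvg t (w n) x + (-ballAvg t u x) + 0‖ₑ ^ 2 := by rw [add_zero, sub_eq_add_neg]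
        _ ≤ 3 * (‖ballAvg t (w n) x‖ₑ ^ 2 + ‖-ballAvg t u x‖ₑ ^ 2 + ‖(0 : ℝ)‖ₑ ^ 2) :=
            enorm_add_add_sq_le _ _ _
        _ ≤ 3 * (V + V + 0) := by
            gcongr
            · exact hbd (hw n) (hwS n) x
            · rw [enorm_neg]; exact hbd hu huS x
            · simp
    · rw [lintegral_const]
      finiteness
    · refine Eventually.of_forall fun x => ?_
      have h1 := ((havg t x).sub_const (ballAvg t u x)).enorm
      have h2 := ENNReal.Tendsto.pow (n := 2) h1
      simpa using h2
  filter_upwards [ENNReal.tendsto_nhds_zero.1 hmid δ (by simpa using hδ0)] with n hn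
  have m1 : AEMeasurable (fun x => ‖w n x - ballAvg t (w n) x‖ₑ ^ 2) (finiteWeight N) := by
    have : AEStronglyMeasurable (fun x => w n x - ballAvg t (w n) x) :=
      (hw n).memLp.1.sub (aestronglyMeasurable_ballAvg (hw n).memLp.1 t)
    exact (this.mono_measure finiteWeight_le).enorm.pow_const 2
  have m3 : AEMeasurable (fun x => ‖ballAvg t u x - u x‖ₑ ^ 2) (finiteWeight N) := by
    have : AEStronglyMeasurable (fun x => ballAvg t u x - u x) :=
      (aestronglyMeasurable_ballAvg hu.memLp.1 t).sub hu.memLp.1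
    exact (this.mono_measure finiteWeight_le).enorm.pow_const 2
  calc ∫⁻ x, ‖w n x - u x‖ₑ ^ 2 ∂(finiteWeight N)
      ≤ ∫⁻ x, 3 * (‖w n x - ballAvg t (w n) x‖ₑ ^ 2 +
          ‖ballAvg t (w n) x - ballAvg t u x‖ₑ ^ 2 +
          ‖ballAvg t u x - u x‖ₑ ^ 2) ∂(finiteWeight N) := by
        refine lintegral_mono fun x => ?_
        refine le_trans (le_of_eq ?_) (enorm_add_add_sq_le _ _ _)
        congr 2
        ring
    _ = 3 * ((∫⁻ x, ‖w n x - ballAvg t (w n) x‖ₑ ^ 2 ∂(finiteWeight N)) +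
          (∫⁻ x, ‖ballAvg t (w n) x - ballAvg t u x‖ₑ ^ 2 ∂(finiteWeight N)) +
          ∫⁻ x, ‖ballAvg t u x - u x‖ₑ ^ 2 ∂(finiteWeight N)) := by
        rw [lintegral_const_mul' _ _ (by norm_num), lintegral_add_right' _ m3,
          lintegral_add_left' m1]
    _ ≤ 3 * (δ + δ + δ) := by
        gcongr
        · refine (lintegral_mono' finiteWeight_le le_rfl).trans ?_
          exact ((hw n).lintegral_sub_ballAvg_le (hwS n) ht0).trans ht2.le
        · refine (lintegral_mono' finiteWeight_le le_rfl).trans ?_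
          refine le_trans (le_of_eq ?_) ((hu.lintegral_sub_ballAvg_le huS ht0).trans ht2.le)
          exact lintegral_congr fun x => by rw [enorm_sub_rev]
    _ ≤ ε := hδ

/-- Sequential weak compactness of the unit ball of `W^{1,2}`, with almost everywhere convergence
of the functions, convergence of ball averages, and the Pythagorean splitting of the norm. -/
theorem exists_subseq_sobolev {v : ℕ → RN N → ℝ} {g : ℕ → RN N → RN N}
    (h : ∀ n, SobolevPair (v n) (g n)) (hS : ∀ n, sobolevSq (v n) ≤ 1) :
    ∃ (u : RN N → ℝ) (k : RN N → RN N) (φ : ℕ → ℕ), StrictMono φ ∧ SobolevPair u k ∧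
      sobolevSq u ≤ 1 ∧
      (∀ᵐ x, Tendsto (fun n => v (φ n) x) atTop (𝓝 (u x))) ∧
      (∀ t x, Tendsto (fun n => ballAvg t (v (φ n)) x) atTop (𝓝 (ballAvg t u x))) ∧
      Tendsto (fun n => sobolevSq (fun x => v (φ n) x - u x) - sobolevSq (v (φ n))) atTop
        (𝓝 (-sobolevSq u)) := by
  have hb := fun n => (h n).sobolevSq_eq_norm ▸ hS n
  have b1 : ∀ n, ‖(h n).memLp.toLp (v n)‖ ≤ 1 := fun n => by
    nlinarith [hb n, sq_nonneg ‖(h n).memLp_grad.toLp (g n)‖, norm_nonneg ((h n).memLp.toLp (v n))]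
  have b2 : ∀ n, ‖(h n).memLp_grad.toLp (g n)‖ ≤ 1 := fun n => by
    nlinarith [hb n, sq_nonneg ‖(h n).memLp.toLp (v n)‖, norm_nonneg ((h n).memLp_grad.toLp (g n))]
  have : Fact ((2 : ℝ≥0∞) ≠ ⊤) := ⟨by norm_num⟩
  obtain ⟨a, φ₁, hφ₁, ha⟩ := exists_subseq_weak_tendsto b1
  obtain ⟨b, φ₂, hφ₂, hb'⟩ := exists_subseq_weak_tendsto fun n => b2 (φ₁ n)
  have ha' := fun y => (ha y).comp hφ₂.tendsto_atTop
  set φ := φ₁ ∘ φ₂ with hφ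
  have hφm : StrictMono φ := hφ₁.comp hφ₂
  have hu : MemLp (a : RN N → ℝ) 2 := Lp.memLp a
  have hk : MemLp (b : RN N → RN N) 2 := Lp.memLp b
  have eu : hu.toLp a = a := Lp.toLp_coeFn a hu
  have ek : hk.toLp b = b := Lp.toLp_coeFn b hk
  have hpair : SobolevPair (a : RN N → ℝ) (b : RN N → RN N) := by
    refine SobolevPair.of_integral_inner hu hk fun ψ hψ e => ?_
    have hd : MemLp (fun x => fderiv ℝ ψ x e) 2 :=
      ((hψ.1.continuous_fderiv (by simp)).clm_apply continuous_const).memLp_of_hasCompactSupport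
        (hψ.2.fderiv_apply ℝ e)
    have hψe : MemLp (fun x => ψ x • e) 2 :=
      (hψ.continuous.smul continuous_const).memLp_of_hasCompactSupport hψ.2.smul_right
    have e1 : ∀ {v : RN N → ℝ} (hv : MemLp v 2),
        ∫ x, v x * fderiv ℝ ψ x e = inner ℝ (hv.toLp v) (hd.toLp _) := fun hv => by
      rw [← integral_inner_eq_inner_toLp]
      simp [mul_comm]
    have e2 : ∀ {g : RN N → RN N} (hg : MemLp g 2),
        ∫ x, ψ x * inner ℝ e (g x) = inner ℝ (hg.toLp g) (hψe.toLp _) := fun hg => by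
      rw [← integral_inner_eq_inner_toLp]
      simp [inner_smul_right, real_inner_comm]
    rw [e1 hu, e2 hk, eu, ek]
    have l1 := ha' (hd.toLp _)
    have l2 := (hb' (hψe.toLp _)).neg
    refine tendsto_nhds_unique l1 (l2.congr fun n => ?_)
    have := (h (φ n)).integral_inner_eq hψ e
    rw [e1 (h (φ n)).memLp, e2 (h (φ n)).memLp_grad] at this
    exact this.symm
  have hpyth : Tendsto (fun n => sobolevSq (fun x => v (φ n) x - a x) - sobolevSq (v (φ n))) atTop
      (𝓝 (-sobolevSq a)) := by
    have t1 := norm_sub_sq_sub_tendsto (ha' a)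
    have t2 := norm_sub_sq_sub_tendsto (hb' b)
    have t3 := t2.add t1
    have e0 : -‖b‖ ^ 2 + -‖a‖ ^ 2 = -sobolevSq a := by
      rw [hpair.sobolevSq_eq_norm, eu, ek]; ring
    rw [e0] at t3
    refine t3.congr fun n => ?_
    have e1 : sobolevSq (fun x => v (φ n) x - a x) =
        ‖((h (φ n)).memLp_grad.sub hpair.memLp_grad).toLp (g (φ n) - (b : RN N → RN N))‖ ^ 2 +
        ‖((h (φ n)).memLp.sub hpair.memLp).toLp (v (φ n) - (a : RN N → ℝ))‖ ^ 2 :=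
      ((h (φ n)).sub hpair).sobolevSq_eq_norm
    rw [MemLp.toLp_sub (h (φ n)).memLp_grad hpair.memLp_grad,
      MemLp.toLp_sub (h (φ n)).memLp hpair.memLp, eu, ek] at e1
    rw [e1, (h (φ n)).sobolevSq_eq_norm]
    simp only [Function.comp_apply, hφ]
    ring
  have hSu : sobolevSq (a : RN N → ℝ) ≤ 1 := by
    have : -1 ≤ -sobolevSq (a : RN N → ℝ) := by
      refine ge_of_tendsto' hpyth fun n => ?_
      have := sobolevSq_nonneg (fun x => v (φ n) x - a x)
      linarith [hS (φ n)]
    linarith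
  have havg : ∀ t x, Tendsto (fun n => ballAvg t (v (φ n)) x) atTop (𝓝 (ballAvg t a x)) := by
    intro t x
    rw [ballAvg_eq_inner t hu, eu]
    refine ((ha' _).const_mul _).congr fun n => ?_
    rw [ballAvg_eq_inner t (h (φ n)).memLp]
    rfl
  have hfin := tendsto_lintegral_finiteWeight (fun n => h (φ n)) (fun n => hS (φ n)) hpair hSu havg
  have hLp : Tendsto (fun n => eLpNorm (v (φ n) - (a : RN N → ℝ)) 2 (finiteWeight N)) atTop
      (𝓝 0) := by
    have e : ∀ n, eLpNorm (v (φ n) - (a : RN N → ℝ)) 2 (finiteWeight N) =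
        (∫⁻ x, ‖v (φ n) x - a x‖ₑ ^ 2 ∂(finiteWeight N)) ^ (1 / 2 : ℝ) := fun n => by
      rw [eLpNorm_eq_lintegral_rpow_enorm_toReal (by norm_num) (by norm_num)]
      simp
    simp only [e]
    have := ((ENNReal.continuous_rpow_const (y := (1 / 2 : ℝ))).tendsto 0).comp hfin
    rwa [ENNReal.zero_rpow_of_pos (by norm_num)] at this
  have hmeas := tendstoInMeasure_of_tendsto_eLpNorm (by norm_num)
    (fun n => (h (φ n)).memLp.1.mono_measure finiteWeight_le) (hu.1.mono_measure finiteWeight_le)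
    hLp
  obtain ⟨ns, hns, hae⟩ := hmeas.exists_seq_tendsto_ae
  refine ⟨a, b, φ ∘ ns, hφm.comp hns, hpair, hSu, ?_, fun t x => ?_, ?_⟩
  · exact absolutelyContinuous_finiteWeight.ae_le hae
  · exact (havg t x).comp hns.tendsto_atTop
  · exact hpyth.comp hns.tendsto_atTop

/-! ### The nonlocal term on the Sobolev space -/

/-- The assumptions on the parameters of the Choquard equation. -/
structure Admissible (N : ℕ) (α p : ℝ) : Prop where
  one_le : 1 ≤ N
  mem_Ioo : α ∈ Ioo (0 : ℝ) N
  one_lt : 1 < p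
  lower : ((N : ℝ) - 2) / (N + α) < 1 / p
  upper : 1 / p < (N : ℝ) / (N + α)

/-- `v` lies in `L^q` for all exponents `q > 2` below the critical Sobolev exponent. -/
def SubcriticalLp (v : RN N → ℝ) : Prop :=
  AEStronglyMeasurable v ∧
    ∀ q : ℝ, 2 < q → ((N : ℝ) - 2) * q < 2 * N → ∫⁻ x, ‖v x‖ₑ ^ q ≠ ⊤

theorem memLp_iff_lintegral_rpow {v : RN N → ℝ} (hv : AEStronglyMeasurable v) {q : ℝ}
    (hq : 0 < q) : MemLp v (ENNReal.ofReal q) ↔ ∫⁻ x, ‖v x‖ₑ ^ q ≠ ⊤ := by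
  have h := eLpNorm_lt_top_iff_lintegral_rpow_enorm_lt_top (μ := volume) (f := v)
    (p := ENNReal.ofReal q) (by simpa using hq) ENNReal.ofReal_ne_top
  rw [ENNReal.toReal_ofReal hq.le] at h
  rw [MemLp, and_iff_right hv, h, lt_top_iff_ne_top]

theorem SubcriticalLp.add {v w : RN N → ℝ} (hv : SubcriticalLp v) (hw : SubcriticalLp w) :
    SubcriticalLp fun x => v x + w x := by
  refine ⟨hv.1.add hw.1, fun q hq hqN => ?_⟩
  have hq0 : 0 < q := by linarith
  have h1 := (memLp_iff_lintegral_rpow hv.1 hq0).2 (hv.2 q hq hqN)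
  have h2 := (memLp_iff_lintegral_rpow hw.1 hq0).2 (hw.2 q hq hqN)
  exact (memLp_iff_lintegral_rpow (hv.1.add hw.1) hq0).1 (h1.add h2)

theorem SubcriticalLp.abs {v : RN N → ℝ} (hv : SubcriticalLp v) :
    SubcriticalLp fun x => |v x| :=
  ⟨hv.1.norm, fun q hq hqN => by simpa using hv.2 q hq hqN⟩

theorem subcriticalLp_of_memLp {v : RN N → ℝ} (hv : ∀ q : ℝ≥0∞, MemLp v q) :
    SubcriticalLp v :=
  ⟨(hv 2).1, fun _ hq _ => (memLp_iff_lintegral_rpow (hv 2).1 (by linarith)).1 (hv _)⟩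

theorem HasSobolevBound.exists_forall {q : ℝ} (hq : 0 ≤ q) (h : HasSobolevBound N q) {R : ℝ}
    (hR : 0 < R) : ∃ A : ℝ≥0, ∀ (v : RN N → ℝ) (g : RN N → RN N), SobolevPair v g →
      sobolevSq v ≤ R ^ 2 → ∫⁻ x, ‖v x‖ₑ ^ q ≤ A := by
  obtain ⟨A, hA⟩ := h
  refine ⟨(R ^ q).toNNReal * A, fun v g hv hS => ?_⟩
  have h1 : sobolevSq (fun x => R⁻¹ * v x) ≤ 1 := by
    rw [hv.sobolevSq_const_mul, inv_pow, inv_mul_le_one₀ (by positivity)]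
    exact hS
  have h2 := hA _ _ (hv.const_smul R⁻¹) h1
  have e : ∀ x, ‖v x‖ₑ ^ q = ENNReal.ofReal (R ^ q) * ‖R⁻¹ * v x‖ₑ ^ q := fun x => by
    rw [enorm_rpow_eq_ofReal hq, enorm_rpow_eq_ofReal hq, ← ENNReal.ofReal_mul (by positivity),
      ← Real.mul_rpow hR.le (abs_nonneg _), abs_mul, abs_of_pos (inv_pos.2 hR),
      mul_inv_cancel_left₀ hR.ne']
  simp only [e]
  rw [lintegral_const_mul' _ _ ENNReal.ofReal_ne_top]
  push_cast
  gcongr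
  rfl

theorem SobolevPair.subcriticalLp (hN : 1 ≤ N) {v : RN N → ℝ} {g : RN N → RN N}
    (h : SobolevPair v g) : SubcriticalLp v := by
  refine ⟨h.memLp.1, fun q hq hqN => ?_⟩
  have h0 := sobolevSq_nonneg v
  obtain ⟨A, hA⟩ := (hasSobolevBound hN hq.le hqN).exists_forall (by linarith)
    (by linarith : 0 < sobolevSq v + 1)
  exact ne_top_of_le_ne_top ENNReal.coe_ne_top (hA v g h (by nlinarith))

theorem Admissible.doubleInt_ne_top {α p : ℝ} (H : Admissible N α p) {v : RN N → ℝ}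
    (hv : SubcriticalLp v) : doubleInt (rieszNN N α) p v ≠ ⊤ := by
  have hp0 : 0 < p := by linarith [H.one_lt]
  obtain ⟨r₁, s₁, h₁, k₁⟩ := exists_near_exponents H.one_le H.mem_Ioo H.lower H.upper H.one_lt
  obtain ⟨r₂, s₂, h₂, k₂⟩ := exists_far_exponents H.one_le H.mem_Ioo H.lower H.upper H.one_lt
  obtain ⟨C₁, b₁⟩ := exists_doubleInt_le (N := N) h₁.one_lt_r h₁.one_lt_s h₁.sum_eq hp0
  obtain ⟨C₂, b₂⟩ := exists_doubleInt_le (N := N) h₂.one_lt_r h₂.one_lt_s h₂.sum_eq hp0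
  have f₁ := hv.2 _ h₁.two_lt h₁.subcritical
  have f₂ := hv.2 _ h₂.two_lt h₂.subcritical
  rw [doubleInt_riesz_eq hv.1]
  refine ENNReal.add_ne_top.2 ⟨?_, ?_⟩
  · exact ne_top_of_le_ne_top (by finiteness) (b₁ _ v (measurable_nearKernel α) hv.1)
  · exact ne_top_of_le_ne_top (by finiteness) (b₂ _ v (measurable_farKernel α) hv.1)

theorem doubleInt_const_mul (K : RN N → ℝ≥0) {p : ℝ} (t : ℝ) (v : RN N → ℝ) :
    doubleInt K p (fun x => t * v x) = ((‖t‖₊ ^ p * ‖t‖₊ ^ p : ℝ≥0) : ℝ≥0∞) * doubleInt K p v := by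
  unfold doubleInt
  rw [← lintegral_const_mul' _ _ ENNReal.coe_ne_top]
  refine lintegral_congr fun z => ?_
  rw [← ENNReal.coe_mul, nnnorm_mul, nnnorm_mul, NNReal.mul_rpow, NNReal.mul_rpow]
  congr 1
  ring

theorem doubleInt_comp_add (K : RN N → ℝ≥0) (p : ℝ) (v : RN N → ℝ) (a : RN N) :
    doubleInt K p (fun x => v (x + a)) = doubleInt K p v := by
  unfold doubleInt
  rw [Measure.volume_eq_prod]
  have := lintegral_add_right_eq_self
    (μ := (volume : Measure (RN N)).prod (volume : Measure (RN N)))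
    (fun z : RN N × RN N => ((K (z.1 - z.2) * ‖v z.1‖₊ ^ p * ‖v z.2‖₊ ^ p : ℝ≥0) : ℝ≥0∞)) (a, a)
  rw [← this]
  simp

theorem nullSingletonClass_volume (hN : 1 ≤ N) : NullSingletonClass (volume : Measure (RN N)) := by
  have : Nonempty (Fin N) := ⟨⟨0, hN⟩⟩
  have : Nontrivial (RN N) := inferInstance
  infer_instance

theorem Admissible.doubleInt_ne_zero {α p : ℝ} (H : Admissible N α p) {v : RN N → ℝ}
    (hv : AEStronglyMeasurable v) (hv0 : ¬ v =ᵐ[volume] 0) :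
    doubleInt (rieszNN N α) p v ≠ 0 := by
  intro h0
  have hp0 : 0 < p := by linarith [H.one_lt]
  have := nullSingletonClass_volume H.one_le
  have hm : AEMeasurable fun z : RN N × RN N =>
      ((rieszNN N α (z.1 - z.2) * ‖v z.1‖₊ ^ p * ‖v z.2‖₊ ^ p : ℝ≥0) : ℝ≥0∞) :=
    (aemeasurable_doubleInt_integrand (measurable_rieszNN α) hv).coe_nnreal_ennreal
  have h1 := (lintegral_eq_zero_iff' hm).1 h0
  rw [Measure.volume_eq_prod] at h1
  have h2 := Measure.ae_ae_of_ae_prod h1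
  have h3 : ∃ᵐ x : RN N, v x ≠ 0 := fun h => hv0 (by simpa [EventuallyEq] using h)
  obtain ⟨x, hx0, hx⟩ := (h3.and_eventually h2).exists
  refine hv0 ?_
  have h4 : ∀ᵐ y : RN N, y ≠ x := by
    rw [ae_iff]; simp
  filter_upwards [hx, h4] with y hy hyx
  have hk := rieszNN_pos (N := N) H.mem_Ioo (sub_ne_zero.2 hyx.symm)
  simp only [Pi.zero_apply, ENNReal.coe_eq_zero, mul_eq_zero] at hy
  have hy' := hy
  rw [or_iff_right (by
    rintro (h | h)
    · exact hk.ne' h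
    · exact hx0 (by simpa [NNReal.rpow_eq_zero_iff, hp0.ne'] using h))] at hy'
  simpa [NNReal.rpow_eq_zero_iff, hp0.ne'] using hy'

theorem doubleInt_eq_zero {K : RN N → ℝ≥0} {p : ℝ} (hp : 0 < p) {v : RN N → ℝ}
    (hv : v =ᵐ[volume] 0) : doubleInt K p v = 0 := by
  unfold doubleInt
  rw [lintegral_eq_zero_of_ae_eq_zero]
  have h : ∀ᵐ z : RN N × RN N, v z.1 = 0 := by
    rw [Measure.volume_eq_prod]
    exact Measure.quasiMeasurePreserving_fst.ae hv
  filter_upwards [h] with z hz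
  simp [hz, NNReal.zero_rpow hp.ne']

theorem exists_test_ne_zero (N : ℕ) :
    ∃ φ : RN N → ℝ, IsTestFunction φ ∧ ¬ φ =ᵐ[volume] 0 := by
  let b : ContDiffBump (0 : RN N) := ⟨1, 2, one_pos, one_lt_two⟩
  refine ⟨b, ⟨b.contDiff, b.hasCompactSupport⟩, fun h => ?_⟩
  have h1 := b.continuous.ae_eq_iff_eq volume continuous_zero |>.1 h
  have h2 : b (0 : RN N) = 1 := b.one_of_mem_closedBall (by simp [b])
  rw [h1] at h2
  simp at h2

/-- Functions on which the nonlocal term is not small have a ball average that is not small. -/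
theorem Admissible.exists_ballAvg_lower_bound {α p : ℝ} (H : Admissible N α p) {m : ℝ}
    (hm : 0 < m) : ∃ t δ : ℝ, 0 < t ∧ 0 < δ ∧ ∀ (v : RN N → ℝ) (g : RN N → RN N),
      SobolevPair v g → sobolevSq v ≤ 1 → ENNReal.ofReal m < doubleInt (rieszNN N α) p v →
        ∃ x, δ < |ballAvg t v x| := by
  have hp0 : 0 < p := by linarith [H.one_lt]
  obtain ⟨r₁, s₁, h₁, k₁⟩ := exists_near_exponents H.one_le H.mem_Ioo H.lower H.upper H.one_lt
  obtain ⟨r₂, s₂, h₂, k₂⟩ := exists_far_exponents H.one_le H.mem_Ioo H.lower H.upper H.one_lt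
  obtain ⟨C₁, b₁⟩ := exists_doubleInt_le (N := N) h₁.one_lt_r h₁.one_lt_s h₁.sum_eq hp0
  obtain ⟨C₂, b₂⟩ := exists_doubleInt_le (N := N) h₂.one_lt_r h₂.one_lt_s h₂.sum_eq hp0
  set X₁ : ℝ≥0 := C₁ * (∫⁻ x, (nearKernel N α x ^ s₁ : ℝ≥0)).toNNReal with hX₁
  set X₂ : ℝ≥0 := C₂ * (∫⁻ x, (farKernel N α x ^ s₂ : ℝ≥0)).toNNReal with hX₂
  set ε : ℝ := min 1 (m / (2 + X₁ + X₂)) with hε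
  have hε0 : 0 < ε := by positivity
  have hε1 : ε ≤ 1 := min_le_left _ _
  have hεm : ε * (2 + X₁ + X₂) ≤ m := by
    calc ε * (2 + X₁ + X₂) ≤ m / (2 + X₁ + X₂) * (2 + X₁ + X₂) := by
          gcongr; exact min_le_right _ _
      _ = m := by field_simp
  obtain ⟨t₁, δ₁, ht₁, hδ₁, v₁⟩ := exists_small_of_ballAvg_small H.one_le h₁.two_lt
    h₁.subcritical hε0
  obtain ⟨t₂, δ₂, ht₂, hδ₂, v₂⟩ := exists_small_of_ballAvg_small H.one_le h₂.two_lt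
    h₂.subcritical hε0
  refine ⟨min t₁ t₂, min δ₁ δ₂, by positivity, by positivity, fun v g hv hS hD => ?_⟩
  by_contra! hcon
  have f₁ := v₁ _ (by positivity) (min_le_left t₁ t₂) v g hv hS
    fun x => (hcon x).trans (min_le_left _ _)
  have f₂ := v₂ _ (by positivity) (min_le_right t₁ t₂) v g hv hS
    fun x => (hcon x).trans (min_le_right _ _)
  refine absurd hD (not_lt.2 ?_)
  rw [doubleInt_riesz_eq hv.memLp.1]
  have hX : ∀ (X : ℝ≥0), ENNReal.ofReal ε * (ENNReal.ofReal ε + X) ≤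
      ENNReal.ofReal (ε * (1 + X)) := fun X => by
    rw [ENNReal.ofReal_mul hε0.le, ENNReal.ofReal_add zero_le_one (by positivity),
      ENNReal.ofReal_coe_nnreal]
    gcongr
  calc _ ≤ ENNReal.ofReal ε * (ENNReal.ofReal ε + X₁) +
        ENNReal.ofReal ε * (ENNReal.ofReal ε + X₂) := by
        refine add_le_add ((b₁ _ v (measurable_nearKernel α) hv.memLp.1).trans ?_)
          ((b₂ _ v (measurable_farKernel α) hv.memLp.1).trans ?_)
        · rw [hX₁, ENNReal.coe_mul, ENNReal.coe_toNNReal k₁]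
          gcongr
        · rw [hX₂, ENNReal.coe_mul, ENNReal.coe_toNNReal k₂]
          gcongr
    _ ≤ ENNReal.ofReal (ε * (1 + X₁)) + ENNReal.ofReal (ε * (1 + X₂)) :=
        add_le_add (hX X₁) (hX X₂)
    _ = ENNReal.ofReal (ε * (2 + X₁ + X₂)) := by
        rw [← ENNReal.ofReal_add (by positivity) (by positivity)]
        congr 1; ring
    _ ≤ ENNReal.ofReal m := ENNReal.ofReal_le_ofReal hεm

/-- The nonlocal term is bounded on the unit ball of `W^{1,2}`. -/
theorem Admissible.exists_doubleInt_bound {α p : ℝ} (H : Admissible N α p) :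
    ∃ A : ℝ≥0, ∀ (v : RN N → ℝ) (g : RN N → RN N), SobolevPair v g → sobolevSq v ≤ 1 →
      doubleInt (rieszNN N α) p v ≤ A := by
  have hp0 : 0 < p := by linarith [H.one_lt]
  obtain ⟨r₁, s₁, h₁, k₁⟩ := exists_near_exponents H.one_le H.mem_Ioo H.lower H.upper H.one_lt
  obtain ⟨r₂, s₂, h₂, k₂⟩ := exists_far_exponents H.one_le H.mem_Ioo H.lower H.upper H.one_lt
  obtain ⟨C₁, b₁⟩ := exists_doubleInt_le (N := N) h₁.one_lt_r h₁.one_lt_s h₁.sum_eq hp0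
  obtain ⟨C₂, b₂⟩ := exists_doubleInt_le (N := N) h₂.one_lt_r h₂.one_lt_s h₂.sum_eq hp0
  obtain ⟨A₁, a₁⟩ := hasSobolevBound H.one_le h₁.two_lt.le h₁.subcritical
  obtain ⟨A₂, a₂⟩ := hasSobolevBound H.one_le h₂.two_lt.le h₂.subcritical
  have hfin : (A₁ : ℝ≥0∞) * (A₁ + C₁ * ∫⁻ x, (nearKernel N α x ^ s₁ : ℝ≥0)) +
      A₂ * (A₂ + C₂ * ∫⁻ x, (farKernel N α x ^ s₂ : ℝ≥0)) ≠ ⊤ := by finiteness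
  obtain ⟨A, hA⟩ : ∃ A : ℝ≥0, (A : ℝ≥0∞) = _ := ⟨_, ENNReal.coe_toNNReal hfin⟩
  refine ⟨A, fun v g hv hS => ?_⟩
  rw [hA, doubleInt_riesz_eq hv.memLp.1]
  refine add_le_add ((b₁ _ v (measurable_nearKernel α) hv.memLp.1).trans ?_)
    ((b₂ _ v (measurable_farKernel α) hv.memLp.1).trans ?_)
  · have := a₁ v g hv hS
    gcongr
  · have := a₂ v g hv hS
    gcongr

/-! ### Existence of a maximizer -/

theorem sobolevSq_sub_le {v w : RN N → ℝ} {g k : RN N → RN N} (hv : SobolevPair v g)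
    (hw : SobolevPair w k) :
    sobolevSq (fun x => v x - w x) ≤ 2 * sobolevSq v + 2 * sobolevSq w := by
  have e1 : sobolevSq (fun x => v x - w x) =
      ‖(hv.memLp_grad.sub hw.memLp_grad).toLp (g - k)‖ ^ 2 +
      ‖(hv.memLp.sub hw.memLp).toLp (v - w)‖ ^ 2 := (hv.sub hw).sobolevSq_eq_norm
  rw [MemLp.toLp_sub hv.memLp_grad hw.memLp_grad, MemLp.toLp_sub hv.memLp hw.memLp] at e1
  rw [e1, hv.sobolevSq_eq_norm, hw.sobolevSq_eq_norm]
  have h1 := parallelogram_law_with_norm ℝ (hv.memLp_grad.toLp g) (hw.memLp_grad.toLp k)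
  have h2 := parallelogram_law_with_norm ℝ (hv.memLp.toLp v) (hw.memLp.toLp w)
  nlinarith [sq_nonneg ‖hv.memLp_grad.toLp g + hw.memLp_grad.toLp k‖,
    sq_nonneg ‖hv.memLp.toLp v + hw.memLp.toLp w‖]

/-- The Brezis–Lieb inequality for the Riesz kernel along a sequence in `W^{1,2}`. -/
theorem Admissible.eventually_doubleInt_le {α p : ℝ} (H : Admissible N α p)
    {w : ℕ → RN N → ℝ} {g : ℕ → RN N → RN N} {u : RN N → ℝ} {k : RN N → RN N}
    (hw : ∀ n, SobolevPair (w n) (g n)) (hwS : ∀ n, sobolevSq (w n) ≤ 1)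
    (hu : SobolevPair u k) (huS : sobolevSq u ≤ 1)
    (hlim : ∀ᵐ x, Tendsto (fun n => w n x) atTop (𝓝 (u x)))
    {c : ℝ≥0} (hc : 1 < c) {η : ℝ≥0} (hη : 0 < η) :
    ∀ᶠ n in atTop, doubleInt (rieszNN N α) p (w n) ≤
      c ^ 2 * doubleInt (rieszNN N α) p (fun x => w n x - u x) +
        doubleInt (rieszNN N α) p u + (η + η) := by
  obtain ⟨r₁, s₁, h₁, k₁⟩ := exists_near_exponents H.one_le H.mem_Ioo H.lower H.upper H.one_lt
  obtain ⟨r₂, s₂, h₂, k₂⟩ := exists_far_exponents H.one_le H.mem_Ioo H.lower H.upper H.one_lt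
  have hS : ∀ n, sobolevSq (fun x => w n x - u x) ≤ 2 ^ 2 := fun n => by
    linarith [sobolevSq_sub_le (hw n) hu, hwS n]
  have two0 : (0 : ℝ) < 2 := by norm_num
  obtain ⟨B₁, a₁⟩ := (hasSobolevBound H.one_le h₁.two_lt.le h₁.subcritical).exists_forall
    (by linarith [h₁.two_lt]) two0
  obtain ⟨B₂, a₂⟩ := (hasSobolevBound H.one_le h₂.two_lt.le h₂.subcritical).exists_forall
    (by linarith [h₂.two_lt]) two0
  have hsub := hu.subcriticalLp H.one_le
  have e₁ := Choquard.eventually_doubleInt_le h₁.one_lt_r h₁.one_lt_s h₁.sum_eq H.one_lt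
    (measurable_nearKernel α) k₁ (fun n => (hw n).memLp.1) hu.memLp.1 hlim
    (fun n => a₁ _ _ ((hw n).sub hu) (hS n)) (hsub.2 _ h₁.two_lt h₁.subcritical) hc hη
  have e₂ := Choquard.eventually_doubleInt_le h₂.one_lt_r h₂.one_lt_s h₂.sum_eq H.one_lt
    (measurable_farKernel α) k₂ (fun n => (hw n).memLp.1) hu.memLp.1 hlim
    (fun n => a₂ _ _ ((hw n).sub hu) (hS n)) (hsub.2 _ h₂.two_lt h₂.subcritical) hc hη
  filter_upwards [e₁, e₂] with n hn₁ hn₂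
  rw [doubleInt_riesz_eq (hw n).memLp.1, doubleInt_riesz_eq ((hw n).sub hu).memLp.1,
    doubleInt_riesz_eq hu.memLp.1]
  refine (add_le_add hn₁ hn₂).trans (le_of_eq ?_)
  ring

theorem ballAvg_eq_zero {u : RN N → ℝ} (hu : u =ᵐ[volume] 0) (t : ℝ) (x : RN N) :
    ballAvg t u x = 0 := by
  rw [ballAvg_eq_mul_integral, setIntegral_congr_ae (g := fun _ => (0 : ℝ)) measurableSet_ball]
  · simp
  · filter_upwards [hu] with y hy _
    exact hy

/-- Strict superadditivity of `σ ↦ σ ^ p` rules out splitting. -/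
theorem eq_one_of_one_le_rpow_add {p σ : ℝ} (hp : 1 < p) (h0 : 0 < σ) (h1 : σ ≤ 1)
    (h : 1 ≤ (1 - σ) ^ p + σ ^ p) : σ = 1 := by
  by_contra hne
  have hlt : σ < 1 := lt_of_le_of_ne h1 hne
  have a1 : σ ^ p < σ := by
    simpa using Real.rpow_lt_rpow_of_exponent_gt h0 hlt hp
  have a2 : (1 - σ) ^ p < 1 - σ := by
    simpa using Real.rpow_lt_rpow_of_exponent_gt (by linarith : 0 < 1 - σ) (by linarith) hp
  linarith

theorem sq_rpow_eq {p : ℝ} {s : ℝ} (hs : 0 ≤ s) : (s ^ 2) ^ p = s ^ p * s ^ p := by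
  rw [sq, Real.mul_rpow hs hs]

/-- The optimal constant in `D(v) ≤ M S(v)^p`, where `D` is the nonlocal term and `S` the squared
Sobolev norm, is attained: a maximizing sequence, translated so that it does not vanish, converges
to a maximizer, by the Brezis–Lieb inequality and strict superadditivity. -/
theorem Admissible.exists_maximizer {α p : ℝ} (H : Admissible N α p) :
    ∃ M : ℝ, 0 < M ∧
      (∀ v, MemW12 v → (doubleInt (rieszNN N α) p v).toReal ≤ M * sobolevSq v ^ p) ∧
      ∃ u, MemW12 u ∧ sobolevSq u = 1 ∧ (doubleInt (rieszNN N α) p u).toReal = M := by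
  have hp0 : 0 < p := by linarith [H.one_lt]
  set D : (RN N → ℝ) → ℝ := fun v => (doubleInt (rieszNN N α) p v).toReal with hD
  have hDfin : ∀ {v : RN N → ℝ} {g}, SobolevPair v g → doubleInt (rieszNN N α) p v ≠ ⊤ :=
    fun h => H.doubleInt_ne_top (h.subcriticalLp H.one_le)
  have hDmul : ∀ (t : ℝ) (v : RN N → ℝ), D (fun x => t * v x) = |t| ^ p * |t| ^ p * D v := by
    intro t v
    simp only [hD]
    rw [doubleInt_const_mul, ENNReal.toReal_mul]
    simp
  set T : Set ℝ := {m | ∃ v : RN N → ℝ, MemW12 v ∧ sobolevSq v ≤ 1 ∧ D v = m} with hT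
  obtain ⟨A, hA⟩ := H.exists_doubleInt_bound
  have hbdd : BddAbove T := by
    refine ⟨A, ?_⟩
    rintro m ⟨v, hv, hS, rfl⟩
    obtain ⟨g, hg⟩ := hv.exists_pair
    exact ENNReal.toReal_le_coe_of_le_coe (hA v g hg hS)
  set M : ℝ := sSup T with hM
  -- homogeneity
  have hhom : ∀ v, MemW12 v → D v ≤ M * sobolevSq v ^ p := by
    intro v hv
    obtain ⟨g, hg⟩ := hv.exists_pair
    by_cases hv0 : v =ᵐ[volume] 0
    · have : D v = 0 := by simp only [hD]; rw [doubleInt_eq_zero hp0 hv0]; rfl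
      rw [this]
      have hM0 : 0 ≤ M := Real.sSup_nonneg (by
        rintro m ⟨w, -, -, rfl⟩; exact ENNReal.toReal_nonneg)
      have := sobolevSq_nonneg v
      positivity
    · have hS := hg.sobolevSq_pos hv0
      set s : ℝ := √(sobolevSq v) with hs
      have hs0 : 0 < s := Real.sqrt_pos.2 hS
      have hs2 : s ^ 2 = sobolevSq v := Real.sq_sqrt hS.le
      have hmem : D (fun x => s⁻¹ * v x) ∈ T := by
        refine ⟨_, (hg.const_smul s⁻¹).memW12, le_of_eq ?_, rfl⟩
        rw [hg.sobolevSq_const_mul, ← hs2, inv_pow, inv_mul_cancel₀ (by positivity)]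
      have h1 : D (fun x => s⁻¹ * v x) ≤ M := le_csSup hbdd hmem
      rw [hDmul, abs_of_pos (inv_pos.2 hs0), Real.inv_rpow hs0.le] at h1
      rw [← hs2, sq_rpow_eq hs0.le]
      have : 0 < s ^ p := by positivity
      calc D v = (s ^ p)⁻¹ * (s ^ p)⁻¹ * D v * (s ^ p * s ^ p) := by field_simp
        _ ≤ M * (s ^ p * s ^ p) := by gcongr
  -- positivity of the supremum
  have hMpos : 0 < M := by
    obtain ⟨φ, hφ, hφ0⟩ := exists_test_ne_zero N
    have hg := hφ.sobolevPair
    have h1 := hhom φ hg.memW12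
    have h2 : 0 < D φ := ENNReal.toReal_pos (H.doubleInt_ne_zero hg.memLp.1 hφ0) (hDfin hg)
    have h3 := hg.sobolevSq_pos hφ0
    have h4 : 0 < M * sobolevSq φ ^ p := h2.trans_le h1
    exact pos_of_mul_pos_left h4 (by positivity)
  have hne : T.Nonempty := by
    by_contra h
    rw [not_nonempty_iff_eq_empty] at h
    rw [hM, h, Real.sSup_empty] at hMpos
    exact hMpos.false
  -- a nonvanishing translated maximizing sequence
  obtain ⟨t, δ, ht0, hδ0, havg⟩ := H.exists_ballAvg_lower_bound (half_pos hMpos)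
  obtain ⟨m, hm_mono, hm_lim, hm_mem⟩ := exists_seq_tendsto_sSup hne hbdd
  obtain ⟨n₀, hn₀⟩ := (hm_lim.eventually_const_lt (half_lt_self hMpos)).exists_forall_of_atTop
  have hseq : ∀ n, ∃ (w : RN N → ℝ) (g : RN N → RN N), SobolevPair w g ∧ sobolevSq w ≤ 1 ∧
      D w = m (n + n₀) ∧ δ < |ballAvg t w 0| := by
    intro n
    obtain ⟨v, hv, hS, hDv⟩ := hm_mem (n + n₀)
    obtain ⟨g, hg⟩ := hv.exists_pair
    obtain ⟨a, ha⟩ := havg v g hg hS (by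
      rw [ENNReal.ofReal_lt_iff_lt_toReal (half_pos hMpos).le (hDfin hg)]
      change M / 2 < D v
      rw [hDv]
      exact hn₀ _ (Nat.le_add_left _ _))
    refine ⟨fun x => v (x + a), fun x => g (x + a), hg.comp_add a, ?_, ?_, ?_⟩
    · rw [hg.sobolevSq_comp_add]; exact hS
    · simp only [hD, doubleInt_comp_add]; exact hDv
    · have : ballAvg t (fun x => v (x + a)) 0 = ballAvg t v a := by
        simp [ballAvg, add_comm]
      rwa [this]
  choose w g hw hwS hwD hwavg using hseq
  obtain ⟨u, k, φ, hφ, hu, huS, hae, hball, hpyth⟩ := exists_subseq_sobolev hw hwS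
  have hu0 : ¬ u =ᵐ[volume] 0 := by
    intro h0
    have h1 := (hball t 0).abs
    rw [ballAvg_eq_zero h0, abs_zero] at h1
    have h2 := ge_of_tendsto' h1 fun n => (hwavg (φ n)).le
    linarith
  have hσ0 := hu.sobolevSq_pos hu0
  have hDlim : Tendsto (fun n => D (w (φ n))) atTop (𝓝 M) := by
    have h1 := (hm_lim.comp (tendsto_add_atTop_nat n₀)).comp hφ.tendsto_atTop
    refine h1.congr fun n => ?_
    simp [hwD]
  have hlimit : ∀ η : ℝ≥0, 0 < η →
      M ≤ (1 + η) ^ 2 * (M * (1 - sobolevSq u) ^ p) + D u + (η + η) := by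
    intro η hη
    have hs : Tendsto (fun n => (1 + (sobolevSq (fun x => w (φ n) x - u x) - sobolevSq (w (φ n))))
        ^ p) atTop (𝓝 ((1 - sobolevSq u) ^ p)) := by
      have := (hpyth.const_add 1).rpow_const (p := p) (Or.inr hp0.le)
      simpa [sub_eq_add_neg] using this
    have hR := (((hs.const_mul M).const_mul ((1 + (η : ℝ)) ^ 2)).add_const (D u)).add_const
      ((η : ℝ) + η)
    refine le_of_tendsto_of_tendsto hDlim hR ?_
    filter_upwards [H.eventually_doubleInt_le (fun n => hw (φ n)) (fun n => hwS (φ n)) hu huS hae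
      (by simpa using hη : (1 : ℝ≥0) < 1 + η) hη] with n hn
    have hp := (hw (φ n)).sub hu
    have h1 : D (w (φ n)) ≤ (1 + η) ^ 2 * D (fun x => w (φ n) x - u x) + D u + (η + η) := by
      have h2 := hDfin hp
      have h3 := hDfin hu
      have := ENNReal.toReal_mono (by finiteness) hn
      rw [ENNReal.toReal_add (by finiteness) (by finiteness),
        ENNReal.toReal_add (by finiteness) (by finiteness), ENNReal.toReal_mul] at this
      have e1 : ((1 : ℝ≥0∞) + η).toReal = 1 + η := by
        rw [ENNReal.toReal_add (by finiteness) (by finiteness)]; simp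
      have e2 : ((η : ℝ≥0∞) + η).toReal = η + η := by
        rw [ENNReal.toReal_add (by finiteness) (by finiteness)]; simp
      rw [e2] at this
      simpa [hD, e1] using this
    refine h1.trans ?_
    gcongr
    refine (hhom _ hp.memW12).trans ?_
    gcongr
    · exact sobolevSq_nonneg _
    · linarith [hwS (φ n)]
  have hmain : M ≤ M * (1 - sobolevSq u) ^ p + D u := by
    have hc : Tendsto (fun η : ℝ => (1 + η) ^ 2 * (M * (1 - sobolevSq u) ^ p) + D u + (η + η))
        (𝓝[>] 0) (𝓝 ((1 + 0) ^ 2 * (M * (1 - sobolevSq u) ^ p) + D u + (0 + 0))) := by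
      apply tendsto_nhdsWithin_of_tendsto_nhds
      exact Continuous.tendsto (by fun_prop) 0
    have := ge_of_tendsto hc (b := M) (by
      filter_upwards [self_mem_nhdsWithin] with η hη
      have hη' : 0 < η := hη
      exact hlimit ⟨η, hη'.le⟩ hη')
    simpa using this
  have hDu := hhom u hu.memW12
  have hσ1 : sobolevSq u = 1 := by
    refine eq_one_of_one_le_rpow_add H.one_lt hσ0 huS ?_
    refine le_of_mul_le_mul_left ?_ hMpos
    linarith
  refine ⟨M, hMpos, hhom, u, hu.memW12, hσ1, le_antisymm ?_ ?_⟩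
  · simpa [hσ1] using hDu
  · simpa [hσ1, Real.zero_rpow hp0.ne'] using hmain

/-! ### The Euler–Lagrange equation -/

theorem coe_doubleInt_integrand {α p : ℝ} (hα : α ∈ Ioo (0 : ℝ) N) (w : RN N → ℝ)
    (z : RN N × RN N) :
    ((rieszNN N α (z.1 - z.2) * ‖w z.1‖₊ ^ p * ‖w z.2‖₊ ^ p : ℝ≥0) : ℝ) =
      rieszKernel α (z.1 - z.2) * |w z.1| ^ p * |w z.2| ^ p := by
  push_cast
  rw [coe_rieszNN hα]
  rfl

theorem Admissible.integrable_double {α p : ℝ} (H : Admissible N α p) {w : RN N → ℝ}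
    (hw : SubcriticalLp w) : Integrable fun z : RN N × RN N =>
      rieszKernel α (z.1 - z.2) * |w z.1| ^ p * |w z.2| ^ p := by
  simp only [← coe_doubleInt_integrand H.mem_Ioo]
  have hm := aemeasurable_doubleInt_integrand (p := p) (measurable_rieszNN α) hw.1
  refine ⟨hm.coe_nnreal_real.aestronglyMeasurable, ?_⟩
  have := H.doubleInt_ne_top hw
  rw [hasFiniteIntegral_iff_enorm, lt_top_iff_ne_top]
  refine ne_of_eq_of_ne (lintegral_congr fun z => ?_) this
  rw [enorm_eq_nnnorm, NNReal.nnnorm_eq]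

theorem Admissible.integral_double {α p : ℝ} (H : Admissible N α p) {w : RN N → ℝ}
    (hw : SubcriticalLp w) : ∫ z : RN N × RN N,
      rieszKernel α (z.1 - z.2) * |w z.1| ^ p * |w z.2| ^ p =
        (doubleInt (rieszNN N α) p w).toReal := by
  simp only [← coe_doubleInt_integrand H.mem_Ioo]
  have hm := aemeasurable_doubleInt_integrand (p := p) (measurable_rieszNN α) hw.1
  rw [integral_eq_lintegral_of_nonneg_ae (Eventually.of_forall fun z => NNReal.coe_nonneg _)
    hm.coe_nnreal_real.aestronglyMeasurable]
  simp only [ENNReal.ofReal_coe_nnreal]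
  rfl

theorem rieszConv_eq (α p : ℝ) (u : RN N → ℝ) (x : RN N) :
    rieszConv α p u x = ∫ y, rieszKernel α (x - y) * |u y| ^ p := by
  rw [rieszConv, convolution_eq_swap]
  rfl

/-- The iterated Bochner integral defining the nonlocal term agrees with the double Lebesgue
integral, by Fubini's theorem. -/
theorem Admissible.nonlocalTerm_eq {α p : ℝ} (H : Admissible N α p) {u : RN N → ℝ}
    (hu : SubcriticalLp u) :
    nonlocalTerm α p u = (doubleInt (rieszNN N α) p u).toReal := by
  rw [← H.integral_double hu, Measure.volume_eq_prod, integral_prod _ (by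
    rw [← Measure.volume_eq_prod]; exact H.integrable_double hu), nonlocalTerm]
  refine integral_congr_ae (Eventually.of_forall fun x => ?_)
  simp only
  rw [rieszConv_eq, ← integral_mul_const]
  refine integral_congr_ae (Eventually.of_forall fun y => ?_)
  simp only
  ring

/-- Domination of the factors that appear on testing the right-hand side of the equation. -/
theorem abs_abs_rpow_mul_le {p : ℝ} (hp : 1 < p) (a b : ℝ) :
    |(|a| ^ (p - 2) * a * b)| ≤ (|a| + |b|) ^ p := by
  have h0 : 0 ≤ |a| + |b| := by positivity
  have e : |(|a| ^ (p - 2) * a * b)| = |a| ^ (p - 1) * |b| := by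
    rw [abs_mul, abs_mul, abs_of_nonneg (by positivity : 0 ≤ |a| ^ (p - 2))]
    congr 1
    rcases eq_or_ne a 0 with rfl | ha
    · simp [Real.zero_rpow (by linarith : p - 1 ≠ 0)]
    · rw [← Real.rpow_add_one (abs_ne_zero.2 ha)]
      congr 1; ring
  rw [e]
  calc |a| ^ (p - 1) * |b| ≤ (|a| + |b|) ^ (p - 1) * (|a| + |b|) := by
        gcongr
        · linarith [abs_nonneg b]
        · linarith [abs_nonneg a]
    _ = (|a| + |b|) ^ p := by
        rcases h0.eq_or_lt with h | h
        · rw [← h, mul_zero, Real.zero_rpow (by linarith)]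
        · rw [← Real.rpow_add_one h.ne']; congr 1; ring

theorem aestronglyMeasurable_abs_rpow {u : RN N → ℝ} (hu : AEStronglyMeasurable u) (q : ℝ) :
    AEStronglyMeasurable fun x => |u x| ^ q :=
  (hu.norm.aemeasurable.pow_const q).aestronglyMeasurable

theorem aestronglyMeasurable_kernel_mul {α : ℝ} {f g : RN N → ℝ} (hf : AEStronglyMeasurable f)
    (hg : AEStronglyMeasurable g) : AEStronglyMeasurable fun z : RN N × RN N =>
      rieszKernel α (z.1 - z.2) * f z.1 * g z.2 := by
  have h1 : Measurable fun z : RN N × RN N => rieszKernel α (z.1 - z.2) :=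
    (measurable_rieszKernel α).comp (measurable_fst.sub measurable_snd)
  have h2 : AEStronglyMeasurable fun z : RN N × RN N => f z.1 := hf.comp_fst
  have h3 : AEStronglyMeasurable fun z : RN N × RN N => g z.2 := hg.comp_snd
  exact (h1.aestronglyMeasurable.mul h2).mul h3

theorem Admissible.integrable_kernel_mul {α p : ℝ} (H : Admissible N α p) {w f g : RN N → ℝ}
    (hw : SubcriticalLp w) (hf : AEStronglyMeasurable f) (hg : AEStronglyMeasurable g)
    (hfw : ∀ x, |f x| ≤ |w x| ^ p) (hgw : ∀ x, |g x| ≤ |w x| ^ p) :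
    Integrable fun z : RN N × RN N => rieszKernel α (z.1 - z.2) * f z.1 * g z.2 := by
  refine (H.integrable_double hw).mono' (aestronglyMeasurable_kernel_mul hf hg)
    (Eventually.of_forall fun z => ?_)
  have := rieszKernel_nonneg H.mem_Ioo (z.1 - z.2)
  rw [Real.norm_eq_abs, abs_mul, abs_mul, abs_of_nonneg this]
  gcongr
  · exact hfw _
  · exact hgw _

/-- The density of the nonlocal term tested against `ψ` is integrable on the product space. -/
theorem Admissible.integrable_rhs {α p : ℝ} (H : Admissible N α p) {u ψ : RN N → ℝ}
    (hu : SubcriticalLp u) (hψ : SubcriticalLp ψ) : Integrable fun z : RN N × RN N =>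
      rieszKernel α (z.1 - z.2) * (|u z.1| ^ (p - 2) * u z.1 * ψ z.1) * |u z.2| ^ p := by
  have hp0 : 0 ≤ p := by linarith [H.one_lt]
  have hw := hu.abs.add hψ.abs
  refine H.integrable_kernel_mul hw
    (((aestronglyMeasurable_abs_rpow hu.1 (p - 2)).mul hu.1).mul hψ.1)
    (aestronglyMeasurable_abs_rpow hu.1 p) (fun x => ?_) (fun x => ?_)
  · rw [abs_of_nonneg (by positivity : 0 ≤ |u x| + |ψ x|)]
    exact abs_abs_rpow_mul_le H.one_lt _ _
  · rw [abs_of_nonneg (by positivity : 0 ≤ |u x| + |ψ x|),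
      abs_of_nonneg (by positivity : 0 ≤ |u x| ^ p)]
    gcongr
    linarith [abs_nonneg (ψ x)]

theorem integral_rhs_inner {α p : ℝ} (u ψ : RN N → ℝ) (x : RN N) :
    ∫ y, rieszKernel α (x - y) * (|u x| ^ (p - 2) * u x * ψ x) * |u y| ^ p =
      choquardRHS α p u x * ψ x := by
  calc _ = ∫ y, (|u x| ^ (p - 2) * u x * ψ x) * (rieszKernel α (x - y) * |u y| ^ p) :=
        integral_congr_ae (Eventually.of_forall fun y => by simp only; ring)
    _ = _ := by
        rw [integral_const_mul, choquardRHS, rieszConv_eq]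
        ring

theorem Admissible.integral_rhs {α p : ℝ} (H : Admissible N α p) {u ψ : RN N → ℝ}
    (hu : SubcriticalLp u) (hψ : SubcriticalLp ψ) : ∫ z : RN N × RN N,
      rieszKernel α (z.1 - z.2) * (|u z.1| ^ (p - 2) * u z.1 * ψ z.1) * |u z.2| ^ p =
        ∫ x, choquardRHS α p u x * ψ x := by
  have h := H.integrable_rhs hu hψ
  rw [Measure.volume_eq_prod] at h ⊢
  rw [integral_prod _ h]
  exact integral_congr_ae (Eventually.of_forall fun x => integral_rhs_inner u ψ x)

theorem Admissible.integrable_choquardRHS_mul {α p : ℝ} (H : Admissible N α p) {u ψ : RN N → ℝ}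
    (hu : SubcriticalLp u) (hψ : SubcriticalLp ψ) :
    Integrable fun x => choquardRHS α p u x * ψ x := by
  have h := H.integrable_rhs hu hψ
  rw [Measure.volume_eq_prod] at h
  exact h.integral_prod_left.congr
    (Eventually.of_forall fun x => integral_rhs_inner u ψ x)

theorem subcriticalLp_indicator_ball (R : ℝ) :
    SubcriticalLp ((Metric.ball (0 : RN N) R).indicator fun _ => (1 : ℝ)) :=
  subcriticalLp_of_memLp fun q =>
    memLp_indicator_const q measurableSet_ball 1 (Or.inr measure_ball_lt_top.ne)

/-- The right-hand side is integrable on balls, as can be seen by testing with their indicators. -/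
theorem Admissible.locallyIntegrable_choquardRHS {α p : ℝ} (H : Admissible N α p)
    {u : RN N → ℝ} (hu : SubcriticalLp u) : LocallyIntegrable (choquardRHS α p u) := by
  intro x
  have h := H.integrable_choquardRHS_mul hu (subcriticalLp_indicator_ball (N := N) (‖x‖ + 1))
  refine ⟨Metric.ball 0 (‖x‖ + 1), Metric.isOpen_ball.mem_nhds (by simp), ?_⟩
  rw [← integrable_indicator_iff measurableSet_ball]
  refine h.congr (Eventually.of_forall fun y => ?_)
  by_cases hy : y ∈ Metric.ball (0 : RN N) (‖x‖ + 1)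
  · simp [indicator_of_mem hy]
  · simp [indicator_of_notMem hy]

/-- The product of `I_α(x - y) |u(y)|^p` with the indicator of a ball in the variable `x` is
integrable on the product space, so that Fubini's theorem applies ball by ball. -/
theorem Admissible.convolutionExistsAt {α p : ℝ} (H : Admissible N α p)
    {u : RN N → ℝ} (hu : SubcriticalLp u) :
    ∀ᵐ x, ConvolutionExistsAt (rieszKernel α) (fun y => |u y| ^ p) x
      (ContinuousLinearMap.mul ℝ ℝ) volume := by
  have hp0 : 0 < p := by linarith [H.one_lt]
  have key : ∀ n : ℕ, ∀ᵐ x : RN N, Integrable fun y => rieszKernel α (x - y) *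
      (Metric.ball (0 : RN N) n).indicator (fun _ => (1 : ℝ)) x * |u y| ^ p := by
    intro n
    set χ : RN N → ℝ := (Metric.ball (0 : RN N) n).indicator fun _ => (1 : ℝ) with hχ
    have hχs : SubcriticalLp χ := subcriticalLp_indicator_ball (N := N) n
    have hw := hu.abs.add hχs.abs
    have h := H.integrable_kernel_mul hw hχs.1 (aestronglyMeasurable_abs_rpow hu.1 p)
      (fun x => ?_) (fun x => ?_)
    · rw [Measure.volume_eq_prod] at h
      exact h.prod_right_ae
    · rw [abs_of_nonneg (by positivity : 0 ≤ |u x| + |χ x|)]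
      by_cases hx : x ∈ Metric.ball (0 : RN N) n
      · have e : χ x = 1 := by rw [hχ, indicator_of_mem hx]
        rw [e, abs_one]
        exact Real.one_le_rpow (by linarith [abs_nonneg (u x)]) hp0.le
      · have e : χ x = 0 := by rw [hχ, indicator_of_notMem hx]
        rw [e, abs_zero]
        positivity
    · rw [abs_of_nonneg (by positivity : 0 ≤ |u x| + |χ x|),
        abs_of_nonneg (by positivity : 0 ≤ |u x| ^ p)]
      gcongr
      linarith [abs_nonneg (χ x)]
  filter_upwards [ae_all_iff.2 key] with x hx
  obtain ⟨n, hn⟩ := exists_nat_gt ‖x‖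
  have hmem : x ∈ Metric.ball (0 : RN N) n := by simpa using hn
  have h1 := (hx n).comp_sub_left x
  simp only [indicator_of_mem hmem, sub_sub_cancel, mul_one] at h1
  exact h1

/-- The derivative of the nonlocal term in the direction of `φ`. The two factors contribute equally,
because the kernel is even. -/
theorem Admissible.hasDerivAt_integral_double {α p : ℝ} (H : Admissible N α p) {u φ : RN N → ℝ}
    (hu : SubcriticalLp u) (hφ : SubcriticalLp φ) :
    HasDerivAt (fun s : ℝ => ∫ z : RN N × RN N,
      rieszKernel α (z.1 - z.2) * |u z.1 + s * φ z.1| ^ p * |u z.2 + s * φ z.2| ^ p)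
      (2 * p * ∫ x, choquardRHS α p u x * φ x) 0 := by
  have hp0 : 0 < p := by linarith [H.one_lt]
  set w : RN N → ℝ := fun x => |u x| + |φ x| with hw
  have hws : SubcriticalLp w := hu.abs.add hφ.abs
  have hw0 : ∀ x, 0 ≤ w x := fun x => by positivity
  set v : ℝ → RN N → ℝ := fun s x => u x + s * φ x with hv
  have hvm : ∀ s, AEStronglyMeasurable (v s) := fun s => hu.1.add (hφ.1.const_mul s)
  have hvw : ∀ s ∈ Metric.ball (0 : ℝ) 1, ∀ x, |v s x| ≤ w x := by
    intro s hs x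
    have hs' : |s| ≤ 1 := by simpa using (mem_ball_zero_iff.1 hs).le
    calc |v s x| ≤ |u x| + |s| * |φ x| := by rw [← abs_mul]; exact abs_add_le _ _
      _ ≤ |u x| + 1 * |φ x| := by gcongr
      _ = w x := by rw [one_mul]
  set d : ℝ → RN N → ℝ := fun s x => p * |v s x| ^ (p - 2) * v s x * φ x with hd
  have hdm : ∀ s, AEStronglyMeasurable (d s) := fun s =>
    (((aestronglyMeasurable_abs_rpow (hvm s) (p - 2)).const_mul p).mul (hvm s)).mul hφ.1
  have hdb : ∀ s ∈ Metric.ball (0 : ℝ) 1, ∀ x, |d s x| ≤ p * (2 ^ p * w x ^ p) := by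
    intro s hs x
    have e : d s x = p * (|v s x| ^ (p - 2) * v s x * φ x) := by simp only [hd]; ring
    rw [e, abs_mul, abs_of_pos hp0]
    gcongr
    refine (abs_abs_rpow_mul_le H.one_lt _ _).trans ?_
    rw [← Real.mul_rpow (by norm_num) (hw0 x)]
    gcongr
    have h1 := hvw s hs x
    have h2 : |φ x| ≤ w x := by simp only [hw]; linarith [abs_nonneg (u x)]
    linarith
  have hvd : ∀ s x, HasDerivAt (fun s => |v s x| ^ p) (d s x) s := by
    intro s x
    have h1 : HasDerivAt (fun s => v s x) (φ x) s := by
      simpa [hv] using ((hasDerivAt_id s).mul_const (φ x)).const_add (u x)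
    exact (hasDerivAt_abs_rpow (v s x) H.one_lt).comp s h1
  have main := hasDerivAt_integral_of_dominated_loc_of_deriv_le
    (μ := (volume : Measure (RN N × RN N)))
    (F := fun s z => rieszKernel α (z.1 - z.2) * |v s z.1| ^ p * |v s z.2| ^ p)
    (F' := fun s z => rieszKernel α (z.1 - z.2) * d s z.1 * |v s z.2| ^ p +
      rieszKernel α (z.1 - z.2) * |v s z.1| ^ p * d s z.2)
    (bound := fun z => (2 * p * 2 ^ p) *
      (rieszKernel α (z.1 - z.2) * |w z.1| ^ p * |w z.2| ^ p))
    (x₀ := 0) (s := Metric.ball (0 : ℝ) 1) (Metric.ball_mem_nhds 0 one_pos)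
    (Eventually.of_forall fun s => aestronglyMeasurable_kernel_mul
      (aestronglyMeasurable_abs_rpow (hvm s) p) (aestronglyMeasurable_abs_rpow (hvm s) p))
    (by
      have := H.integrable_double hu
      simpa [hv] using this)
    ((aestronglyMeasurable_kernel_mul (hdm 0) (aestronglyMeasurable_abs_rpow (hvm 0) p)).add
      (aestronglyMeasurable_kernel_mul (aestronglyMeasurable_abs_rpow (hvm 0) p) (hdm 0)))
    (Eventually.of_forall fun z s hs => by
      have k0 := rieszKernel_nonneg H.mem_Ioo (z.1 - z.2)
      have habs : ∀ a b c : ℝ, 0 ≤ a → 0 ≤ c → |a * b * c| = a * |b| * c := fun a b c ha hc => by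
        rw [abs_mul, abs_mul, abs_of_nonneg ha, abs_of_nonneg hc]
      have b1 := hdb s hs z.1
      have b2 := hdb s hs z.2
      have c1 : |v s z.1| ^ p ≤ w z.1 ^ p := Real.rpow_le_rpow (abs_nonneg _) (hvw s hs _) hp0.le
      have c2 : |v s z.2| ^ p ≤ w z.2 ^ p := Real.rpow_le_rpow (abs_nonneg _) (hvw s hs _) hp0.le
      have w1 := hw0 z.1
      have w2 := hw0 z.2
      rw [abs_of_nonneg w1, abs_of_nonneg w2, Real.norm_eq_abs]
      calc _ ≤ |rieszKernel α (z.1 - z.2) * d s z.1 * |v s z.2| ^ p| +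
            |rieszKernel α (z.1 - z.2) * |v s z.1| ^ p * d s z.2| := abs_add_le _ _
        _ = rieszKernel α (z.1 - z.2) * |d s z.1| * |v s z.2| ^ p +
            rieszKernel α (z.1 - z.2) * |v s z.1| ^ p * |d s z.2| := by
            rw [habs _ (d s z.1) _ k0 (Real.rpow_nonneg (abs_nonneg _) p),
              abs_mul (_ * _) (d s z.2),
              abs_of_nonneg (mul_nonneg k0 (Real.rpow_nonneg (abs_nonneg _) p))]
        _ ≤ rieszKernel α (z.1 - z.2) * (p * (2 ^ p * w z.1 ^ p)) * w z.2 ^ p +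
            rieszKernel α (z.1 - z.2) * w z.1 ^ p * (p * (2 ^ p * w z.2 ^ p)) := by gcongr
        _ = _ := by ring)
    ((H.integrable_double hws).const_mul _)
    (Eventually.of_forall fun z s _ => by
      have := ((hvd s z.1).const_mul (rieszKernel α (z.1 - z.2))).mul (hvd s z.2)
      exact this)
  have hder := main.2
  have i1 := H.integrable_rhs hu hφ
  have i2 : Integrable fun z : RN N × RN N =>
      rieszKernel α (z.1 - z.2) * |u z.1| ^ p * (|u z.2| ^ (p - 2) * u z.2 * φ z.2) := by
    have := i1.swap
    refine this.congr (Eventually.of_forall fun z => ?_)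
    simp only [Function.comp_apply, Prod.fst_swap, Prod.snd_swap]
    rw [← neg_sub z.1 z.2, rieszKernel_neg]
    ring
  have e2 : ∫ z : RN N × RN N,
      rieszKernel α (z.1 - z.2) * |u z.1| ^ p * (|u z.2| ^ (p - 2) * u z.2 * φ z.2) =
      ∫ x, choquardRHS α p u x * φ x := by
    rw [← H.integral_rhs hu hφ, Measure.volume_eq_prod, ← integral_prod_swap]
    refine integral_congr_ae (Eventually.of_forall fun z => ?_)
    simp only [Prod.fst_swap, Prod.snd_swap]
    rw [← neg_sub z.1 z.2, rieszKernel_neg]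
    ring
  have e : ∫ z : RN N × RN N, (rieszKernel α (z.1 - z.2) * d 0 z.1 * |v 0 z.2| ^ p +
      rieszKernel α (z.1 - z.2) * |v 0 z.1| ^ p * d 0 z.2) =
      2 * p * ∫ x, choquardRHS α p u x * φ x := by
    calc _ = ∫ z : RN N × RN N, (p * (rieszKernel α (z.1 - z.2) *
          (|u z.1| ^ (p - 2) * u z.1 * φ z.1) * |u z.2| ^ p) + p * (rieszKernel α (z.1 - z.2) *
          |u z.1| ^ p * (|u z.2| ^ (p - 2) * u z.2 * φ z.2))) := by
          refine integral_congr_ae (Eventually.of_forall fun z => ?_)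
          simp only [hd, hv, zero_mul, add_zero]
          ring
      _ = _ := by
          rw [integral_add (i1.const_mul p) (i2.const_mul p), integral_const_mul,
            integral_const_mul, e2, H.integral_rhs hu hφ]
          ring
  rw [← e]
  exact hder

theorem sobolevSq_add_mul {u φ : RN N → ℝ} (hu : MemW12 u) (hφ : IsTestFunction φ) (s : ℝ) :
    sobolevSq (fun x => u x + s * φ x) = sobolevSq u +
      2 * s * (∫ x, (inner ℝ (weakGrad u x) (gradient φ x) + u x * φ x)) +
      s ^ 2 * sobolevSq φ := by
  have pu := hu.sobolevPair
  have pφ := hφ.sobolevPair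
  have e1 := (pu.add (pφ.const_smul s)).sobolevSq_eq
  have j1 : Integrable fun x => ‖weakGrad u x‖ ^ 2 + |u x| ^ 2 :=
    (pu.memLp_grad.integrable_norm_pow (by norm_num)).add
      (pu.memLp.integrable_norm_pow (by norm_num))
  have j3 : Integrable fun x => ‖gradient φ x‖ ^ 2 + |φ x| ^ 2 :=
    (pφ.memLp_grad.integrable_norm_pow (by norm_num)).add
      (pφ.memLp.integrable_norm_pow (by norm_num))
  have j2 : Integrable fun x => inner ℝ (weakGrad u x) (gradient φ x) + u x * φ x := by
    have a1 : Integrable fun x => inner ℝ (weakGrad u x) (gradient φ x) := by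
      refine (L2.integrable_inner (𝕜 := ℝ) (pu.memLp_grad.toLp _)
        (pφ.memLp_grad.toLp _)).congr ?_
      filter_upwards [pu.memLp_grad.coeFn_toLp, pφ.memLp_grad.coeFn_toLp] with x h1 h2
      rw [h1, h2]
    have a2 : Integrable fun x => u x * φ x :=
      (memLp_locallyIntegrable pu.memLp).integrable_smul_right_of_hasCompactSupport
        hφ.continuous hφ.2
    exact a1.add a2
  have j12 : Integrable fun x => (‖weakGrad u x‖ ^ 2 + |u x| ^ 2) +
      2 * s * (inner ℝ (weakGrad u x) (gradient φ x) + u x * φ x) := j1.add (j2.const_mul _)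
  rw [e1, pu.sobolevSq_eq, pφ.sobolevSq_eq, ← integral_const_mul, ← integral_const_mul,
    ← integral_add j1 (j2.const_mul _), ← integral_add j12 (j3.const_mul _)]
  refine integral_congr_ae (Eventually.of_forall fun x => ?_)
  simp only [sq_abs]
  rw [norm_add_sq_real, inner_smul_right, norm_smul, mul_pow, Real.norm_eq_abs, sq_abs]
  ring

/-- A function on the Nehari set that realizes the optimal constant in `D(v) ≤ M S(v)^p` solves
the Choquard equation: `s ↦ M S(u + s φ)^p - D(u + s φ)` has a minimum at `0`. -/
theorem Admissible.isWeakSolution {α p M : ℝ} (H : Admissible N α p)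
    (hM : ∀ v, MemW12 v → (doubleInt (rieszNN N α) p v).toReal ≤ M * sobolevSq v ^ p)
    {u : RN N → ℝ} (hu : MemW12 u) (hS : 0 < sobolevSq u)
    (hDS : (doubleInt (rieszNN N α) p u).toReal = sobolevSq u)
    (hDM : (doubleInt (rieszNN N α) p u).toReal = M * sobolevSq u ^ p) :
    IsWeakSolution α p u := by
  have hp0 : 0 < p := by linarith [H.one_lt]
  have pu := hu.sobolevPair
  have su := pu.subcriticalLp H.one_le
  refine ⟨hu, H.convolutionExistsAt su, H.locallyIntegrable_choquardRHS su, fun φ hφ => ?_⟩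
  have pφ := hφ.sobolevPair
  have sφ : SubcriticalLp φ := subcriticalLp_of_memLp hφ.memLp
  set L : ℝ := ∫ x, (inner ℝ (weakGrad u x) (gradient φ x) + u x * φ x) with hL
  set f : ℝ → ℝ := fun s => M * (sobolevSq u + 2 * s * L + s ^ 2 * sobolevSq φ) ^ p -
    ∫ z : RN N × RN N,
      rieszKernel α (z.1 - z.2) * |u z.1 + s * φ z.1| ^ p * |u z.2 + s * φ z.2| ^ p with hf
  have hpair : ∀ s : ℝ, SobolevPair (fun x => u x + s * φ x)
      (fun x => weakGrad u x + s • gradient φ x) := fun s => pu.add (pφ.const_smul s)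
  have hfnonneg : ∀ s, 0 ≤ f s := by
    intro s
    have h1 := hM _ (hpair s).memW12
    rw [sobolevSq_add_mul hu hφ, ← H.integral_double ((hpair s).subcriticalLp H.one_le)] at h1
    exact sub_nonneg.2 h1
  have hf0 : f 0 = 0 := by
    have h1 := H.integral_double su
    simp only [hf, zero_mul, add_zero, mul_zero, ne_eq, OfNat.ofNat_ne_zero, not_false_eq_true,
      zero_pow]
    rw [h1, hDM, sub_self]
  have hmin : IsLocalMin f 0 := Eventually.of_forall fun s => by rw [hf0]; exact hfnonneg s
  have hq : HasDerivAt (fun s : ℝ => sobolevSq u + 2 * s * L + s ^ 2 * sobolevSq φ) (2 * L) 0 := by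
    have h1 : HasDerivAt (fun s : ℝ => 2 * s * L) (2 * L) 0 := by
      simpa using ((hasDerivAt_id (0 : ℝ)).const_mul 2).mul_const L
    have h2 : HasDerivAt (fun s : ℝ => s ^ 2 * sobolevSq φ) 0 0 := by
      simpa using (hasDerivAt_pow 2 (0 : ℝ)).mul_const (sobolevSq φ)
    exact ((h1.const_add (sobolevSq u)).add h2).congr_deriv (by simp)
  have hder : HasDerivAt f (M * (2 * L * p * sobolevSq u ^ (p - 1)) -
      2 * p * ∫ x, choquardRHS α p u x * φ x) 0 := by
    have h1 := hq.rpow_const (p := p) (Or.inr H.one_lt.le)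
    have h2 := (h1.const_mul M).sub (H.hasDerivAt_integral_double su sφ)
    exact h2.congr_deriv (by simp)
  have hz := hmin.hasDerivAt_eq_zero hder
  have hM1 : M * sobolevSq u ^ (p - 1) = 1 := by
    have h1 : M * sobolevSq u ^ p = sobolevSq u := by rw [← hDM, hDS]
    rw [Real.rpow_sub_one hS.ne', mul_div_assoc', h1, div_self hS.ne']
  have h3 : 2 * p * (L - ∫ x, choquardRHS α p u x * φ x) = 0 := by
    calc _ = (M * sobolevSq u ^ (p - 1)) * (2 * p * L) -
          2 * p * ∫ x, choquardRHS α p u x * φ x := by rw [hM1]; ring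
      _ = _ := by rw [← hz]; ring
  have h4 := (mul_eq_zero.1 h3).resolve_left (by positivity)
  linarith

/-! ### Minimization on the Nehari set -/

theorem energy_eq {α p : ℝ} {v : RN N → ℝ} (h : sobolevSq v = nonlocalTerm α p v) :
    energy α p v = (1 / 2 - 1 / (2 * p)) * sobolevSq v := by
  rw [energy, ← h]; ring

theorem MemW12.subcriticalLp (hN : 1 ≤ N) {v : RN N → ℝ} (hv : MemW12 v) : SubcriticalLp v :=
  hv.sobolevPair.subcriticalLp hN

/-- A rescaled maximizer of `D(v) / S(v)^p` lies on the Nehari set, solves the Choquard equation,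
and has the smallest `S` on the Nehari set. -/
theorem Admissible.exists_groundstate {α p : ℝ} (H : Admissible N α p) :
    ∃ u : RN N → ℝ, MemW12 u ∧ ¬ u =ᵐ[volume] 0 ∧ IsWeakSolution α p u ∧
      u ∈ nehariSet N α p ∧ IsLeast (energy α p '' nehariSet N α p) (energy α p u) := by
  obtain ⟨M, hM0, hM, u₀, hu₀, hS₀, hD₀⟩ := H.exists_maximizer
  have hp1 : 0 < p - 1 := by linarith [H.one_lt]
  have hp0 : 0 < p := by linarith
  -- `a` solves `a = M * a ^ p`, so that `√a * u₀` lies on the Nehari set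
  obtain ⟨a, ha0, haM⟩ : ∃ a : ℝ, 0 < a ∧ M * a ^ (p - 1) = 1 :=
    ⟨(1 / M) ^ (1 / (p - 1)), by positivity, by
      rw [← Real.rpow_mul (by positivity), one_div_mul_cancel hp1.ne', Real.rpow_one,
        mul_one_div_cancel hM0.ne']⟩
  have haM' : M * a ^ p = a := by
    have h : a ^ p = a ^ (p - 1) * a := by
      rw [← Real.rpow_add_one ha0.ne']; congr 1; ring
    rw [h, ← mul_assoc, haM, one_mul]
  set t : ℝ := √a with ht
  have ht0 : 0 ≤ t := Real.sqrt_nonneg a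
  have ht2 : t ^ 2 = a := Real.sq_sqrt ha0.le
  have hu : MemW12 fun x => t * u₀ x := (hu₀.sobolevPair.const_smul t).memW12
  have hS : sobolevSq (fun x => t * u₀ x) = a := by
    rw [hu₀.sobolevPair.sobolevSq_const_mul, hS₀, mul_one, ht2]
  have hD : (doubleInt (rieszNN N α) p fun x => t * u₀ x).toReal = M * a ^ p := by
    rw [doubleInt_const_mul, ENNReal.toReal_mul, hD₀, ← ht2, sq_rpow_eq ht0]
    simp only [ENNReal.coe_toReal, NNReal.coe_mul, NNReal.coe_rpow, coe_nnnorm,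
      Real.norm_eq_abs, abs_of_nonneg ht0]
    ring
  have hne : ¬ (fun x => t * u₀ x) =ᵐ[volume] 0 := fun h => by
    rw [doubleInt_eq_zero hp0 h, ENNReal.toReal_zero, haM'] at hD
    exact ha0.ne hD
  have hN : (fun x => t * u₀ x) ∈ nehariSet N α p :=
    ⟨hu, hne, by rw [H.nonlocalTerm_eq (hu.subcriticalLp H.one_le), hD, hS, haM']⟩
  refine ⟨_, hu, hne, H.isWeakSolution hM hu (hS ▸ ha0) (by rw [hD, hS, haM']) (by rw [hD, hS]),
    hN, ⟨_, hN, rfl⟩, ?_⟩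
  rintro _ ⟨v, hv, rfl⟩
  have hSD := hv.2.2
  have hSv : 0 < sobolevSq v := hv.1.sobolevPair.sobolevSq_pos hv.2.1
  have h1 : sobolevSq v ≤ M * sobolevSq v ^ p := by
    calc sobolevSq v = _ := hSD.trans (H.nonlocalTerm_eq (hv.1.subcriticalLp H.one_le))
      _ ≤ _ := hM v hv.1
  have h2 : a ^ (p - 1) ≤ sobolevSq v ^ (p - 1) := by
    have h : sobolevSq v ^ p = sobolevSq v ^ (p - 1) * sobolevSq v := by
      rw [← Real.rpow_add_one hSv.ne']; congr 1; ring
    rw [h, ← mul_assoc] at h1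
    have h3 : 1 ≤ M * sobolevSq v ^ (p - 1) := le_of_mul_le_mul_right (by linarith) hSv
    exact le_of_mul_le_mul_left (haM.trans_le h3) hM0
  have h4 : a ≤ sobolevSq v := (Real.rpow_le_rpow_iff ha0.le hSv.le hp1).1 h2
  rw [energy_eq hSD, energy_eq hN.2.2, hS]
  refine mul_le_mul_of_nonneg_left h4 (sub_nonneg.2 ?_)
  exact one_div_le_one_div_of_le two_pos (by linarith [H.one_lt])

end Choquard

end

theorem theorem1 (N : ℕ) (hN : 1 ≤ N) (α p : ℝ) (hα : α ∈ Set.Ioo (0 : ℝ) N) (hp : 1 < p)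
    (hlow : ((N : ℝ) - 2) / (N + α) < 1 / p) (hupp : 1 / p < (N : ℝ) / (N + α)) :
    -- the energy is well defined on `W^{1,2}`: the double integral converges absolutely
    (∀ v : Choquard.RN N → ℝ, Choquard.MemW12 v →
      MeasureTheory.Integrable (fun z : Choquard.RN N × Choquard.RN N =>
        Choquard.rieszKernel α (z.1 - z.2) * |v z.2| ^ p * |v z.1| ^ p)) ∧
    ∃ u : Choquard.RN N → ℝ,
      Choquard.MemW12 u ∧
      ¬ u =ᵐ[MeasureTheory.volume] 0 ∧
      Choquard.IsWeakSolution α p u ∧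
      u ∈ Choquard.nehariSet N α p ∧
      IsLeast (Choquard.energy α p '' Choquard.nehariSet N α p) (Choquard.energy α p u) := by
  have H : Choquard.Admissible N α p := ⟨hN, hα, hp, hlow, hupp⟩
  refine ⟨fun v hv => ?_, H.exists_groundstate⟩
  simpa only [mul_right_comm] using H.integrable_double (hv.subcriticalLp hN)
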